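/- Let $\{(b_k,e_k)\}_{k\ge 0}$ be independent, identically distributed random vectors in $\mathbb R^2$ with $Eb_0=0$, $Eb_0^2=\omega^2>0$, $Ee_0=0$, $Ee_0^2=\sigma^2>0$, $\operatorname{cov}(b_0,e_0)=0$, $Eb_0^4<\infty$ and $Ee_0^4<\infty$. Let $\varphi\in\mathbb R$ satisfy $E\log|\varphi+b_0|\ge 0$ (with $\log 0=-\infty$). Let $X_0$ be a constant and $$X_k=(\varphi+b_k)X_{k-1}+e_k,\qquad k\ge 1.$$ For $s\in\mathbb R$, $x>0$, $y>0$ put $$L_n(s,x,y)=-\frac12\sum_{k=1}^n\left(\log(xX_{k-1}^2+y)+\frac{(X_k-sX_{k-1})^2}{xX_{k-1}^2+y}\right).$$ Let $\Gamma=\{(s,x): s_*\le s\le s^*,\ x_*\le x\le x^*\}$ with $0<x_*$, and assume that $(\varphi,\omega^2)$ lies in the interior of $\Gamma$, i.e. $s_*<\varphi<s^*$ and $x_*<\omega^2<x^*$. For each $n$ let $\widehat\eta_n(\sigma^2)$ be a (measurable) quasi-maximum likelihood estimator computed at the true value $y=\sigma^2$: a random point of $\Gamma$ with $$L_n(\widehat\eta_n(\sigma^2),\sigma^2)=\max_{z\in\Gamma}L_n(z,\sigma^2)\quad\text{a.s.}$$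 Then the matrix $$\Omega_0=\begin{pmatrix}\omega^2 & Eb_0^3\\ Eb_0^3 & \operatorname{var}(b_0^2)\end{pmatrix}$$ is positive semidefinite and, as $n\to\infty$, $\sqrt n\,\bigl(\widehat\eta_n(\sigma^2)-(\varphi,\omega^2)\bigr)$ converges in distribution to the bivariate normal distribution $N_2(0,\Omega_0)$ with mean $0$ and covariance matrix $\Omega_0$. -/

import Mathlib

open MeasureTheory ProbabilityTheory Filter Topology

/-- The random coefficient autoregression `X 0 = x₀`, `X k = (φ + b k) * X (k - 1) + e k`
for `k ≥ 1`. -/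
def rcaProcess {Ω : Type*} (φ x₀ : ℝ) (b e : ℕ → Ω → ℝ) : ℕ → Ω → ℝ
  | 0, _ => x₀
  | k + 1, w => (φ + b (k + 1) w) * rcaProcess φ x₀ b e k w + e (k + 1) w

/-- The summand `ℓ_k(s, x, y)` of the Gaussian conditional log-likelihood of a path
`X : ℕ → ℝ` (constant terms omitted). It is used for `1 ≤ k` only. -/
noncomputable def quasiLogLikTerm (X : ℕ → ℝ) (k : ℕ) (s x y : ℝ) : ℝ :=
  -(1 / 2) * (Real.log (x * X (k - 1) ^ 2 + y)
    + (X k - s * X (k - 1)) ^ 2 / (x * X (k - 1) ^ 2 + y))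

/-- The quasi-log-likelihood `L_n(s, x, y) = ∑_{1 ≤ k ≤ n} ℓ_k(s, x, y)`. -/
noncomputable def quasiLogLik (X : ℕ → ℝ) (n : ℕ) (s x y : ℝ) : ℝ :=
  ∑ k ∈ Finset.Icc 1 n, quasiLogLikTerm X k s x y

/-- The parameter rectangle `Γ = {(s, x) : s_* ≤ s ≤ s^*, x_* ≤ x ≤ x^*}`. -/
def paramRect (sLo sHi xLo xHi : ℝ) : Set (EuclideanSpace ℝ (Fin 2)) :=
  {z | z 0 ∈ Set.Icc sLo sHi ∧ z 1 ∈ Set.Icc xLo xHi}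

/-- `η` is a quasi-maximum likelihood estimate at level `y` from the path `X` up to time `n`:
a point of `Γ` at which `z ↦ L_n(z, y)` attains its maximum over `Γ`. -/
def IsQMLE (Γ : Set (EuclideanSpace ℝ (Fin 2))) (X : ℕ → ℝ) (n : ℕ) (y : ℝ)
    (η : EuclideanSpace ℝ (Fin 2)) : Prop :=
  η ∈ Γ ∧ ∀ z ∈ Γ, quasiLogLik X n (z 0) (z 1) y ≤ quasiLogLik X n (η 0) (η 1) y

/-- The asymptotic covariance matrix, for `β` distributed as the random coefficient `b₀`:
the covariance matrix of `(β, β ^ 2)` when `β` is centred with variance `ω2`. -/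
noncomputable def asympCov {Ω : Type*} [MeasurableSpace Ω] (P : Measure Ω) (ω2 : ℝ)
    (β : Ω → ℝ) : Matrix (Fin 2) (Fin 2) ℝ :=
  !![ω2, ∫ w, β w ^ 3 ∂P; ∫ w, β w ^ 3 ∂P, Var[fun w => β w ^ 2; P]]

/-! Write `A = φ + b`. Where `|X_{k-1}|` is large, `X_k / X_{k-1}` is nearly `φ + b_k`. Up to a term
free of the parameters, the quasi-likelihood is then that of a Gaussian sample `φ + b_1, ..., φ +
b_n` with mean `s` and variance `x`. To first order its maximiser is `φ` plus the average of the
`b_k` in the first coordinate and the average of the `b_k²` in the second. The limit law is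
therefore the one in the central limit theorem for `(b, b² - ω²)`. Its covariance is `Ω₀`, which is
positive semidefinite because its quadratic form is the mean of a square.

The analysis of the estimator is deterministic on a "good" path (`PathGood`). A comparison of
likelihood values gives consistency (`exists_consistency`), hence an interior maximiser and
vanishing scores. Multiplied by `x` or `-x²`, the score equations become the two sample-moment
equations plus sums of noise times weights of size `O(1 / √(1 + X²))` (`score_s_expand`,
`score_x_expand`). The choice `y = σ²` is what centres the term in `e² - y`. With the weights frozen
at `ω²`, the centred sums are martingale transforms of variance `o(n)`, hence negligible against
`√n`. Replacing `ω²` by the estimate costs a Lipschitz error, which is absorbed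
(`exists_linearization`).

Good paths have probability tending to one as soon as the Cesàro means of `E 1 / √(1 + X_k²)` tend
to zero (`IsNoise.tendsto_mean_inv_sqrt_of_log`), and this is where `E log |A| ≥ 0` enters. The
proof uses a Lyapunov function `V` whose mean increases outside a compact set, uniformly on bounded
annuli, while `E V(X_n) = o(n)`. Summing the increments shows that every annulus is visited `o(n)`
times in mean. A second and fourth moment argument (`IsNoise.exists_exit`) carries this over to
compact sets, because from a compact set the process reaches an annulus after a fixed number of
steps with probability bounded below.

The function `V` depends on the case. If `E log |A| > 0`, it is `√(log⁺ |x|)`: its drift is of order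
`1 / √(log |x|)`, and its mean is `O(√n)` because `E log⁺ |X_n| = O(n)`. If `E log |A| = 0` and
`|A|` is not a.s. one, it is `(√(log⁺ |x|) - 1/2)²`: the concave correction `-√(log⁺)` turns the
variance of `log |A|` into a positive drift, and fractional moments `E |A|^θ` with small `θ` give `E
log⁺ |X_n| = o(n)`. If `|A| = 1` a.s., it is `√(1 + x²)`: strict convexity gives the drift, and `E
X_n²` is linear in `n`. -/

lemma quasiLogLik_eq_sum_range (X : ℕ → ℝ) (n : ℕ) (s x y : ℝ) :
    quasiLogLik X n s x y = ∑ k ∈ Finset.range n, quasiLogLikTerm X (k + 1) s x y := by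
  unfold quasiLogLik
  induction n with
  | zero => simp
  | succ n ih => rw [Finset.sum_Icc_succ_top (by omega), ih, Finset.sum_range_succ]

/-! ### Weights in the score equations: decay and Lipschitz bounds. -/

section Weights

variable {xLo xHi y : ℝ}

/-- The five weights `w (x, X)` that occur in the score equations. -/
noncomputable def scoreWeight (y : ℝ) (i : Fin 5) (x X : ℝ) : ℝ :=
  ![1 / (x * X ^ 2 + y), X / (x * X ^ 2 + y), 1 - (x * X ^ 2 / (x * X ^ 2 + y)) ^ 2,
    X ^ 3 / (x * X ^ 2 + y) ^ 2, X ^ 2 / (x * X ^ 2 + y) ^ 2] i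

lemma measurable_scoreWeight (y : ℝ) (i : Fin 5) (x : ℝ) : Measurable (scoreWeight y i x) := by
  fin_cases i <;> (unfold scoreWeight; simp; fun_prop)

lemma one_le_sqrt_one_add_sq (X : ℝ) : 1 ≤ √(1 + X ^ 2) :=
  Real.one_le_sqrt.2 (by nlinarith [sq_nonneg X])

lemma abs_le_sqrt_one_add_sq (X : ℝ) : |X| ≤ √(1 + X ^ 2) :=
  Real.abs_le_sqrt (by linarith)

lemma exists_le_quad (hxLo : 0 < xLo) (hy : 0 < y) :
    ∃ c, 0 < c ∧ ∀ x, xLo ≤ x → ∀ X : ℝ, c * √(1 + X ^ 2) ^ 2 ≤ x * X ^ 2 + y := by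
  refine ⟨min xLo y, lt_min hxLo hy, fun x hx X => ?_⟩
  rw [Real.sq_sqrt (by positivity)]
  nlinarith [min_le_left xLo y, min_le_right xLo y, sq_nonneg X]

/-- Every weight is built from the bounded quantity `X² / (x X² + y)` and from factors that decay at
least like `1 / √(1 + X²)`. The third weight decays because `x X² / (x X² + y) = 1 - y / (x X² +
y)`. Changing `x` multiplies by another bounded factor, so the Lipschitz bound keeps the same decay
in `X`. -/
lemma exists_scoreWeight_bound (hxLo : 0 < xLo) (hy : 0 < y) :
    ∃ B, 0 < B ∧ ∀ i : Fin 5, ∀ x, xLo ≤ x → ∀ X : ℝ,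
      |scoreWeight y i x X| ≤ B / √(1 + X ^ 2) ∧
      ∀ x', xLo ≤ x' →
        |scoreWeight y i x X - scoreWeight y i x' X| ≤ B * |x - x'| / √(1 + X ^ 2) := by
  obtain ⟨c, hc, hq⟩ := exists_le_quad hxLo hy
  -- basic bounds, in terms of `v = √(1 + X ^ 2)`
  have basic : ∀ x, xLo ≤ x → ∀ X : ℝ, 0 < x * X ^ 2 + y ∧
      |1 / (x * X ^ 2 + y)| ≤ 1 / c / √(1 + X ^ 2) ∧
      |X / (x * X ^ 2 + y)| ≤ 1 / c / √(1 + X ^ 2) ∧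
      |X ^ 2 / (x * X ^ 2 + y)| ≤ 1 / c := by
    intro x hx X
    have h1 := hq x hx X
    have hv := one_le_sqrt_one_add_sq X
    have hXv := abs_le_sqrt_one_add_sq X
    set v := √(1 + X ^ 2)
    have hv0 : 0 < v := by linarith
    have hcv : 0 < c * v ^ 2 := by positivity
    have hq0 : 0 < x * X ^ 2 + y := by linarith
    refine ⟨hq0, ?_, ?_, ?_⟩
    · rw [abs_of_pos (by positivity), div_div, div_le_div_iff₀ hq0 (by positivity)]
      nlinarith [mul_pos hc hv0]
    · rw [abs_div, abs_of_pos hq0, div_div, div_le_div_iff₀ hq0 (by positivity)]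
      nlinarith [mul_pos hc hv0, mul_le_mul_of_nonneg_left hXv (mul_pos hc hv0).le]
    · rw [abs_div, abs_of_pos hq0, abs_of_nonneg (sq_nonneg X), div_le_div_iff₀ hq0 hc]
      have : X ^ 2 ≤ v ^ 2 := sq_le_sq' (by linarith [neg_abs_le X]) (by linarith [le_abs_self X])
      nlinarith
  have diff : ∀ x, xLo ≤ x → ∀ x', xLo ≤ x' → ∀ X : ℝ,
      |1 / (x * X ^ 2 + y) - 1 / (x' * X ^ 2 + y)| ≤ 1 / c ^ 2 * |x - x'| / √(1 + X ^ 2) ∧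
      |X / (x * X ^ 2 + y) - X / (x' * X ^ 2 + y)| ≤ 1 / c ^ 2 * |x - x'| / √(1 + X ^ 2) ∧
      |X ^ 2 / (x * X ^ 2 + y) - X ^ 2 / (x' * X ^ 2 + y)| ≤ 1 / c ^ 2 * |x - x'| := by
    intro x hx x' hx' X
    obtain ⟨p, a1, a2, a3⟩ := basic x hx X
    obtain ⟨p', b1, b2, b3⟩ := basic x' hx' X
    have hne := p.ne'
    have hne' := p'.ne'
    have hv : 0 < √(1 + X ^ 2) := by linarith [one_le_sqrt_one_add_sq X]
    -- Resolvent identity: the difference is again a product of quantities bounded by `basic`.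
    have aux : ∀ q q' t : ℝ, q ≠ 0 → q' ≠ 0 → q - q' = (x - x') * X ^ 2 →
        t / q - t / q' = -(x - x') * (X ^ 2 / q) * (t / q') := by
      intro q q' t h h' hqq
      field_simp
      linear_combination (-t) * hqq
    set v := √(1 + X ^ 2)
    refine ⟨?_, ?_, ?_⟩
    · have : 1 / (x * X ^ 2 + y) - 1 / (x' * X ^ 2 + y)
          = -(x - x') * (X ^ 2 / (x * X ^ 2 + y)) * (1 / (x' * X ^ 2 + y)) :=
        aux _ _ _ hne hne' (by ring)
      rw [this, abs_mul, abs_mul, abs_neg]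
      calc _ ≤ |x - x'| * (1 / c) * (1 / c / v) := by gcongr
        _ = _ := by field_simp
    · have : X / (x * X ^ 2 + y) - X / (x' * X ^ 2 + y)
          = -(x - x') * (X ^ 2 / (x * X ^ 2 + y)) * (X / (x' * X ^ 2 + y)) :=
        aux _ _ _ hne hne' (by ring)
      rw [this, abs_mul, abs_mul, abs_neg]
      calc _ ≤ |x - x'| * (1 / c) * (1 / c / v) := by gcongr
        _ = _ := by field_simp
    · have : X ^ 2 / (x * X ^ 2 + y) - X ^ 2 / (x' * X ^ 2 + y)
          = -(x - x') * (X ^ 2 / (x * X ^ 2 + y)) * (X ^ 2 / (x' * X ^ 2 + y)) :=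
        aux _ _ _ hne hne' (by ring)
      rw [this, abs_mul, abs_mul, abs_neg]
      calc _ ≤ |x - x'| * (1 / c) * (1 / c) := by gcongr
        _ = _ := by field_simp
  have hB1 : 0 < 1 / c := by positivity
  -- The five summands are the constants produced by the individual size and Lipschitz estimates;
  -- their sum dominates each of them.
  refine ⟨1 / c + 1 / c ^ 2 + 2 * y / c + 2 * y / c ^ 2 + 2 / c ^ 3, by positivity, ?_⟩
  set B := 1 / c + 1 / c ^ 2 + 2 * y / c + 2 * y / c ^ 2 + 2 / c ^ 3 with hB
  have e1 : 1 / c ≤ B := by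
    have : 0 < 1 / c ^ 2 + 2 * y / c + 2 * y / c ^ 2 + 2 / c ^ 3 := by positivity
    linarith
  have e2 : 1 / c ^ 2 ≤ B := by
    have : 0 < 1 / c + 2 * y / c + 2 * y / c ^ 2 + 2 / c ^ 3 := by positivity
    linarith
  have e3 : 2 * y / c ≤ B := by
    have : 0 < 1 / c + 1 / c ^ 2 + 2 * y / c ^ 2 + 2 / c ^ 3 := by positivity
    linarith
  have e4 : 2 * y / c ^ 2 ≤ B := by
    have : 0 < 1 / c + 1 / c ^ 2 + 2 * y / c + 2 / c ^ 3 := by positivity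
    linarith
  have e5 : 2 / c ^ 3 ≤ B := by
    have : 0 < 1 / c + 1 / c ^ 2 + 2 * y / c + 2 * y / c ^ 2 := by positivity
    linarith
  intro i x hx X
  obtain ⟨p, a1, a2, a3⟩ := basic x hx X
  have hv1 := one_le_sqrt_one_add_sq X
  have hv : 0 < √(1 + X ^ 2) := by linarith
  have pq : ∀ x, xLo ≤ x → x * X ^ 2 / (x * X ^ 2 + y) = 1 - y * (1 / (x * X ^ 2 + y)) ∧
      0 ≤ y * (1 / (x * X ^ 2 + y)) ∧ y * (1 / (x * X ^ 2 + y)) ≤ 1 := by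
    intro x hx
    have := (basic x hx X).1
    refine ⟨by field_simp; ring, by positivity, ?_⟩
    rw [mul_one_div, div_le_one this]
    nlinarith [sq_nonneg X]
  obtain ⟨p1, p2, p3⟩ := pq x hx
  constructor
  · have hmono : ∀ b, b ≤ B → b / √(1 + X ^ 2) ≤ B / √(1 + X ^ 2) := fun b hb => by gcongr
    fin_cases i <;> simp only [scoreWeight] <;> simp
    · simpa using a1.trans (hmono _ e1)
    · exact a2.trans (hmono _ e1)
    · rw [p1]
      refine le_trans ?_ (hmono _ e3)
      rw [abs_of_nonneg (by nlinarith)]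
      calc _ ≤ 2 * (y * (1 / (x * X ^ 2 + y))) := by nlinarith
        _ ≤ 2 * (y * (1 / c / √(1 + X ^ 2))) := by
          have := le_trans (le_abs_self _) a1
          gcongr
        _ = _ := by field_simp
    · refine le_trans ?_ (hmono _ e2)
      have : X ^ 3 / (x * X ^ 2 + y) ^ 2 = (X ^ 2 / (x * X ^ 2 + y)) * (X / (x * X ^ 2 + y)) := by
        field_simp
      rw [this, abs_mul]
      calc _ ≤ 1 / c * (1 / c / √(1 + X ^ 2)) := by gcongr
        _ = _ := by field_simp
    · refine le_trans ?_ (hmono _ e2)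
      have : X ^ 2 / (x * X ^ 2 + y) ^ 2 = (X ^ 2 / (x * X ^ 2 + y)) * (1 / (x * X ^ 2 + y)) := by
        field_simp
      rw [this, abs_mul]
      calc _ ≤ 1 / c * (1 / c / √(1 + X ^ 2)) := by gcongr
        _ = _ := by field_simp
  · intro x' hx'
    obtain ⟨p', b1, b2, b3⟩ := basic x' hx' X
    obtain ⟨d1, d2, d3⟩ := diff x hx x' hx' X
    obtain ⟨p1', p2', p3'⟩ := pq x' hx'
    have hmono : ∀ b, b ≤ B → b * |x - x'| / √(1 + X ^ 2) ≤ B * |x - x'| / √(1 + X ^ 2) :=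
      fun b hb => by gcongr
    have hprod : ∀ α β α' β' t : ℝ, |α| ≤ 1 / c → |β'| ≤ 1 / c / √(1 + X ^ 2) →
        |α - α'| ≤ 1 / c ^ 2 * |x - x'| → |β - β'| ≤ 1 / c ^ 2 * |x - x'| / √(1 + X ^ 2) →
        |α * β - α' * β'| ≤ 2 / c ^ 3 * |x - x'| / √(1 + X ^ 2) := by
      intro α β α' β' t h1 h2 h3 h4
      have : α * β - α' * β' = α * (β - β') + (α - α') * β' := by ring
      rw [this]
      refine (abs_add_le _ _).trans ?_
      rw [abs_mul, abs_mul]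
      calc _ ≤ 1 / c * (1 / c ^ 2 * |x - x'| / √(1 + X ^ 2)) +
            1 / c ^ 2 * |x - x'| * (1 / c / √(1 + X ^ 2)) := by gcongr
        _ = _ := by field_simp; norm_num
    fin_cases i <;> simp only [scoreWeight] <;> simp
    · simpa using d1.trans (hmono _ e2)
    · exact d2.trans (hmono _ e2)
    · rw [p1, p1']
      refine le_trans ?_ (hmono _ e4)
      set P := y * (1 / (x * X ^ 2 + y)) with hP
      set Q := y * (1 / (x' * X ^ 2 + y)) with hQ
      have h1 : |P - Q| ≤ y * (1 / c ^ 2 * |x - x'| / √(1 + X ^ 2)) := by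
        rw [hP, hQ, ← mul_sub, abs_mul, abs_of_pos hy]
        gcongr
      have h2 : (1 - Q) ^ 2 - (1 - P) ^ 2 = (P - Q) * (2 - P - Q) := by ring
      rw [h2, abs_mul]
      calc _ ≤ y * (1 / c ^ 2 * |x - x'| / √(1 + X ^ 2)) * 2 := by
            gcongr
            rw [abs_le]; constructor <;> linarith
        _ = _ := by field_simp
    · refine le_trans ?_ (hmono _ e5)
      have h1 : X ^ 3 / (x * X ^ 2 + y) ^ 2 = (X ^ 2 / (x * X ^ 2 + y)) * (X / (x * X ^ 2 + y)) := by
        field_simp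
      have h2 : X ^ 3 / (x' * X ^ 2 + y) ^ 2
          = (X ^ 2 / (x' * X ^ 2 + y)) * (X / (x' * X ^ 2 + y)) := by
        field_simp
      rw [h1, h2]
      exact hprod _ _ _ _ 0 a3 b2 d3 d2
    · refine le_trans ?_ (hmono _ e5)
      have h1 : X ^ 2 / (x * X ^ 2 + y) ^ 2 = (X ^ 2 / (x * X ^ 2 + y)) * (1 / (x * X ^ 2 + y)) := by
        field_simp
      have h2 : X ^ 2 / (x' * X ^ 2 + y) ^ 2
          = (X ^ 2 / (x' * X ^ 2 + y)) * (1 / (x' * X ^ 2 + y)) := by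
        field_simp
      rw [h1, h2]
      exact hprod _ _ _ _ 0 a3 b1 d3 d1

end Weights

/-! ### Vanishing of the score at an interior maximiser. -/

section Score

variable {sLo sHi xLo xHi y : ℝ} {X : ℕ → ℝ} {n : ℕ} {η : EuclideanSpace ℝ (Fin 2)}

/-- Fermat's rule along one coordinate line, so only that coordinate has to be interior to the
rectangle. -/
lemma IsQMLE.score_s (hxLo : 0 < xLo) (hy : 0 < y)
    (h : IsQMLE (paramRect sLo sHi xLo xHi) X n y η) (hs : η 0 ∈ Set.Ioo sLo sHi) :
    ∑ k ∈ Finset.range n, X k * (X (k + 1) - η 0 * X k) / (η 1 * X k ^ 2 + y) = 0 := by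
  have hη := h.1
  have hmax : IsLocalMax (fun s => quasiLogLik X n s (η 1) y) (η 0) := by
    filter_upwards [Ioo_mem_nhds hs.1 hs.2] with s hs'
    simpa using h.2 !₂[s, η 1] ⟨by simpa using ⟨hs'.1.le, hs'.2.le⟩, by simpa using hη.2⟩
  have hq : ∀ k, 0 < η 1 * X k ^ 2 + y := fun k => by
    nlinarith [mul_nonneg (hxLo.le.trans hη.2.1) (sq_nonneg (X k))]
  have hd : HasDerivAt (fun s => quasiLogLik X n s (η 1) y)
      (∑ k ∈ Finset.range n, X k * (X (k + 1) - η 0 * X k) / (η 1 * X k ^ 2 + y)) (η 0) := by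
    simp only [quasiLogLik_eq_sum_range]
    refine HasDerivAt.fun_sum fun k _ => ?_
    simp only [quasiLogLikTerm, Nat.add_sub_cancel]
    have h1 : HasDerivAt (fun s => X (k + 1) - s * X k) (-(1 * X k)) (η 0) :=
      ((hasDerivAt_id _).mul_const _).const_sub _
    have h2 := ((((h1.pow 2).div_const (η 1 * X k ^ 2 + y)).const_add
      (Real.log (η 1 * X k ^ 2 + y))).const_mul (-(1 / 2 : ℝ)))
    refine HasDerivAt.congr_deriv h2 ?_
    have := (hq k).ne'
    field_simp
    simp
  exact hmax.hasDerivAt_eq_zero hd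

lemma IsQMLE.score_x (hxLo : 0 < xLo) (hy : 0 < y)
    (h : IsQMLE (paramRect sLo sHi xLo xHi) X n y η) (hx : η 1 ∈ Set.Ioo xLo xHi) :
    ∑ k ∈ Finset.range n, (X k ^ 2 / (η 1 * X k ^ 2 + y)
      - (X (k + 1) - η 0 * X k) ^ 2 * X k ^ 2 / (η 1 * X k ^ 2 + y) ^ 2) = 0 := by
  have hη := h.1
  have hmax : IsLocalMax (fun x => quasiLogLik X n (η 0) x y) (η 1) := by
    filter_upwards [Ioo_mem_nhds hx.1 hx.2] with s hs'
    simpa using h.2 !₂[η 0, s] ⟨by simpa using hη.1, by simpa using ⟨hs'.1.le, hs'.2.le⟩⟩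
  have hq : ∀ k, 0 < η 1 * X k ^ 2 + y := fun k => by
    nlinarith [mul_nonneg (hxLo.le.trans hη.2.1) (sq_nonneg (X k))]
  have hd : HasDerivAt (fun x => quasiLogLik X n (η 0) x y)
      (∑ k ∈ Finset.range n, -(1 / 2) * (X k ^ 2 / (η 1 * X k ^ 2 + y)
        - (X (k + 1) - η 0 * X k) ^ 2 * X k ^ 2 / (η 1 * X k ^ 2 + y) ^ 2)) (η 1) := by
    simp only [quasiLogLik_eq_sum_range]
    refine HasDerivAt.fun_sum fun k _ => ?_
    simp only [quasiLogLikTerm, Nat.add_sub_cancel]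
    have h1 : HasDerivAt (fun x => x * X k ^ 2 + y) (1 * X k ^ 2) (η 1) :=
      ((hasDerivAt_id _).mul_const _).add_const _
    have h2 := (((h1.log (hq k).ne').add
      ((hasDerivAt_const (η 1) ((X (k + 1) - η 0 * X k) ^ 2)).div h1 (hq k).ne')).const_mul
      (-(1 / 2 : ℝ)))
    refine HasDerivAt.congr_deriv h2 ?_
    have := (hq k).ne'
    field_simp
    ring
  have := hmax.hasDerivAt_eq_zero hd
  rw [← Finset.mul_sum] at this
  simpa using this

end Score

/-! ### Approximation of the log-likelihood summand at a large state. -/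

lemma abs_log_quad_sub_le {c xLo xHi x y X : ℝ} (hxLo : 0 < xLo) (hy : 0 < y) (hc : 0 < c)
    (hx : x ∈ Set.Icc xLo xHi) (hq : c * √(1 + X ^ 2) ^ 2 ≤ x * X ^ 2 + y) :
    |Real.log (x * X ^ 2 + y) - (Real.log (1 + X ^ 2) + Real.log x)|
      ≤ (y / xLo + xHi / c) * (1 / √(1 + X ^ 2)) := by
  have hx0 : 0 < x := hxLo.trans_le hx.1
  have hxH : 0 < xHi := hx0.trans_le hx.2
  have hv1 := one_le_sqrt_one_add_sq X
  have hv2 : √(1 + X ^ 2) ^ 2 = 1 + X ^ 2 := Real.sq_sqrt (by positivity)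
  set v := √(1 + X ^ 2)
  have hv : 0 < v := by linarith
  set q := x * X ^ 2 + y with hqdef
  have hq0 : 0 < q := lt_of_lt_of_le (by positivity) hq
  have hvq : 1 / q ≤ 1 / (c * v) := by
    apply one_div_le_one_div_of_le (by positivity)
    nlinarith [mul_pos hc hv]
  have e1 : Real.log (1 + X ^ 2) + Real.log x = Real.log ((1 + X ^ 2) * x) :=
    (Real.log_mul (by positivity) hx0.ne').symm
  have hA : y / (x * (1 + X ^ 2)) ≤ y / xLo * (1 / v) := by
    calc y / (x * (1 + X ^ 2)) ≤ y / (xLo * v) := by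
          gcongr
          · exact hx.1
          · rw [← hv2]; nlinarith
      _ = y / xLo * (1 / v) := by field_simp
  have hBd : x / q ≤ xHi / c * (1 / v) := by
    calc x / q = x * (1 / q) := by ring
      _ ≤ xHi * (1 / (c * v)) := by gcongr; exact hx.2
      _ = xHi / c * (1 / v) := by field_simp
  have hA0 : 0 ≤ y / xLo * (1 / v) := by positivity
  have hB0 : 0 ≤ xHi / c * (1 / v) := by positivity
  -- Both sides come from `log t ≤ t - 1`, applied to the ratio of the two quadratics and to its
  -- inverse.
  rw [e1, abs_le, add_mul (y / xLo)]
  constructor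
  · have := Real.log_le_sub_one_of_pos (x := (1 + X ^ 2) * x / q) (by positivity)
    rw [Real.log_div (by positivity) hq0.ne'] at this
    have h2 : (1 + X ^ 2) * x / q - 1 = x / q - y / q := by
      rw [hqdef]; field_simp; ring
    have : 0 ≤ y / q := by positivity
    linarith
  · have := Real.log_le_sub_one_of_pos (x := q / ((1 + X ^ 2) * x)) (by positivity)
    rw [Real.log_div hq0.ne' (by positivity)] at this
    have h2 : q / ((1 + X ^ 2) * x) - 1 = y / (x * (1 + X ^ 2)) - x / (x * (1 + X ^ 2)) := by
      rw [hqdef]; field_simp; ring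
    have : 0 ≤ x / (x * (1 + X ^ 2)) := by positivity
    linarith

/-- After expansion of the square, every term of the difference carries a factor `X / q` or `1 / q`
with `q = x X² + y`, and both are at most `1 / (c √(1 + X²))` in absolute value. -/
lemma abs_sq_div_quad_sub_le {c xLo x y X a e : ℝ} (hxLo : 0 < xLo) (hy : 0 < y) (hc : 0 < c)
    (hx : xLo ≤ x) (hq : c * √(1 + X ^ 2) ^ 2 ≤ x * X ^ 2 + y) :
    |(a * X + e) ^ 2 / (x * X ^ 2 + y) - a ^ 2 / x|
      ≤ (2 / c + y / (xLo * c)) * ((a ^ 2 + e ^ 2) / √(1 + X ^ 2)) := by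
  have hx0 : 0 < x := hxLo.trans_le hx
  have hv1 := one_le_sqrt_one_add_sq X
  have hXv := abs_le_sqrt_one_add_sq X
  set v := √(1 + X ^ 2)
  have hv : 0 < v := by linarith
  set q := x * X ^ 2 + y with hqdef
  have hq0 : 0 < q := lt_of_lt_of_le (by positivity) hq
  have hvq : 1 / q ≤ 1 / (c * v) := by
    apply one_div_le_one_div_of_le (by positivity)
    nlinarith [mul_pos hc hv]
  have hXq : |X| / q ≤ 1 / (c * v) := by
    rw [div_le_div_iff₀ hq0 (by positivity)]
    nlinarith [mul_pos hc hv, mul_le_mul_of_nonneg_left hXv (mul_pos hc hv).le]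
  have h1 : (a * X + e) ^ 2 / q - a ^ 2 / x
      = 2 * (a * e) * (X / q) + (e ^ 2 * (1 / q) - a ^ 2 * (y / x) * (1 / q)) := by
    field_simp; rw [hqdef]; ring
  have hae : 2 * |a * e| ≤ a ^ 2 + e ^ 2 := by
    rw [abs_mul]; nlinarith [sq_nonneg (|a| - |e|), sq_abs a, sq_abs e]
  have t1 : |2 * (a * e) * (X / q)| ≤ (a ^ 2 + e ^ 2) * (1 / (c * v)) := by
    rw [abs_mul, abs_mul, abs_div, abs_of_pos hq0, abs_two]
    gcongr
  have hyx : y / x ≤ y / xLo := by gcongr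
  have t2 : |e ^ 2 * (1 / q) - a ^ 2 * (y / x) * (1 / q)|
      ≤ (a ^ 2 + e ^ 2) * (1 / (c * v)) + (a ^ 2 + e ^ 2) * (y / xLo) * (1 / (c * v)) := by
    refine (abs_sub _ _).trans ?_
    rw [abs_of_nonneg (a := e ^ 2 * (1 / q)) (by positivity),
      abs_of_nonneg (a := a ^ 2 * (y / x) * (1 / q)) (by positivity)]
    have : e ^ 2 ≤ a ^ 2 + e ^ 2 := by linarith [sq_nonneg a]
    have : a ^ 2 ≤ a ^ 2 + e ^ 2 := by linarith [sq_nonneg e]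
    gcongr
  rw [h1]
  refine (abs_add_le _ _).trans ((add_le_add t1 t2).trans (le_of_eq ?_))
  field_simp
  ring

/-- The log-likelihood summand is close to its limit for a large state. -/
lemma exists_logLik_approx {φ sLo sHi xLo xHi y : ℝ} (hxLo : 0 < xLo) (hlt : xLo < xHi)
    (hy : 0 < y) :
    ∃ D, 0 < D ∧ ∀ s x, s ∈ Set.Icc sLo sHi → x ∈ Set.Icc xLo xHi → ∀ X b e : ℝ,
      |Real.log (x * X ^ 2 + y) + ((φ + b) * X + e - s * X) ^ 2 / (x * X ^ 2 + y)
        - (Real.log (1 + X ^ 2) + Real.log x + (φ - s + b) ^ 2 / x)|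
        ≤ D * ((1 + b ^ 2 + e ^ 2) / √(1 + X ^ 2)) := by
  obtain ⟨c, hc, hq⟩ := exists_le_quad hxLo hy
  have hxH : 0 < xHi := hxLo.trans hlt
  set S := (φ - sLo) ^ 2 + (φ - sHi) ^ 2 with hS
  have hS0 : 0 ≤ S := by positivity
  refine ⟨(y / xLo + xHi / c) + (2 / c + y / (xLo * c)) * (2 * S + 2), by positivity, ?_⟩
  intro s x hs hx X b e
  have hqx := hq x hx.1 X
  have t1 := abs_log_quad_sub_le hxLo hy hc hx hqx
  have t2 := abs_sq_div_quad_sub_le (a := φ - s + b) (e := e) hxLo hy hc hx.1 hqx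
  have hv : 0 < √(1 + X ^ 2) := by linarith [one_le_sqrt_one_add_sq X]
  set v := √(1 + X ^ 2)
  have ha2 : (φ - s + b) ^ 2 + e ^ 2 ≤ (2 * S + 2) * (1 + b ^ 2 + e ^ 2) := by
    have h1 : (φ - s) ^ 2 ≤ S := by
      rcases le_total 0 (φ - s) with h | h
      · nlinarith [hs.1, hs.2, sq_nonneg (φ - sHi)]
      · nlinarith [hs.1, hs.2, sq_nonneg (φ - sLo)]
    have h2 : (φ - s + b) ^ 2 ≤ 2 * (φ - s) ^ 2 + 2 * b ^ 2 := by
      nlinarith [sq_nonneg (φ - s - b)]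
    have := mul_nonneg hS0 (add_nonneg (sq_nonneg b) (sq_nonneg e))
    linarith [sq_nonneg e]
  have hk : (1 : ℝ) ≤ 1 + b ^ 2 + e ^ 2 := by linarith [sq_nonneg b, sq_nonneg e]
  have e1 : (φ + b) * X + e - s * X = (φ - s + b) * X + e := by ring
  rw [e1, add_mul (y / xLo + xHi / c)]
  have t3 : (y / xLo + xHi / c) * (1 / v) ≤ (y / xLo + xHi / c) * ((1 + b ^ 2 + e ^ 2) / v) := by
    gcongr
  have t4 : (2 / c + y / (xLo * c)) * (((φ - s + b) ^ 2 + e ^ 2) / v)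
      ≤ (2 / c + y / (xLo * c)) * (2 * S + 2) * ((1 + b ^ 2 + e ^ 2) / v) := by
    rw [mul_assoc, ← mul_div_assoc (2 * S + 2)]
    gcongr
  have t5 := abs_add_le (Real.log (x * X ^ 2 + y) - (Real.log (1 + X ^ 2) + Real.log x))
    (((φ - s + b) * X + e) ^ 2 / (x * X ^ 2 + y) - (φ - s + b) ^ 2 / x)
  refine le_trans (le_of_eq ?_) (t5.trans (add_le_add (t1.trans t3) (t2.trans t4)))
  congr 1
  ring

lemma sq_sqrt_sub_one_le {t : ℝ} (ht : 0 < t) : (√t - 1) ^ 2 ≤ t - 1 - Real.log t := by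
  have h := Real.log_le_sub_one_of_pos (Real.sqrt_pos.2 ht)
  rw [Real.log_sqrt ht.le] at h
  nlinarith [Real.sq_sqrt ht.le]

/-- With `t = ω2 / x` the contrast is `(φ - s)² / x + (t - 1 - log t)`. Both parts are nonnegative,
so each is small, and the second controls `(√t - 1)²`. This yields the rate `√ρ` in both
coordinates. -/
lemma abs_sub_le_of_contrast {φ ω2 s x xLo xHi c ρ : ℝ} (hxLo : 0 < xLo) (hω0 : 0 < ω2)
    (hx : x ∈ Set.Icc xLo xHi) (hc : 0 < c)
    (h : Real.log x - Real.log ω2 + (φ - s) ^ 2 / x + ω2 / x - 1 ≤ c * ρ) :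
    |s - φ| ≤ √(xHi * c) * √ρ ∧ |x - ω2| ≤ xHi * (√c * (√(ω2 / xLo) + 1)) * √ρ := by
  have hx0 : 0 < x := hxLo.trans_le hx.1
  have hxH : 0 < xHi := hx0.trans_le hx.2
  have ht : 0 < ω2 / x := by positivity
  have hsq := sq_sqrt_sub_one_le ht
  rw [Real.log_div hω0.ne' hx0.ne'] at hsq
  have hps : 0 ≤ (φ - s) ^ 2 / x := by positivity
  have h0 := sq_nonneg (√(ω2 / x) - 1)
  have hcr : 0 ≤ c * ρ := by linarith
  constructor
  · have h3 : (φ - s) ^ 2 / x ≤ c * ρ := by linarith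
    rw [div_le_iff₀ hx0] at h3
    have h4 : (s - φ) ^ 2 ≤ xHi * c * ρ := by
      have : c * ρ * x ≤ c * ρ * xHi := mul_le_mul_of_nonneg_left hx.2 hcr
      linarith [sub_sq_comm s φ]
    have h5 := Real.abs_le_sqrt h4
    rwa [Real.sqrt_mul (by positivity)] at h5
  · have h3 : (√(ω2 / x) - 1) ^ 2 ≤ c * ρ := by linarith
    have h5 := Real.abs_le_sqrt h3
    rw [Real.sqrt_mul hc.le] at h5
    have h6 : x - ω2 = -(x * ((√(ω2 / x) - 1) * (√(ω2 / x) + 1))) := by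
      have : (√(ω2 / x) - 1) * (√(ω2 / x) + 1) = ω2 / x - 1 := by
        have := Real.sq_sqrt ht.le
        linear_combination this
      rw [this]; field_simp; ring
    have h7 : √(ω2 / x) ≤ √(ω2 / xLo) := by
      apply Real.sqrt_le_sqrt; gcongr; exact hx.1
    have h8 : 0 < √(ω2 / x) := Real.sqrt_pos.2 ht
    rw [h6, abs_neg, abs_mul, abs_mul, abs_of_pos hx0,
      abs_of_pos (a := √(ω2 / x) + 1) (by linarith)]
    have h9 : 0 ≤ √c * √ρ := by positivity
    calc x * (|√(ω2 / x) - 1| * (√(ω2 / x) + 1))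
        ≤ xHi * (√c * √ρ * (√(ω2 / xLo) + 1)) :=
          mul_le_mul hx.2 (mul_le_mul h5 (by linarith) (by linarith) h9)
            (mul_nonneg (abs_nonneg _) (by linarith)) hxH.le
      _ = xHi * (√c * (√(ω2 / xLo) + 1)) * √ρ := by ring

/-! ### Good paths: consistency and linearisation of the estimator. -/

/-- Path conditions at time `n` with tolerance `ρ`: the path is mostly far from the origin and
the relevant averages are close to their means. -/
structure PathGood (ω2 y : ℝ) (X b e : ℕ → ℝ) (n : ℕ) (ρ : ℝ) : Prop where
  escape : ∑ k ∈ Finset.range n, (1 + b (k + 1) ^ 2 + e (k + 1) ^ 2) / √(1 + X k ^ 2) ≤ ρ * n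
  mean : |∑ k ∈ Finset.range n, b (k + 1)| ≤ ρ * n
  meanSq : |∑ k ∈ Finset.range n, (b (k + 1) ^ 2 - ω2)| ≤ ρ * n
  score₀ : |∑ k ∈ Finset.range n, b (k + 1) * scoreWeight y 0 ω2 (X k)| ≤ ρ * √n
  score₁ : |∑ k ∈ Finset.range n, e (k + 1) * scoreWeight y 1 ω2 (X k)| ≤ ρ * √n
  score₂ : |∑ k ∈ Finset.range n, (b (k + 1) ^ 2 - ω2) * scoreWeight y 2 ω2 (X k)| ≤ ρ * √n
  score₃ : |∑ k ∈ Finset.range n, b (k + 1) * e (k + 1) * scoreWeight y 3 ω2 (X k)| ≤ ρ * √n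
  score₄ : |∑ k ∈ Finset.range n, (e (k + 1) ^ 2 - y) * scoreWeight y 4 ω2 (X k)| ≤ ρ * √n

/-- Consistency of the estimator on a good path. -/
lemma exists_consistency {φ ω2 sLo sHi xLo xHi y : ℝ} (hxLo : 0 < xLo) (hy : 0 < y)
    (hφ : φ ∈ Set.Ioo sLo sHi) (hω : ω2 ∈ Set.Ioo xLo xHi) :
    ∃ C, 0 < C ∧ ∀ (n : ℕ) (X b e : ℕ → ℝ) (ρ : ℝ) (η : EuclideanSpace ℝ (Fin 2)), 0 < n →
      0 < ρ → ρ ≤ 1 →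
      (∀ k, X (k + 1) = (φ + b (k + 1)) * X k + e (k + 1)) → PathGood ω2 y X b e n ρ →
      IsQMLE (paramRect sLo sHi xLo xHi) X n y η →
      |η 0 - φ| ≤ C * √ρ ∧ |η 1 - ω2| ≤ C * √ρ := by
  obtain ⟨D, hD, happ⟩ := exists_logLik_approx (φ := φ) (sLo := sLo) (sHi := sHi) hxLo
    (hω.1.trans hω.2) hy
  have hω0 : 0 < ω2 := hxLo.trans hω.1
  have hxH : 0 < xHi := hω0.trans hω.2
  set S := sHi - sLo with hS
  have hS0 : 0 < S := by have := hφ.1.trans hφ.2; linarith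
  -- `2 * D` pays for the approximation at the estimate and at the true parameter, `2 * S / xLo` for
  -- the cross term with the mean of `b`, and the last two for replacing the empirical second moment
  -- by `ω2` in each of the two likelihoods.
  set C1 := 2 * D + 2 * S / xLo + 1 / xLo + 1 / ω2 with hC1
  have hC1p : 0 < C1 := by positivity
  refine ⟨√(xHi * C1) + xHi * (√C1 * (√(ω2 / xLo) + 1)), by positivity, ?_⟩
  intro n X b e ρ η hn hρ hρ1 hX hg hη
  have hn' : (0 : ℝ) < n := by exact_mod_cast hn
  set s := η 0
  set x := η 1
  have hs : s ∈ Set.Icc sLo sHi := hη.1.1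
  have hx : x ∈ Set.Icc xLo xHi := hη.1.2
  have hx0 : 0 < x := hxLo.trans_le hx.1
  -- comparison with the true parameter
  have hcmp := hη.2 !₂[φ, ω2] ⟨by simpa using ⟨hφ.1.le, hφ.2.le⟩, by simpa using ⟨hω.1.le, hω.2.le⟩⟩
  simp only [quasiLogLik_eq_sum_range, quasiLogLikTerm, Nat.add_sub_cancel, ← Finset.mul_sum,
    hX] at hcmp
  simp only [Matrix.cons_val_zero, Matrix.cons_val_one] at hcmp
  set T := ∑ k ∈ Finset.range n, Real.log (1 + X k ^ 2) with hT
  set B1 := ∑ k ∈ Finset.range n, b (k + 1) with hB1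
  set B2 := ∑ k ∈ Finset.range n, b (k + 1) ^ 2 with hB2
  set R := ∑ k ∈ Finset.range n, (1 + b (k + 1) ^ 2 + e (k + 1) ^ 2) / √(1 + X k ^ 2) with hR
  -- The approximating likelihood depends on the path only through `T`, `B1` and `B2`, and `T`
  -- cancels in the comparison of two parameters.
  have hsum : ∀ s x, s ∈ Set.Icc sLo sHi → x ∈ Set.Icc xLo xHi →
      |∑ k ∈ Finset.range n, (Real.log (x * X k ^ 2 + y) +
        ((φ + b (k + 1)) * X k + e (k + 1) - s * X k) ^ 2 / (x * X k ^ 2 + y))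
        - (T + n * Real.log x + (n * (φ - s) ^ 2 + 2 * (φ - s) * B1 + B2) / x)| ≤ D * R := by
    intro s x hs hx
    have : T + n * Real.log x + (n * (φ - s) ^ 2 + 2 * (φ - s) * B1 + B2) / x
        = ∑ k ∈ Finset.range n, (Real.log (1 + X k ^ 2) + Real.log x
          + (φ - s + b (k + 1)) ^ 2 / x) := by
      rw [Finset.sum_add_distrib, Finset.sum_add_distrib, Finset.sum_const, Finset.card_range,
        nsmul_eq_mul, ← Finset.sum_div]
      congr 2
      simp only [add_sq, Finset.sum_add_distrib, Finset.sum_const, Finset.card_range, nsmul_eq_mul,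
        ← Finset.mul_sum]
      rw [hB1, hB2]
    rw [this, ← Finset.sum_sub_distrib, hR, Finset.mul_sum]
    exact (Finset.abs_sum_le_sum_abs _ _).trans
      (Finset.sum_le_sum fun k _ => happ s x hs hx (X k) (b (k + 1)) (e (k + 1)))
  have h1 := abs_le.1 (hsum s x hs hx)
  have h2 := abs_le.1 (hsum φ ω2 ⟨hφ.1.le, hφ.2.le⟩ ⟨hω.1.le, hω.2.le⟩)
  have hB2' : |B2 - n * ω2| ≤ ρ * n := by
    have := hg.meanSq
    rwa [Finset.sum_sub_distrib, Finset.sum_const, Finset.card_range, nsmul_eq_mul] at this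
  have hRle : R ≤ ρ * n := hg.escape
  have hB1' : |B1| ≤ ρ * n := hg.mean
  have hφs : |φ - s| ≤ S := by
    rw [abs_le]; constructor <;> linarith [hφ.1, hφ.2, hs.1, hs.2]
  -- the limiting contrast is small
  have hmain : n * (Real.log x - Real.log ω2 + (φ - s) ^ 2 / x + ω2 / x - 1) ≤ n * (C1 * ρ) := by
    have e1 : n * (Real.log x - Real.log ω2 + (φ - s) ^ 2 / x + ω2 / x - 1)
        = ((T + n * Real.log x + (n * (φ - s) ^ 2 + 2 * (φ - s) * B1 + B2) / x)
          - (T + n * Real.log ω2 + (n * (φ - φ) ^ 2 + 2 * (φ - φ) * B1 + B2) / ω2))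
          + (-(2 * (φ - s) * B1 / x) - (B2 - n * ω2) / x + (B2 - n * ω2) / ω2) := by
      field_simp; ring
    have b1 : -(2 * (φ - s) * B1 / x) ≤ 2 * S / xLo * (ρ * n) := by
      refine (neg_le_abs _).trans ?_
      rw [abs_div, abs_mul, abs_mul, abs_two, abs_of_pos hx0]
      calc 2 * |φ - s| * |B1| / x ≤ 2 * S * (ρ * n) / xLo := by
            gcongr; exact hx.1
        _ = _ := by ring
    have b2 : -((B2 - n * ω2) / x) ≤ 1 / xLo * (ρ * n) := by
      refine (neg_le_abs _).trans ?_
      rw [abs_div, abs_of_pos hx0]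
      calc |B2 - n * ω2| / x ≤ ρ * n / xLo := by gcongr; exact hx.1
        _ = _ := by ring
    have b3 : (B2 - n * ω2) / ω2 ≤ 1 / ω2 * (ρ * n) := by
      refine (le_abs_self _).trans ?_
      rw [abs_div, abs_of_pos hω0]
      calc |B2 - n * ω2| / ω2 ≤ ρ * n / ω2 := by gcongr
        _ = _ := by ring
    have b4 : D * R ≤ D * (ρ * n) := by gcongr
    have e2 : n * (C1 * ρ) = 2 * (D * (ρ * n)) + 2 * S / xLo * (ρ * n) + 1 / xLo * (ρ * n)
        + 1 / ω2 * (ρ * n) := by rw [hC1]; ring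
    linarith
  have hmain' := le_of_mul_le_mul_left hmain hn'
  refine ⟨(abs_sub_le_of_contrast hxLo hω0 hx hC1p hmain').1.trans ?_,
    (abs_sub_le_of_contrast hxLo hω0 hx hC1p hmain').2.trans ?_⟩
  · rw [add_mul]
    have : 0 ≤ xHi * (√C1 * (√(ω2 / xLo) + 1)) * √ρ := by positivity
    linarith
  · rw [add_mul]
    have : 0 ≤ √(xHi * C1) * √ρ := by positivity
    linarith

/-- The estimate `x` depends on the whole path, so a sum with weights at `x` is not a martingale
transform. The Lipschitz bound moves the weights to the fixed value `ω2`. The cost is `|x - ω2|`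
times the escape sum, which can later be absorbed into the left side. -/
lemma abs_sum_mul_scoreWeight_le {B D ρ x xLo ω2 y : ℝ} {X b e ξ : ℕ → ℝ} {n : ℕ} (i : Fin 5)
    (hD : 0 ≤ D) (hB0 : 0 < B) (hx : xLo ≤ x) (hω : xLo ≤ ω2)
    (hB : ∀ i : Fin 5, ∀ x, xLo ≤ x → ∀ X : ℝ,
      |scoreWeight y i x X| ≤ B / √(1 + X ^ 2) ∧
      ∀ x', xLo ≤ x' →
        |scoreWeight y i x X - scoreWeight y i x' X| ≤ B * |x - x'| / √(1 + X ^ 2))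
    (hR : ∑ k ∈ Finset.range n, (1 + b (k + 1) ^ 2 + e (k + 1) ^ 2) / √(1 + X k ^ 2) ≤ ρ * n)
    (hξ : ∀ k, |ξ k| ≤ D * (1 + b (k + 1) ^ 2 + e (k + 1) ^ 2)) :
    |∑ k ∈ Finset.range n, ξ k * scoreWeight y i x (X k)| ≤ D * B * (ρ * n) ∧
    |∑ k ∈ Finset.range n, ξ k * scoreWeight y i x (X k)|
      ≤ |∑ k ∈ Finset.range n, ξ k * scoreWeight y i ω2 (X k)| + D * B * |x - ω2| * (ρ * n) := by
  have key : ∀ (w : ℕ → ℝ) (c : ℝ), 0 ≤ c → (∀ k, |w k| ≤ c / √(1 + X k ^ 2)) →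
      |∑ k ∈ Finset.range n, ξ k * w k| ≤ D * c * (ρ * n) := by
    intro w c hc hw
    calc |∑ k ∈ Finset.range n, ξ k * w k| ≤ ∑ k ∈ Finset.range n, |ξ k * w k| :=
          Finset.abs_sum_le_sum_abs _ _
      _ ≤ ∑ k ∈ Finset.range n, D * c * ((1 + b (k + 1) ^ 2 + e (k + 1) ^ 2) / √(1 + X k ^ 2)) := by
          refine Finset.sum_le_sum fun k _ => ?_
          rw [abs_mul]
          calc |ξ k| * |w k| ≤ (D * (1 + b (k + 1) ^ 2 + e (k + 1) ^ 2)) * (c / √(1 + X k ^ 2)) := by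
                gcongr
                · exact hξ k
                · exact hw k
            _ = _ := by ring
      _ = D * c * ∑ k ∈ Finset.range n, (1 + b (k + 1) ^ 2 + e (k + 1) ^ 2) / √(1 + X k ^ 2) := by
          rw [Finset.mul_sum]
      _ ≤ _ := by gcongr
  refine ⟨key _ B hB0.le fun k => (hB i x hx (X k)).1, ?_⟩
  have h := key (fun k => scoreWeight y i x (X k) - scoreWeight y i ω2 (X k)) (B * |x - ω2|)
    (by positivity) fun k => (hB i x hx (X k)).2 ω2 hω
  have h2 : ∑ k ∈ Finset.range n, ξ k * scoreWeight y i x (X k)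
      = ∑ k ∈ Finset.range n, ξ k * scoreWeight y i ω2 (X k)
        + ∑ k ∈ Finset.range n, ξ k * (scoreWeight y i x (X k) - scoreWeight y i ω2 (X k)) := by
    rw [← Finset.sum_add_distrib]
    exact Finset.sum_congr rfl fun k _ => by ring
  rw [h2]
  refine (abs_add_le _ _).trans ?_
  rw [← mul_assoc D B] at h
  linarith

/-- The score is multiplied by `x`, and `x X² / (x X² + y)` is written as `1 - y / (x X² + y)`. The
constant 1 produces the left side; everything else carries a decaying weight. -/
lemma score_s_expand {φ s x y : ℝ} {X b e : ℕ → ℝ} {n : ℕ} (hx : 0 < x) (hy : 0 < y)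
    (hX : ∀ k, X (k + 1) = (φ + b (k + 1)) * X k + e (k + 1))
    (h : ∑ k ∈ Finset.range n, X k * (X (k + 1) - s * X k) / (x * X k ^ 2 + y) = 0) :
    n * (s - φ) - ∑ k ∈ Finset.range n, b (k + 1)
      = (s - φ) * y * ∑ k ∈ Finset.range n, 1 * scoreWeight y 0 x (X k)
        - y * ∑ k ∈ Finset.range n, b (k + 1) * scoreWeight y 0 x (X k)
        + x * ∑ k ∈ Finset.range n, e (k + 1) * scoreWeight y 1 x (X k) := by
  have h1 : ∑ k ∈ Finset.range n, (b (k + 1) - (s - φ)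
      - y * (b (k + 1) * scoreWeight y 0 x (X k)) + (s - φ) * y * (1 * scoreWeight y 0 x (X k))
      + x * (e (k + 1) * scoreWeight y 1 x (X k))) = 0 := by
    rw [← mul_zero x, ← h, Finset.mul_sum]
    refine Finset.sum_congr rfl fun k _ => ?_
    have hq : x * X k ^ 2 + y ≠ 0 := by positivity
    simp only [scoreWeight, hX, Matrix.cons_val_zero, Matrix.cons_val_one]
    field_simp
    ring
  simp only [Finset.sum_add_distrib, Finset.sum_sub_distrib, ← Finset.mul_sum, Finset.sum_const,
    Finset.card_range, nsmul_eq_mul] at h1 ⊢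
  linarith

/-- With `a = b - (s - φ)` and weights `w_i`, the summand multiplied by `-x²` equals `(a² - x)(1 -
w₂) + 2 x² a e w₃ + x² (e² - y) w₄`. Expanding `a²` separates the leading part from sums with
decaying weights and from terms containing a factor `s - φ`. -/
lemma score_x_expand {φ s x y ω2 : ℝ} {X b e : ℕ → ℝ} {n : ℕ} (hx : 0 < x) (hy : 0 < y)
    (hX : ∀ k, X (k + 1) = (φ + b (k + 1)) * X k + e (k + 1))
    (h : ∑ k ∈ Finset.range n, (X k ^ 2 / (x * X k ^ 2 + y)
      - (X (k + 1) - s * X k) ^ 2 * X k ^ 2 / (x * X k ^ 2 + y) ^ 2) = 0) :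
    n * (x - ω2) - ∑ k ∈ Finset.range n, (b (k + 1) ^ 2 - ω2)
      = (x - ω2) * ∑ k ∈ Finset.range n, 1 * scoreWeight y 2 x (X k)
        - ∑ k ∈ Finset.range n, (b (k + 1) ^ 2 - ω2) * scoreWeight y 2 x (X k)
        + x ^ 2 * (2 * ∑ k ∈ Finset.range n, b (k + 1) * e (k + 1) * scoreWeight y 3 x (X k)
          + ∑ k ∈ Finset.range n, (e (k + 1) ^ 2 - y) * scoreWeight y 4 x (X k))
        - 2 * (s - φ) * ∑ k ∈ Finset.range n, b (k + 1)
        + 2 * (s - φ) * ∑ k ∈ Finset.range n, b (k + 1) * scoreWeight y 2 x (X k)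
        - 2 * (s - φ) * x ^ 2 * ∑ k ∈ Finset.range n, e (k + 1) * scoreWeight y 3 x (X k)
        + (s - φ) ^ 2 * (n - ∑ k ∈ Finset.range n, 1 * scoreWeight y 2 x (X k)) := by
  have h1 : ∑ k ∈ Finset.range n, ((b (k + 1) ^ 2 - ω2)
      - (x - ω2) + (x - ω2) * (1 * scoreWeight y 2 x (X k))
      - (b (k + 1) ^ 2 - ω2) * scoreWeight y 2 x (X k)
      + x ^ 2 * (2 * (b (k + 1) * e (k + 1) * scoreWeight y 3 x (X k))
        + (e (k + 1) ^ 2 - y) * scoreWeight y 4 x (X k))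
      - 2 * (s - φ) * b (k + 1)
      + 2 * (s - φ) * (b (k + 1) * scoreWeight y 2 x (X k))
      - 2 * (s - φ) * x ^ 2 * (e (k + 1) * scoreWeight y 3 x (X k))
      + (s - φ) ^ 2 * (1 - 1 * scoreWeight y 2 x (X k))) = 0 := by
    rw [← mul_zero (-x ^ 2), ← h, Finset.mul_sum]
    refine Finset.sum_congr rfl fun k _ => ?_
    have hq : x * X k ^ 2 + y ≠ 0 := by positivity
    have e2 : scoreWeight y 2 x (X k) = 1 - (x * X k ^ 2 / (x * X k ^ 2 + y)) ^ 2 := rfl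
    have e3 : scoreWeight y 3 x (X k) = X k ^ 3 / (x * X k ^ 2 + y) ^ 2 := rfl
    have e4 : scoreWeight y 4 x (X k) = X k ^ 2 / (x * X k ^ 2 + y) ^ 2 := rfl
    simp only [e2, e3, e4, hX]
    field_simp
    ring
  simp only [Finset.sum_add_distrib, Finset.sum_sub_distrib, ← Finset.mul_sum, Finset.sum_const,
    Finset.card_range, nsmul_eq_mul] at h1 ⊢
  linarith

lemma abs_le_noise (β ε : ℝ) :
    |(1 : ℝ)| ≤ 1 * (1 + β ^ 2 + ε ^ 2) ∧ |β| ≤ 1 * (1 + β ^ 2 + ε ^ 2) ∧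
      |ε| ≤ 1 * (1 + β ^ 2 + ε ^ 2) ∧ |β * ε| ≤ 1 * (1 + β ^ 2 + ε ^ 2) ∧
      (∀ c, 0 ≤ c → |β ^ 2 - c| ≤ (1 + c) * (1 + β ^ 2 + ε ^ 2)) ∧
      (∀ c, 0 ≤ c → |ε ^ 2 - c| ≤ (1 + c) * (1 + β ^ 2 + ε ^ 2)) := by
  refine ⟨by rw [abs_one]; nlinarith [sq_nonneg β, sq_nonneg ε], ?_, ?_, ?_, ?_, ?_⟩
  · rw [abs_le]; constructor <;> nlinarith [sq_nonneg (β - 1), sq_nonneg (β + 1), sq_nonneg ε]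
  · rw [abs_le]; constructor <;> nlinarith [sq_nonneg (ε - 1), sq_nonneg (ε + 1), sq_nonneg β]
  · rw [abs_le]; constructor <;> nlinarith [sq_nonneg (β - ε), sq_nonneg (β + ε)]
  · intro c hc
    rw [abs_le]; constructor <;>
      nlinarith [sq_nonneg β, sq_nonneg ε, mul_nonneg hc (sq_nonneg β), mul_nonneg hc (sq_nonneg ε)]
  · intro c hc
    rw [abs_le]; constructor <;>
      nlinarith [sq_nonneg β, sq_nonneg ε, mul_nonneg hc (sq_nonneg β), mul_nonneg hc (sq_nonneg ε)]

lemma abs_mul_le_of_le {a b A B : ℝ} (ha : |a| ≤ A) (hb : |b| ≤ B) : |a * b| ≤ A * B := by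
  rw [abs_mul]
  exact mul_le_mul ha hb (abs_nonneg _) ((abs_nonneg _).trans ha)

set_option maxHeartbeats 1000000 in
/-- On a good path the estimation error is close to the normalised sums of the noise. -/
lemma exists_linearization {φ ω2 sLo sHi xLo xHi y : ℝ} (hxLo : 0 < xLo) (hy : 0 < y)
    (hφ : φ ∈ Set.Ioo sLo sHi) (hω : ω2 ∈ Set.Ioo xLo xHi) :
    ∃ C ρ₀, 0 < C ∧ 0 < ρ₀ ∧ ∀ (n : ℕ) (X b e : ℕ → ℝ) (ρ : ℝ) (η : EuclideanSpace ℝ (Fin 2)),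
      0 < n → 0 < ρ → ρ ≤ ρ₀ →
      (∀ k, X (k + 1) = (φ + b (k + 1)) * X k + e (k + 1)) → PathGood ω2 y X b e n ρ →
      IsQMLE (paramRect sLo sHi xLo xHi) X n y η →
      |√n * (η 0 - φ) - (√n)⁻¹ * ∑ k ∈ Finset.range n, b (k + 1)|
        + |√n * (η 1 - ω2) - (√n)⁻¹ * ∑ k ∈ Finset.range n, (b (k + 1) ^ 2 - ω2)|
      ≤ C * √ρ * (1 + |(√n)⁻¹ * ∑ k ∈ Finset.range n, b (k + 1)|
        + |(√n)⁻¹ * ∑ k ∈ Finset.range n, (b (k + 1) ^ 2 - ω2)|) := by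
  obtain ⟨B, hB0, hB⟩ := exists_scoreWeight_bound hxLo hy
  obtain ⟨C, hC, hcons⟩ := exists_consistency hxLo hy hφ hω
  have hω0 : 0 < ω2 := hxLo.trans hω.1
  have hxH : 0 < xHi := hω0.trans hω.2
  -- `K₀` bounds the remainder in the first equation, `K₁` in the second
  set K₀ := y * B + (y + xHi) * (1 + B) with hK₀
  set K₁ := B + (1 + (1 + ω2) * B) + xHi ^ 2 * (2 * (1 + B) + (1 + (1 + y) * B))
    + 2 + 2 * B + 2 * xHi ^ 2 * B + C * (1 + B) with hK₁
  have hK₀p : 0 < K₀ := by positivity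
  have hK₁p : 0 < K₁ := by positivity
  set K := K₀ + K₁ with hK
  have hKp : 0 < K := by positivity
  set ε := min (min (φ - sLo) (sHi - φ)) (min (ω2 - xLo) (xHi - ω2)) with hε
  have hεp : 0 < ε := by
    refine lt_min (lt_min ?_ ?_) (lt_min ?_ ?_) <;> linarith [hφ.1, hφ.2, hω.1, hω.2]
  -- The bound 1 gives `ρ ≤ √ρ ≤ 1`, the second bound keeps the estimate in the open rectangle so
  -- that both scores vanish, and the third allows the absorption at the end.
  set τ := min 1 (min (ε / (2 * C)) (1 / (2 * K))) with hτ
  have hτp : 0 < τ := lt_min one_pos (lt_min (by positivity) (by positivity))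
  refine ⟨2 * K, τ ^ 2, by positivity, by positivity, ?_⟩
  intro n X b e ρ η hn hρ hρ0 hX hg hη
  have hr : √ρ ≤ τ := by
    rw [← Real.sqrt_sq hτp.le]; exact Real.sqrt_le_sqrt hρ0
  have hr1 : √ρ ≤ 1 := hr.trans (min_le_left _ _)
  have hr0 : 0 < √ρ := Real.sqrt_pos.2 hρ
  have hρr : ρ ≤ √ρ := by nlinarith [Real.mul_self_sqrt hρ.le]
  have hρ1 : ρ ≤ 1 := hρr.trans hr1
  obtain ⟨c1, c2⟩ := hcons n X b e ρ η hn hρ hρ1 hX hg hη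
  have hCr : C * √ρ < ε := by
    have : √ρ ≤ ε / (2 * C) := hr.trans ((min_le_right _ _).trans (min_le_left _ _))
    rw [le_div_iff₀ (by positivity)] at this
    linarith
  have hKr : K * √ρ ≤ 1 / 2 := by
    have : √ρ ≤ 1 / (2 * K) := hr.trans ((min_le_right _ _).trans (min_le_right _ _))
    rw [le_div_iff₀ (by positivity)] at this
    linarith
  have hεs : ε ≤ φ - sLo ∧ ε ≤ sHi - φ ∧ ε ≤ ω2 - xLo ∧ ε ≤ xHi - ω2 :=
    ⟨(min_le_left _ _).trans (min_le_left _ _), (min_le_left _ _).trans (min_le_right _ _),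
      (min_le_right _ _).trans (min_le_left _ _), (min_le_right _ _).trans (min_le_right _ _)⟩
  have c1' := abs_le.1 c1
  have c2' := abs_le.1 c2
  have hs : η 0 ∈ Set.Ioo sLo sHi := ⟨by linarith [hεs.1], by linarith [hεs.2.1]⟩
  have hx : η 1 ∈ Set.Ioo xLo xHi := ⟨by linarith [hεs.2.2.1], by linarith [hεs.2.2.2]⟩
  have hx0 : 0 < η 1 := hxLo.trans hx.1
  have E0 := score_s_expand hx0 hy hX (hη.score_s hxLo hy hs)
  have E1 := score_x_expand (ω2 := ω2) hx0 hy hX (hη.score_x hxLo hy hx)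
  clear c1' c2' hεs hs hcons hη
  generalize η 0 = s at *
  generalize η 1 = x at *
  have hWS : ∀ (ξ : ℕ → ℝ) (D : ℝ) (i : Fin 5), 0 ≤ D →
      (∀ k, |ξ k| ≤ D * (1 + b (k + 1) ^ 2 + e (k + 1) ^ 2)) → _ := fun ξ D i hD hξ =>
    abs_sum_mul_scoreWeight_le (y := y) i hD hB0 hx.1.le hω.1.le hB hg.escape hξ
  have hn0 : (0 : ℝ) < n := by exact_mod_cast hn
  -- The crude bound of order `ρ n` suffices for sums that are multiplied by a power of `s - φ` or
  -- by `x - ω2`. The other sums need order `ρ √n` and go through the weights at `ω2`.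
  have W10 := (hWS (fun _ => 1) 1 0 (by norm_num) fun k => (abs_le_noise _ _).1).1
  have W12 := (hWS (fun _ => 1) 1 2 (by norm_num) fun k => (abs_le_noise _ _).1).1
  have Wb0 := (hWS (fun k => b (k + 1)) 1 0 (by norm_num) fun k => (abs_le_noise _ _).2.1).2.trans
    (add_le_add_left hg.score₀ _)
  have We1 := (hWS (fun k => e (k + 1)) 1 1 (by norm_num)
    fun k => (abs_le_noise _ _).2.2.1).2.trans (add_le_add_left hg.score₁ _)
  have Wbb := (hWS (fun k => b (k + 1) ^ 2 - ω2) (1 + ω2) 2 (by positivity)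
    fun k => (abs_le_noise _ _).2.2.2.2.1 _ hω0.le).2.trans (add_le_add_left hg.score₂ _)
  have Wbe := (hWS (fun k => b (k + 1) * e (k + 1)) 1 3 (by norm_num)
    fun k => (abs_le_noise _ _).2.2.2.1).2.trans (add_le_add_left hg.score₃ _)
  have Wee := (hWS (fun k => e (k + 1) ^ 2 - y) (1 + y) 4 (by positivity)
    fun k => (abs_le_noise _ _).2.2.2.2.2 _ hy.le).2.trans (add_le_add_left hg.score₄ _)
  have Wb2 := (hWS (fun k => b (k + 1)) 1 2 (by norm_num) fun k => (abs_le_noise _ _).2.1).1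
  have We3 := (hWS (fun k => e (k + 1)) 1 3 (by norm_num) fun k => (abs_le_noise _ _).2.2.1).1
  have Wb := hg.mean
  clear hWS hg hB
  set m := √(n : ℝ) with hm
  have hm0 : 0 < m := Real.sqrt_pos.2 hn0
  have hmm : (n : ℝ) = m * m := (Real.mul_self_sqrt hn0.le).symm
  set δs := |s - φ| with hδs
  set δx := |x - ω2| with hδx
  have hδs0 : 0 ≤ δs := abs_nonneg _
  have hδx0 : 0 ≤ δx := abs_nonneg _
  set Sb := ∑ k ∈ Finset.range n, b (k + 1)
  set Sbb := ∑ k ∈ Finset.range n, (b (k + 1) ^ 2 - ω2)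
  generalize ∑ k ∈ Finset.range n, 1 * scoreWeight y 0 x (X k) = V10 at *
  generalize ∑ k ∈ Finset.range n, 1 * scoreWeight y 2 x (X k) = V12 at *
  generalize ∑ k ∈ Finset.range n, b (k + 1) * scoreWeight y 0 x (X k) = Vb0 at *
  generalize ∑ k ∈ Finset.range n, e (k + 1) * scoreWeight y 1 x (X k) = Ve1 at *
  generalize ∑ k ∈ Finset.range n, (b (k + 1) ^ 2 - ω2) * scoreWeight y 2 x (X k) = Vbb at *
  generalize ∑ k ∈ Finset.range n, b (k + 1) * e (k + 1) * scoreWeight y 3 x (X k) = Vbe at *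
  generalize ∑ k ∈ Finset.range n, (e (k + 1) ^ 2 - y) * scoreWeight y 4 x (X k) = Vee at *
  generalize ∑ k ∈ Finset.range n, b (k + 1) * scoreWeight y 2 x (X k) = Vb2 at *
  generalize ∑ k ∈ Finset.range n, e (k + 1) * scoreWeight y 3 x (X k) = Ve3 at *
  set r := √ρ
  -- common scale of all remainders
  set G := r * (m * m * δs + m * m * δx + m) with hG
  have hr0' := hr0.le
  have g1 : r * (m * m * δs) ≤ G := by
    rw [hG]; apply mul_le_mul_of_nonneg_left _ hr0'; linarith [mul_nonneg (mul_pos hm0 hm0).le hδx0]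
  have g2 : r * (m * m * δx) ≤ G := by
    rw [hG]; apply mul_le_mul_of_nonneg_left _ hr0'; linarith [mul_nonneg (mul_pos hm0 hm0).le hδs0]
  have hG0 : 0 ≤ G := le_trans (by positivity) g1
  rw [hmm] at W10 W12 Wb0 We1 Wbb Wbe Wee Wb2 We3 Wb
  have hρm : ρ * (m * m) ≤ r * (m * m) := by gcongr
  have hρG : ρ * m + δx * (ρ * (m * m)) ≤ G := by
    calc ρ * m + δx * (ρ * (m * m)) ≤ r * m + δx * (r * (m * m)) := by gcongr
      _ ≤ G := by rw [hG]; linarith [mul_nonneg hr0' (mul_nonneg (mul_pos hm0 hm0).le hδs0)]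
  have up : ∀ D, 0 ≤ D → D * B * δx * (ρ * (m * m)) + ρ * m ≤ (1 + D * B) * G := by
    intro D hD
    have h1 : δx * (ρ * (m * m)) ≤ G := le_trans (by linarith [mul_pos hρ hm0]) hρG
    have h2 : ρ * m ≤ G := le_trans
      (by linarith [mul_nonneg hδx0 (mul_pos hρ (mul_pos hm0 hm0)).le]) hρG
    have h3 := mul_le_mul_of_nonneg_left h1 (mul_nonneg hD hB0.le)
    linarith
  have F1 : ∀ V D, 0 ≤ D → |V| ≤ D * (ρ * (m * m)) → |(s - φ) * V| ≤ D * G ∧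
      |(x - ω2) * V| ≤ D * G := by
    intro V D hD hV
    have hV' : |V| ≤ D * (r * (m * m)) := hV.trans (by gcongr)
    constructor
    · refine (abs_mul_le_of_le le_rfl hV').trans ?_
      have := mul_le_mul_of_nonneg_left g1 hD
      linarith
    · refine (abs_mul_le_of_le le_rfl hV').trans ?_
      have := mul_le_mul_of_nonneg_left g2 hD
      linarith
  have A0 : |n * (s - φ) - Sb| ≤ K₀ * G := by
    have t1 : |y * ((s - φ) * V10)| ≤ y * (B * G) := by
      rw [abs_mul, abs_of_pos hy]
      gcongr
      exact (F1 V10 B hB0.le (by simpa using W10)).1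
    have t2 : |y * Vb0| ≤ y * ((1 + B) * G) := by
      rw [abs_mul, abs_of_pos hy]
      gcongr
      linarith [up 1 (by norm_num)]
    have t3 : |x * Ve1| ≤ xHi * ((1 + B) * G) := by
      refine abs_mul_le_of_le (by rw [abs_of_pos hx0]; exact hx.2.le) ?_
      linarith [up 1 (by norm_num)]
    rw [E0, abs_le, hK₀]
    constructor <;> linarith [abs_le.1 t1, abs_le.1 t2, abs_le.1 t3]
  have A1 : |n * (x - ω2) - Sbb| ≤ K₁ * G := by
    have hx2 : |x ^ 2| ≤ xHi ^ 2 := by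
      rw [abs_of_pos (by positivity)]; gcongr; exact hx.2.le
    have t1 := (F1 V12 B hB0.le (by simpa using W12)).2
    have t2 := Wbb.trans (by linarith [up (1 + ω2) (by positivity)] : _ ≤ (1 + (1 + ω2) * B) * G)
    have t3 : |2 * Vbe + Vee| ≤ (2 * (1 + B) + (1 + (1 + y) * B)) * G := by
      refine (abs_add_le _ _).trans ?_
      rw [abs_mul, abs_two]
      linarith [up (1 + y) (by positivity), up 1 (by norm_num)]
    have t3' := abs_mul_le_of_le hx2 t3
    have t4 := (F1 Sb 1 (by norm_num) (by simpa using Wb)).1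
    have t5 := (F1 Vb2 B hB0.le (by simpa using Wb2)).1
    have t6 := abs_mul_le_of_le hx2 (F1 Ve3 B hB0.le (by simpa using We3)).1
    -- The quadratic term is of order `n` times a square. Consistency turns one of its two factors
    -- into `C * √ρ`.
    have t7 : |(s - φ) ^ 2 * (n - V12)| ≤ C * (1 + B) * G := by
      have h1 : |(n : ℝ) - V12| ≤ (1 + B) * (m * m) := by
        refine (abs_sub _ _).trans ?_
        rw [abs_of_pos hn0, hmm]
        have : 1 * B * (ρ * (m * m)) ≤ 1 * B * (1 * (m * m)) := by gcongr
        linarith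
      have h2 : |(s - φ) ^ 2| ≤ δs * (C * r) := by
        rw [sq]; exact abs_mul_le_of_le le_rfl c1
      refine (abs_mul_le_of_le h2 h1).trans ?_
      have := mul_le_mul_of_nonneg_left g1 (by positivity : 0 ≤ C * (1 + B))
      linarith
    rw [E1, abs_le, hK₁]
    constructor <;> linarith [abs_le.1 t1, abs_le.1 t2, abs_le.1 t3', abs_le.1 t4, abs_le.1 t5,
      abs_le.1 t6, abs_le.1 t7]
  -- division by `√n`
  have hscale : ∀ d S c : ℝ, |n * d - S| ≤ c * G →
      |m * d - m⁻¹ * S| ≤ c * (r * (m * δs + m * δx + 1)) := by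
    intro d S c h
    have h1 : m * d - m⁻¹ * S = (n * d - S) / m := by rw [hmm]; field_simp
    have h2 : G = m * (r * (m * δs + m * δx + 1)) := by rw [hG]; ring
    rw [h1, abs_div, abs_of_pos hm0, div_le_iff₀ hm0]
    rw [h2] at h
    linarith
  have Z0 := hscale _ _ _ A0
  have Z1 := hscale _ _ _ A1
  set T0 := m⁻¹ * Sb
  set T1 := m⁻¹ * Sbb
  have hN0 : m * δs ≤ |T0| + |m * (s - φ) - T0| := by
    have : m * δs = |T0 + (m * (s - φ) - T0)| := by
      rw [hδs, add_sub_cancel, abs_mul, abs_of_pos hm0]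
    rw [this]; exact abs_add_le _ _
  have hN1 : m * δx ≤ |T1| + |m * (x - ω2) - T1| := by
    have : m * δx = |T1 + (m * (x - ω2) - T1)| := by
      rw [hδx, add_sub_cancel, abs_mul, abs_of_pos hm0]
    rw [this]; exact abs_add_le _ _
  set W := |m * (s - φ) - T0| + |m * (x - ω2) - T1|
  have hW : W ≤ K * r * (m * δs + m * δx + 1) := by rw [hK]; linarith
  -- Absorption: the remainder is at most half of the quantity being bounded.
  have hN : m * δs + m * δx + 1 ≤ 2 * (1 + |T0| + |T1|) := by
    have : K * r * (m * δs + m * δx + 1) ≤ 1 / 2 * (m * δs + m * δx + 1) := by gcongr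
    linarith
  calc W ≤ K * r * (m * δs + m * δx + 1) := hW
    _ ≤ K * r * (2 * (1 + |T0| + |T1|)) := by gcongr
    _ = _ := by ring

/-! ### The noise filtration and integration over the next innovation. -/

section Noise

variable {Ω : Type*} {b e : ℕ → Ω → ℝ}

/-- The σ-algebra generated by the noise up to time `k`. -/
abbrev noiseSigma (b e : ℕ → Ω → ℝ) (k : ℕ) : MeasurableSpace Ω :=
  ⨆ i ∈ Set.Iic k, MeasurableSpace.comap (fun w => (b i w, e i w)) inferInstance

lemma noiseSigma_mono {i j : ℕ} (h : i ≤ j) : noiseSigma b e i ≤ noiseSigma b e j :=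
  biSup_mono fun _ hk => le_trans (Set.mem_Iic.1 hk) h

lemma measurable_noiseSigma {i k : ℕ} (h : i ≤ k) :
    Measurable[noiseSigma b e k] (fun w => (b i w, e i w)) := by
  have : MeasurableSpace.comap (fun w => (b i w, e i w)) inferInstance ≤ noiseSigma b e k :=
    le_biSup (fun i => MeasurableSpace.comap (fun w => (b i w, e i w)) inferInstance)
      (Set.mem_Iic.2 h)
  exact (comap_measurable _).mono this le_rfl

lemma measurable_rcaProcess_noiseSigma (φ x₀ : ℝ) {j k : ℕ} (h : j ≤ k) :
    Measurable[noiseSigma b e k] (rcaProcess φ x₀ b e j) := by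
  induction j with
  | zero =>
    have : rcaProcess φ x₀ b e 0 = fun _ => x₀ := rfl
    rw [this]; exact measurable_const
  | succ j ih =>
    have hz := measurable_noiseSigma (b := b) (e := e) h
    have hX := ih (by omega)
    have : rcaProcess φ x₀ b e (j + 1)
        = fun w => (φ + b (j + 1) w) * rcaProcess φ x₀ b e j w + e (j + 1) w := rfl
    rw [this]
    have hb : Measurable[noiseSigma b e k] (b (j + 1)) := measurable_fst.comp hz
    have he : Measurable[noiseSigma b e k] (e (j + 1)) := measurable_snd.comp hz
    exact ((hb.const_add φ).mul hX).add he

variable [mΩ : MeasurableSpace Ω] {P : Measure Ω} {μ : Measure (ℝ × ℝ)}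

/-- `(b k, e k)` is a measurable i.i.d. sequence with common law `μ`. -/
structure IsNoise (P : Measure Ω) (b e : ℕ → Ω → ℝ) (μ : Measure (ℝ × ℝ)) : Prop where
  meas_b : ∀ k, Measurable (b k)
  meas_e : ∀ k, Measurable (e k)
  indep : iIndepFun (fun (k : ℕ) (w : Ω) => (b k w, e k w)) P
  law : ∀ k, P.map (fun w => (b k w, e k w)) = μ

namespace IsNoise

variable (hN : IsNoise P b e μ)
include hN

lemma meas (k : ℕ) : Measurable fun w => (b k w, e k w) := (hN.meas_b k).prodMk (hN.meas_e k)

lemma noiseSigma_le (k : ℕ) : noiseSigma b e k ≤ mΩ :=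
  iSup₂_le fun i _ => (hN.meas i).comap_le

lemma measurable_rcaProcess (φ x₀ : ℝ) (k : ℕ) : Measurable (rcaProcess φ x₀ b e k) :=
  (measurable_rcaProcess_noiseSigma φ x₀ le_rfl).mono (hN.noiseSigma_le k) le_rfl

/-- The index sets `{0, ..., k}` and `{k + 1}` are disjoint, so the σ-algebras they generate are
independent. -/
lemma indepFun_succ {γ : Type*} [MeasurableSpace γ] {k : ℕ} {U : Ω → γ}
    (hU : Measurable[noiseSigma b e k] U) :
    IndepFun U (fun w => (b (k + 1) w, e (k + 1) w)) P := by
  have h := indep_iSup_of_disjoint (fun i => (hN.meas i).comap_le) hN.indep.iIndep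
    (S := Set.Iic k) (T := {k + 1}) (by simp)
  rw [IndepFun_iff_Indep]
  refine indep_of_indep_of_le_left (indep_of_indep_of_le_right h ?_) hU.comap_le
  simp

lemma map_prodMk [IsProbabilityMeasure P] {γ : Type*} [MeasurableSpace γ] {k : ℕ} {U : Ω → γ}
    (hU : Measurable[noiseSigma b e k] U) :
    P.map (fun w => (U w, (b (k + 1) w, e (k + 1) w))) = (P.map U).prod μ := by
  rw [(hN.indepFun_succ hU).map_prod_eq_prod_map_map
    (hU.mono (hN.noiseSigma_le k) le_rfl).aemeasurable (hN.meas _).aemeasurable, hN.law]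

lemma isProbabilityMeasure [IsProbabilityMeasure P] : IsProbabilityMeasure μ := by
  rw [← hN.law 0]
  exact Measure.isProbabilityMeasure_map (hN.meas 0).aemeasurable

/-- Integrating out the noise at time `k + 1`. -/
lemma integral_succ [IsProbabilityMeasure P] {γ : Type*} [MeasurableSpace γ] {k : ℕ} {U : Ω → γ}
    (hU : Measurable[noiseSigma b e k] U) {F : γ × (ℝ × ℝ) → ℝ} (hF : Measurable F)
    (hint : Integrable (fun w => F (U w, (b (k + 1) w, e (k + 1) w))) P) :
    Integrable (fun w => ∫ z, F (U w, z) ∂μ) P ∧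
    ∫ w, F (U w, (b (k + 1) w, e (k + 1) w)) ∂P = ∫ w, ∫ z, F (U w, z) ∂μ ∂P := by
  have := hN.isProbabilityMeasure
  have hU' := hU.mono (hN.noiseSigma_le k) le_rfl
  have hm := hN.map_prodMk hU
  have hUZ : Measurable fun w => (U w, (b (k + 1) w, e (k + 1) w)) := hU'.prodMk (hN.meas _)
  have hint' : Integrable F ((P.map U).prod μ) := by
    rw [← hm]
    exact (integrable_map_measure hF.aestronglyMeasurable hUZ.aemeasurable).2 hint
  have hpm : IsProbabilityMeasure (P.map U) := Measure.isProbabilityMeasure_map hU'.aemeasurable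
  have h1 := hint'.integral_prod_left
  constructor
  · exact (integrable_map_measure h1.aestronglyMeasurable hU'.aemeasurable).1 h1
  · rw [← integral_map (f := F) hUZ.aemeasurable hF.aestronglyMeasurable, hm,
      integral_prod _ hint', integral_map hU'.aemeasurable h1.aestronglyMeasurable]

lemma integral_noise {f : ℝ × ℝ → ℝ} (hf : Measurable f) (k : ℕ) :
    ∫ w, f (b k w, e k w) ∂P = ∫ z, f z ∂μ := by
  rw [← hN.law k, integral_map (hN.meas k).aemeasurable hf.aestronglyMeasurable]

lemma integrable_noise {f : ℝ × ℝ → ℝ} (hf : Integrable f μ) (k : ℕ) :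
    Integrable (fun w => f (b k w, e k w)) P := by
  rw [← hN.law k] at hf
  exact hf.comp_measurable (hN.meas k)

/-- A mean-zero function of the new noise is orthogonal to the past. -/
lemma integral_mul_succ_eq_zero [IsProbabilityMeasure P] {k : ℕ} {U : Ω → ℝ}
    (hU : Measurable[noiseSigma b e k] U) {f : ℝ × ℝ → ℝ} (hf : Measurable f)
    (hf0 : ∫ z, f z ∂μ = 0) :
    ∫ w, U w * f (b (k + 1) w, e (k + 1) w) ∂P = 0 := by
  have h := ((hN.indepFun_succ hU).comp measurable_id hf).integral_fun_mul_eq_mul_integral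
    (hU.mono (hN.noiseSigma_le k) le_rfl).aestronglyMeasurable
    (hf.comp (hN.meas _)).aestronglyMeasurable
  simp only [Function.comp_def, id] at h
  rw [h, hN.integral_noise hf, hf0, mul_zero]

lemma integrable_mul_succ [IsProbabilityMeasure P] {k : ℕ} {U : Ω → ℝ}
    (hU : Measurable[noiseSigma b e k] U) (hUi : Integrable U P) {f : ℝ × ℝ → ℝ}
    (hf : Measurable f) (hfi : Integrable f μ) :
    Integrable (fun w => U w * f (b (k + 1) w, e (k + 1) w)) P :=
  ((hN.indepFun_succ hU).comp measurable_id hf).integrable_mul hUi (hN.integrable_noise hfi _)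

lemma integral_mul_succ [IsProbabilityMeasure P] {k : ℕ} {U : Ω → ℝ}
    (hU : Measurable[noiseSigma b e k] U) {f : ℝ × ℝ → ℝ} (hf : Measurable f) :
    ∫ w, U w * f (b (k + 1) w, e (k + 1) w) ∂P = (∫ w, U w ∂P) * ∫ z, f z ∂μ := by
  have h := ((hN.indepFun_succ hU).comp measurable_id hf).integral_fun_mul_eq_mul_integral
    (hU.mono (hN.noiseSigma_le k) le_rfl).aestronglyMeasurable
    (hf.comp (hN.meas _)).aestronglyMeasurable
  simp only [Function.comp_def, id] at h
  rw [h, hN.integral_noise hf]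

end IsNoise

/-- The moment assumptions on the law of the noise. -/
structure NoiseMoments (μ : Measure (ℝ × ℝ)) (ω2 σ2 : ℝ) : Prop where
  int_b : Integrable (fun z => z.1 ^ 4) μ
  int_e : Integrable (fun z => z.2 ^ 4) μ
  b1 : ∫ z, z.1 ∂μ = 0
  b2 : ∫ z, z.1 ^ 2 ∂μ = ω2
  e1 : ∫ z, z.2 ∂μ = 0
  e2 : ∫ z, z.2 ^ 2 ∂μ = σ2
  be : ∫ z, z.1 * z.2 ∂μ = 0

namespace NoiseMoments

variable {ω2 σ2 : ℝ} (hm : NoiseMoments μ ω2 σ2) [IsProbabilityMeasure μ]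
include hm

lemma integrable_of_le {f : ℝ × ℝ → ℝ} (hf : Measurable f) (C : ℝ)
    (h : ∀ z, |f z| ≤ C * (1 + z.1 ^ 4 + z.2 ^ 4)) : Integrable f μ :=
  ((((integrable_const (1 : ℝ)).add hm.int_b).add hm.int_e).const_mul C).mono'
    hf.aestronglyMeasurable (Eventually.of_forall fun z => by simpa using h z)

end NoiseMoments

end Noise

/-! ### Moments of the process and exit from compact sets. -/

section Moments

variable {Ω : Type*} [mΩ : MeasurableSpace Ω] {P : Measure Ω}
  {b e : ℕ → Ω → ℝ} {μ : Measure (ℝ × ℝ)} {φ x₀ ω2 σ2 : ℝ}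

lemma abs_step_pow_four_le (φ x : ℝ) (z : ℝ × ℝ) :
    |((φ + z.1) * x + z.2) ^ 4| ≤ (64 * (1 + φ ^ 4) * (1 + x ^ 4)) * (1 + z.1 ^ 4 + z.2 ^ 4) := by
  -- Used twice, for the sum with the noise and for `φ + b`, which is the source of the factor 64.
  have h4 : ∀ u v : ℝ, (u + v) ^ 4 ≤ 8 * (u ^ 4 + v ^ 4) := fun u v => by
    nlinarith [sq_nonneg (u - v), sq_nonneg (u + v), sq_nonneg (u ^ 2 - v ^ 2),
      mul_nonneg (sq_nonneg (u - v)) (sq_nonneg (u + v)), mul_nonneg (sq_nonneg (u - v))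
      (sq_nonneg (u - v)), mul_nonneg (sq_nonneg (u - v)) (sq_nonneg u),
      mul_nonneg (sq_nonneg (u - v)) (sq_nonneg v)]
  rw [abs_of_nonneg (by positivity)]
  have h1 := h4 ((φ + z.1) * x) z.2
  rw [mul_pow] at h1
  have h2 := mul_le_mul_of_nonneg_right (h4 φ z.1) (by positivity : 0 ≤ x ^ 4)
  have p1 : 0 ≤ φ ^ 4 := by positivity
  have p2 : 0 ≤ x ^ 4 := by positivity
  have p3 : 0 ≤ z.1 ^ 4 := by positivity
  have p4 : 0 ≤ z.2 ^ 4 := by positivity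
  have p5 := mul_nonneg p1 p2
  have p6 := mul_nonneg p1 p3
  have p7 := mul_nonneg p1 p4
  have p8 := mul_nonneg p2 p3
  have p9 := mul_nonneg p2 p4
  have p10 := mul_nonneg p5 p3
  have p11 := mul_nonneg p5 p4
  nlinarith

namespace NoiseMoments

variable (hm : NoiseMoments μ ω2 σ2) [IsProbabilityMeasure μ]
include hm

lemma integrable_fst : Integrable (fun z => z.1) μ :=
  hm.integrable_of_le (by fun_prop) 1 fun z => by
    rw [abs_le]
    constructor <;> nlinarith [sq_nonneg (z.1 ^ 2 - 1), sq_nonneg (z.1 - 1), sq_nonneg (z.1 + 1),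
      sq_nonneg (z.2 ^ 2)]

lemma integrable_snd : Integrable (fun z => z.2) μ :=
  hm.integrable_of_le (by fun_prop) 1 fun z => by
    rw [abs_le]
    constructor <;> nlinarith [sq_nonneg (z.2 ^ 2 - 1), sq_nonneg (z.2 - 1), sq_nonneg (z.2 + 1),
      sq_nonneg (z.1 ^ 2)]

lemma integrable_fst_sq : Integrable (fun z => z.1 ^ 2) μ :=
  hm.integrable_of_le (by fun_prop) 1 fun z => by
    rw [abs_le]
    constructor <;> nlinarith [sq_nonneg (z.1 ^ 2 - 1), sq_nonneg (z.2 ^ 2), sq_nonneg z.1]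

lemma integrable_snd_sq : Integrable (fun z => z.2 ^ 2) μ :=
  hm.integrable_of_le (by fun_prop) 1 fun z => by
    rw [abs_le]
    constructor <;> nlinarith [sq_nonneg (z.2 ^ 2 - 1), sq_nonneg (z.1 ^ 2), sq_nonneg z.2]

lemma integrable_mul : Integrable (fun z => z.1 * z.2) μ :=
  hm.integrable_of_le (by fun_prop) 1 fun z => by
    rw [abs_le]
    constructor <;> nlinarith [sq_nonneg (z.2 ^ 2 - 1), sq_nonneg (z.1 ^ 2 - 1),
      sq_nonneg (z.1 - z.2), sq_nonneg (z.1 + z.2)]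

/-- The cross terms vanish because `b` and `e` are centred and uncorrelated. -/
lemma integral_step_sq (φ x : ℝ) :
    ∫ z, ((φ + z.1) * x + z.2) ^ 2 ∂μ = (φ ^ 2 + ω2) * x ^ 2 + σ2 := by
  have h : ∀ z : ℝ × ℝ, ((φ + z.1) * x + z.2) ^ 2 = φ ^ 2 * x ^ 2 + (2 * φ * x ^ 2) * z.1
      + x ^ 2 * z.1 ^ 2 + (2 * φ * x) * z.2 + (2 * x) * (z.1 * z.2) + z.2 ^ 2 := fun z => by ring
  simp_rw [h]
  have i1 := hm.integrable_fst.const_mul (2 * φ * x ^ 2)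
  have i2 := hm.integrable_fst_sq.const_mul (x ^ 2)
  have i3 := hm.integrable_snd.const_mul (2 * φ * x)
  have i4 := hm.integrable_mul.const_mul (2 * x)
  have i5 := hm.integrable_snd_sq
  have i0 : Integrable (fun _ : ℝ × ℝ => φ ^ 2 * x ^ 2) μ := integrable_const _
  rw [integral_add, integral_add, integral_add, integral_add, integral_add]
  rotate_left
  iterate 10 first
    | exact i0 | exact i1 | exact i2 | exact i3 | exact i4 | exact i5 | exact i0.add i1
    | exact (i0.add i1).add i2 | exact ((i0.add i1).add i2).add i3
    | exact (((i0.add i1).add i2).add i3).add i4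
  simp only [integral_const_mul, hm.b1, hm.b2, hm.e1, hm.e2, hm.be, integral_const, probReal_univ,
    smul_eq_mul]
  ring

lemma integrable_step_pow_four (φ x : ℝ) :
    Integrable (fun z : ℝ × ℝ => ((φ + z.1) * x + z.2) ^ 4) μ :=
  hm.integrable_of_le (by fun_prop) _ (abs_step_pow_four_le φ x)

lemma integral_step_pow_four_le (φ : ℝ) :
    ∃ C, 0 < C ∧ ∀ x, ∫ z, ((φ + z.1) * x + z.2) ^ 4 ∂μ ≤ C * (1 + x ^ 4) := by
  have hi : Integrable (fun z : ℝ × ℝ => 1 + z.1 ^ 4 + z.2 ^ 4) μ :=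
    ((integrable_const (1 : ℝ)).add hm.int_b).add hm.int_e
  have h0 : 0 ≤ ∫ z, (1 + z.1 ^ 4 + z.2 ^ 4) ∂μ := integral_nonneg fun z => by positivity
  refine ⟨64 * (1 + φ ^ 4) * (1 + ∫ z, (1 + z.1 ^ 4 + z.2 ^ 4) ∂μ), by positivity, fun x => ?_⟩
  calc ∫ z, ((φ + z.1) * x + z.2) ^ 4 ∂μ
      ≤ ∫ z, (64 * (1 + φ ^ 4) * (1 + x ^ 4)) * (1 + z.1 ^ 4 + z.2 ^ 4) ∂μ :=
        integral_mono (hm.integrable_step_pow_four φ x) (hi.const_mul _)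
          fun z => (le_abs_self _).trans (abs_step_pow_four_le φ x z)
    _ = (64 * (1 + φ ^ 4) * (1 + x ^ 4)) * ∫ z, (1 + z.1 ^ 4 + z.2 ^ 4) ∂μ := integral_const_mul _ _
    _ ≤ _ := by
      have : 0 ≤ 64 * (1 + φ ^ 4) * (1 + x ^ 4) := by positivity
      nlinarith

end NoiseMoments

namespace IsNoise

variable [IsProbabilityMeasure P] (hN : IsNoise P b e μ) (hm : NoiseMoments μ ω2 σ2)
include hN hm

lemma integrable_pow_four (φ x₀ : ℝ) (k : ℕ) :
    Integrable (fun w => rcaProcess φ x₀ b e k w ^ 4) P := by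
  have := hN.isProbabilityMeasure
  induction k with
  | zero => simp [rcaProcess]
  | succ k ih =>
    have hU : Measurable[noiseSigma b e k] (fun w => 1 + rcaProcess φ x₀ b e k w ^ 4) :=
      ((measurable_rcaProcess_noiseSigma φ x₀ le_rfl).pow_const 4).const_add 1
    have h := hN.integrable_mul_succ hU ((integrable_const (1 : ℝ)).add ih)
      (f := fun z => 1 + z.1 ^ 4 + z.2 ^ 4) (by fun_prop)
      (((integrable_const (1 : ℝ)).add hm.int_b).add hm.int_e)
    refine (h.const_mul (64 * (1 + φ ^ 4))).mono'
      ((hN.measurable_rcaProcess φ x₀ (k + 1)).pow_const 4).aestronglyMeasurable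
      (Eventually.of_forall fun w => ?_)
    have := abs_step_pow_four_le φ (rcaProcess φ x₀ b e k w) (b (k + 1) w, e (k + 1) w)
    rw [Real.norm_eq_abs]
    refine this.trans (le_of_eq ?_)
    ring

lemma integrable_sq (φ x₀ : ℝ) (k : ℕ) :
    Integrable (fun w => rcaProcess φ x₀ b e k w ^ 2) P := by
  refine ((integrable_const (1 : ℝ)).add (hN.integrable_pow_four hm φ x₀ k)).mono'
    ((hN.measurable_rcaProcess φ x₀ k).pow_const 2).aestronglyMeasurable
    (Eventually.of_forall fun w => ?_)
  rw [Real.norm_eq_abs, abs_of_nonneg (by positivity), Pi.add_apply]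
  nlinarith [sq_nonneg (rcaProcess φ x₀ b e k w ^ 2 - 1), sq_nonneg (rcaProcess φ x₀ b e k w)]

/-- Second moment of the state after one step, on an event of the past. -/
lemma integral_indicator_sq_succ (φ x₀ : ℝ) {k : ℕ} {ι : Ω → ℝ}
    (hι : Measurable[noiseSigma b e k] ι) (hι1 : ∀ w, ι w ∈ Set.Icc (0 : ℝ) 1) :
    ∫ w, ι w * rcaProcess φ x₀ b e (k + 1) w ^ 2 ∂P
      = (φ ^ 2 + ω2) * ∫ w, ι w * rcaProcess φ x₀ b e k w ^ 2 ∂P + σ2 * ∫ w, ι w ∂P := by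
  have := hN.isProbabilityMeasure
  have hιm : Measurable ι := hι.mono (hN.noiseSigma_le k) le_rfl
  have hιb : ∀ᵐ w ∂P, ‖ι w‖ ≤ 1 := Eventually.of_forall fun w => by
    rw [Real.norm_eq_abs, abs_of_nonneg (hι1 w).1]; exact (hι1 w).2
  have hU : Measurable[noiseSigma b e k] (fun w => (ι w, rcaProcess φ x₀ b e k w)) :=
    hι.prodMk (measurable_rcaProcess_noiseSigma φ x₀ le_rfl)
  have h := (hN.integral_succ hU (F := fun p => p.1.1 * ((φ + p.2.1) * p.1.2 + p.2.2) ^ 2)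
    (by fun_prop)
    ((hN.integrable_sq hm φ x₀ (k + 1)).bdd_mul hιm.aestronglyMeasurable hιb)).2
  refine h.trans ?_
  simp only [integral_const_mul, hm.integral_step_sq]
  rw [← integral_const_mul, ← integral_const_mul, ← integral_add]
  · refine integral_congr_ae (Eventually.of_forall fun w => ?_)
    simp only; ring
  · exact ((hN.integrable_sq hm φ x₀ k).bdd_mul hιm.aestronglyMeasurable hιb).const_mul _
  · exact (Integrable.of_bound hιm.aestronglyMeasurable 1 hιb).const_mul _

/-- An upper bound on fourth moments, localised to an event of the past; in `exists_exit` it limits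
how much of the second moment can come from very large states. -/
lemma integral_indicator_pow_four_succ_le (φ : ℝ) :
    ∃ C, 0 < C ∧ ∀ (x₀ : ℝ) (k : ℕ) (ι : Ω → ℝ),
    Measurable[noiseSigma b e k] ι → (∀ w, ι w ∈ Set.Icc (0 : ℝ) 1) →
    ∫ w, ι w * rcaProcess φ x₀ b e (k + 1) w ^ 4 ∂P
      ≤ C * (∫ w, ι w * rcaProcess φ x₀ b e k w ^ 4 ∂P + ∫ w, ι w ∂P) := by
  have := hN.isProbabilityMeasure
  obtain ⟨C, hC, hle⟩ := hm.integral_step_pow_four_le φ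
  refine ⟨C, hC, fun x₀ k ι hι hι1 => ?_⟩
  have hιm : Measurable ι := hι.mono (hN.noiseSigma_le k) le_rfl
  have hιb : ∀ᵐ w ∂P, ‖ι w‖ ≤ 1 := Eventually.of_forall fun w => by
    rw [Real.norm_eq_abs, abs_of_nonneg (hι1 w).1]; exact (hι1 w).2
  have hU : Measurable[noiseSigma b e k] (fun w => (ι w, rcaProcess φ x₀ b e k w)) :=
    hι.prodMk (measurable_rcaProcess_noiseSigma φ x₀ le_rfl)
  obtain ⟨hi, h⟩ := (hN.integral_succ hU (F := fun p => p.1.1 * ((φ + p.2.1) * p.1.2 + p.2.2) ^ 4)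
    (by fun_prop)
    ((hN.integrable_pow_four hm φ x₀ (k + 1)).bdd_mul hιm.aestronglyMeasurable hιb))
  refine h.le.trans ?_
  simp only [integral_const_mul] at hi ⊢
  have i4 := (hN.integrable_pow_four hm φ x₀ k).bdd_mul hιm.aestronglyMeasurable hιb
  have i1 : Integrable ι P := Integrable.of_bound hιm.aestronglyMeasurable 1 hιb
  rw [← integral_add i4 i1, ← integral_const_mul]
  refine integral_mono hi ((i4.add i1).const_mul C) fun w => ?_
  have := mul_le_mul_of_nonneg_left (hle (rcaProcess φ x₀ b e k w)) (hι1 w).1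
  simp only
  linarith

/-- From a compact set the process moves with positive probability, in a bounded number of steps,
to an annulus outside it. -/
lemma exists_exit (hσ2 : 0 < σ2) (hexp : 1 ≤ φ ^ 2 + ω2) (x₀ : ℝ) {K : ℝ} (hK : 0 ≤ K) :
    ∃ (m : ℕ) (M : ℝ), 0 < M ∧ ∀ k,
      P.real {w | |(rcaProcess φ x₀ b e k w)| ≤ K}
        ≤ M ^ 2 * P.real {w | |(rcaProcess φ x₀ b e (k + m) w)| ∈ Set.Icc K M} := by
  obtain ⟨C, hC, h4⟩ := hN.integral_indicator_pow_four_succ_le hm φ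
  -- Since `φ² + ω² ≥ 1`, each step adds at least `σ²` times the probability of the starting event
  -- to the localised second moment. Here `m` is large enough for it to exceed `K² + 2` times that
  -- probability.
  obtain ⟨m, hmK⟩ := exists_nat_ge ((K ^ 2 + 2) / σ2)
  rw [div_le_iff₀ hσ2] at hmK
  have hCm : ∃ D : ℕ → ℝ, D 0 = K ^ 4 ∧ ∀ j, D (j + 1) = C * (D j + 1) :=
    ⟨fun j => Nat.rec (K ^ 4) (fun _ d => C * (d + 1)) j, rfl, fun _ => rfl⟩
  obtain ⟨D, hD0, hDs⟩ := hCm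
  have hDp : ∀ j, 0 ≤ D j := fun j => by
    induction j with
    | zero => rw [hD0]; positivity
    | succ j ih => rw [hDs]; positivity
  -- Chosen so that `D m ≤ M²`: the part of the second moment carried by states beyond `M` is then
  -- at most the probability of the starting event.
  set M := K + √(D m) + 1 with hM
  have hMp : 0 < M := by positivity
  have hMD : D m ≤ M ^ 2 := by
    have := Real.sq_sqrt (hDp m)
    have := Real.sqrt_nonneg (D m)
    nlinarith
  refine ⟨m, M, hMp, fun k => ?_⟩
  set X := rcaProcess φ x₀ b e with hX
  set ι : Ω → ℝ := fun w => (Set.Icc (-K) K).indicator 1 (X k w) with hιdef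
  have hι : Measurable[noiseSigma b e k] ι :=
    ((measurable_const (a := (1 : ℝ))).indicator measurableSet_Icc).comp
      (measurable_rcaProcess_noiseSigma φ x₀ le_rfl)
  have hι1 : ∀ w, ι w ∈ Set.Icc (0 : ℝ) 1 := fun w => by
    by_cases h : X k w ∈ Set.Icc (-K) K <;> simp [hιdef, h]
  have hιk : ∀ j, Measurable[noiseSigma b e (k + j)] ι :=
    fun j => hι.mono (noiseSigma_mono (by omega)) le_rfl
  have hιm : Measurable ι := hι.mono (hN.noiseSigma_le k) le_rfl
  have hιb : ∀ᵐ w ∂P, ‖ι w‖ ≤ 1 := Eventually.of_forall fun w => by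
    rw [Real.norm_eq_abs, abs_of_nonneg (hι1 w).1]; exact (hι1 w).2
  have iι : Integrable ι P := Integrable.of_bound hιm.aestronglyMeasurable 1 hιb
  have i2 : ∀ j, Integrable (fun w => ι w * X j w ^ 2) P := fun j =>
    (hN.integrable_sq hm φ x₀ j).bdd_mul hιm.aestronglyMeasurable hιb
  have i4 : ∀ j, Integrable (fun w => ι w * X j w ^ 4) P := fun j =>
    (hN.integrable_pow_four hm φ x₀ j).bdd_mul hιm.aestronglyMeasurable hιb
  have hp : ∫ w, ι w ∂P = P.real {w | |X k w| ≤ K} := by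
    have : ι = Set.indicator {w | |X k w| ≤ K} 1 := by
      ext w
      by_cases h : |X k w| ≤ K
      · simp [hιdef, h, abs_le.1 h]
      · have h' : ¬ (-K ≤ X k w ∧ X k w ≤ K) := fun h' => h (abs_le.2 h')
        simp [hιdef, h, Set.indicator, h']
    rw [this, integral_indicator_one]
    exact measurableSet_le (hN.measurable_rcaProcess φ x₀ k).abs measurable_const
  set p := P.real {w | |X k w| ≤ K} with hpdef
  have hp0 : 0 ≤ p := measureReal_nonneg
  have h2 : ∀ j : ℕ, j * σ2 * p ≤ ∫ w, ι w * X (k + j) w ^ 2 ∂P := by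
    intro j
    induction j with
    | zero =>
      simp only [Nat.cast_zero, zero_mul]
      exact integral_nonneg fun w => mul_nonneg (hι1 w).1 (sq_nonneg _)
    | succ j ih =>
      have := hN.integral_indicator_sq_succ hm φ x₀ (hιk j) hι1
      rw [← add_assoc, this, hp]
      have h0 : 0 ≤ ∫ w, ι w * X (k + j) w ^ 2 ∂P :=
        integral_nonneg fun w => mul_nonneg (hι1 w).1 (sq_nonneg _)
      push_cast
      nlinarith
  have h4' : ∀ j : ℕ, ∫ w, ι w * X (k + j) w ^ 4 ∂P ≤ D j * p := by
    intro j
    induction j with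
    | zero =>
      rw [hD0, ← hp, ← integral_const_mul]
      refine integral_mono (i4 _) (iι.const_mul _) fun w => ?_
      by_cases h : X k w ∈ Set.Icc (-K) K
      · have : X k w ^ 4 ≤ K ^ 4 := by
          have h1 : X k w ^ 2 ≤ K ^ 2 := sq_le_sq' h.1 h.2
          nlinarith [sq_nonneg (X k w)]
        simpa [hιdef, h] using this
      · simp [hιdef, h]
    | succ j ih =>
      have := h4 x₀ (k + j) ι (hιk j) hι1
      rw [← add_assoc]
      refine this.trans ?_
      rw [hp, hDs, mul_assoc, add_mul, one_mul]
      gcongr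
  set A := {w | |X (k + m) w| ∈ Set.Icc K M} with hA
  have hAm : MeasurableSet A := (hN.measurable_rcaProcess φ x₀ (k + m)).abs measurableSet_Icc
  -- The three terms cover `|x| < K`, the annulus, and `|x| > M`, where `x² ≤ x⁴ / M²`. Integration
  -- leaves at least one unit of the starting probability to be carried by the annulus.
  have hpt : ∀ w, ι w * X (k + m) w ^ 2
      ≤ K ^ 2 * ι w + M ^ 2 * A.indicator 1 w + (1 / M ^ 2) * (ι w * X (k + m) w ^ 4) := by
    intro w
    have hi0 := (hι1 w).1
    have hi1 := (hι1 w).2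
    set x := X (k + m) w
    have hx4 : x ^ 4 = |x| ^ 4 := (Even.pow_abs (by decide) x).symm
    have n1 : 0 ≤ K ^ 2 * ι w := by positivity
    have n2 : 0 ≤ (A.indicator 1 w : ℝ) := Set.indicator_nonneg (fun _ _ => zero_le_one) w
    have n3 : 0 ≤ M ^ 2 * A.indicator 1 w := by positivity
    have n4 : 0 ≤ (1 / M ^ 2) * (ι w * x ^ 4) := by positivity
    rcases lt_or_ge |x| K with h | h
    · have : x ^ 2 ≤ K ^ 2 := by rw [← sq_abs]; gcongr
      nlinarith
    · rcases le_or_gt |x| M with h' | h'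
      · have hw : w ∈ A := ⟨h, h'⟩
        have : x ^ 2 ≤ M ^ 2 := by rw [← sq_abs]; gcongr
        simp only [Set.indicator_of_mem hw, Pi.one_apply, mul_one] at *
        nlinarith [sq_nonneg x]
      · have h1 : M ^ 2 ≤ x ^ 2 := by rw [← sq_abs x]; gcongr
        have h2 : x ^ 2 ≤ (1 / M ^ 2) * x ^ 4 := by
          rw [div_mul_eq_mul_div, one_mul, le_div_iff₀ (by positivity)]
          nlinarith [sq_nonneg x]
        nlinarith
  have hint := integral_mono (i2 (k + m)) (((iι.const_mul (K ^ 2)).add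
    (((integrable_const (1 : ℝ)).indicator hAm).const_mul (M ^ 2))).add
    ((i4 (k + m)).const_mul (1 / M ^ 2))) hpt
  have e1 : ∫ w, (K ^ 2 * ι w + M ^ 2 * A.indicator 1 w + (1 / M ^ 2) * (ι w * X (k + m) w ^ 4)) ∂P
      = K ^ 2 * p + M ^ 2 * P.real A + (1 / M ^ 2) * ∫ w, ι w * X (k + m) w ^ 4 ∂P := by
    rw [integral_add, integral_add, integral_const_mul, integral_const_mul, integral_const_mul,
      integral_indicator_one hAm, hp]
    · exact iι.const_mul _
    · exact ((integrable_const (1 : ℝ)).indicator hAm).const_mul _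
    · exact (iι.const_mul _).add (((integrable_const (1 : ℝ)).indicator hAm).const_mul _)
    · exact (i4 _).const_mul _
  have hint' : ∫ w, ι w * X (k + m) w ^ 2 ∂P
      ≤ K ^ 2 * p + M ^ 2 * P.real A + (1 / M ^ 2) * ∫ w, ι w * X (k + m) w ^ 4 ∂P :=
    hint.trans_eq e1
  have h5 : (1 / M ^ 2) * ∫ w, ι w * X (k + m) w ^ 4 ∂P ≤ p := by
    calc (1 / M ^ 2) * ∫ w, ι w * X (k + m) w ^ 4 ∂P ≤ (1 / M ^ 2) * (D m * p) := by
          gcongr; exact h4' m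
      _ ≤ (1 / M ^ 2) * (M ^ 2 * p) := by gcongr
      _ = p := by field_simp
  have h6 := h2 m
  nlinarith [mul_le_mul_of_nonneg_right hmK hp0]

end IsNoise

end Moments

/-! ### Occupation times from a Lyapunov function. -/

section Occupation

variable {Ω : Type*} [mΩ : MeasurableSpace Ω] {P : Measure Ω}
  {b e : ℕ → Ω → ℝ} {μ : Measure (ℝ × ℝ)} {φ x₀ ω2 σ2 : ℝ}

/-- A Lyapunov function: `V` increases in mean under one step of the recursion started outside
`[-K, K]`, by an amount bounded below on bounded sets. -/
structure IsDrift (μ : Measure (ℝ × ℝ)) (φ : ℝ) (V : ℝ → ℝ) (K v₀ : ℝ) : Prop where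
  meas : Measurable V
  nonneg : ∀ x, 0 ≤ V x
  growth : ∃ C, ∀ x, V x ≤ C * (1 + |x|)
  inner : ∀ x, |x| ≤ K → V x ≤ v₀
  outer : ∀ x, K ≤ |x| → v₀ ≤ V x
  drift : ∀ M, ∃ c, 0 < c ∧ ∀ x, K ≤ |x| → |x| ≤ M →
    V x + c ≤ ∫ z, V ((φ + z.1) * x + z.2) ∂μ

lemma NoiseMoments.integrable_step [IsProbabilityMeasure μ] (hm : NoiseMoments μ ω2 σ2)
    {V : ℝ → ℝ} (hV : Measurable V) {C : ℝ}
    (h : ∀ x, |V x| ≤ C * (1 + |x|)) (φ x : ℝ) :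
    Integrable (fun z : ℝ × ℝ => V ((φ + z.1) * x + z.2)) μ := by
  have hC : 0 ≤ C := by simpa using (abs_nonneg _).trans (h 0)
  refine (((integrable_const (2 : ℝ)).add (hm.integrable_step_pow_four φ x)).const_mul C).mono'
    (hV.comp (by fun_prop)).aestronglyMeasurable
    (Eventually.of_forall fun z => (h _).trans ?_)
  simp only [Pi.add_apply]
  refine mul_le_mul_of_nonneg_left ?_ hC
  set t := (φ + z.1) * x + z.2
  have h4 : t ^ 4 = (|t| ^ 2) ^ 2 := by rw [sq_abs]; ring
  rw [h4]
  nlinarith [sq_nonneg (|t| - 1), sq_nonneg (|t| ^ 2 - 1)]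

namespace IsNoise

variable [IsProbabilityMeasure P] (hN : IsNoise P b e μ) (hm : NoiseMoments μ ω2 σ2)
include hN hm

lemma integrable_of_linear_growth {V : ℝ → ℝ} (hV : Measurable V) {C : ℝ}
    (h : ∀ x, |V x| ≤ C * (1 + |x|)) (φ x₀ : ℝ) (k : ℕ) :
    Integrable (fun w => V (rcaProcess φ x₀ b e k w)) P := by
  have hC : 0 ≤ C := by simpa using (abs_nonneg _).trans (h 0)
  refine (((integrable_const (2 : ℝ)).add (hN.integrable_sq hm φ x₀ k)).const_mul C).mono'
    (hV.comp (hN.measurable_rcaProcess φ x₀ k)).aestronglyMeasurable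
    (Eventually.of_forall fun w => (h _).trans ?_)
  simp only [Pi.add_apply]
  refine mul_le_mul_of_nonneg_left ?_ hC
  nlinarith [sq_abs (rcaProcess φ x₀ b e k w), sq_nonneg (|(rcaProcess φ x₀ b e k w)| - 1)]

/-- The mean of `max (V, v₀)` along the process never decreases, and each visit to the annulus
raises it by at least a fixed amount. The total number of visits is therefore controlled by `E
V(X_n)`, which is `o(n)`. -/
lemma tendsto_occupation_annulus {V : ℝ → ℝ} {K v₀ : ℝ} (hV : IsDrift μ φ V K v₀)
    (hgrow : Tendsto (fun n : ℕ => (∫ w, V (rcaProcess φ x₀ b e n w) ∂P) / n) atTop (𝓝 0))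
    (M : ℝ) :
    Tendsto (fun n : ℕ =>
      (∑ k ∈ Finset.range n, P.real {w | |(rcaProcess φ x₀ b e k w)| ∈ Set.Icc K M}) / n)
      atTop (𝓝 0) := by
  have := hN.isProbabilityMeasure
  obtain ⟨c, hc, hdr⟩ := hV.drift M
  obtain ⟨C, hC⟩ := hV.growth
  set X := rcaProcess φ x₀ b e with hX
  -- Truncation from below removes the need for a drift inside `[-K, K]`: there `W` takes its
  -- minimum `v₀`, so its mean cannot fall.
  set W : ℝ → ℝ := fun x => max (V x) v₀ with hW
  have hWm : Measurable W := hV.meas.max measurable_const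
  have hC0 : 0 ≤ C := by simpa using (hV.nonneg 0).trans (hC 0)
  have hVg : ∀ x, |V x| ≤ C * (1 + |x|) := fun x => by
    rw [abs_of_nonneg (hV.nonneg x)]; exact hC x
  have hWg : ∀ x, |W x| ≤ (C + |v₀|) * (1 + |x|) := fun x => by
    have h1 := hC x
    have h2 := hV.nonneg x
    have h3 := abs_nonneg x
    have h4 := abs_nonneg v₀
    have h5 := abs_le.1 (le_refl |v₀|)
    have h6 := mul_nonneg h4 h3
    have h7 := mul_nonneg hC0 h3
    rw [abs_le]
    constructor
    · exact (by nlinarith : -((C + |v₀|) * (1 + |x|)) ≤ V x).trans (le_max_left _ _)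
    · exact max_le (by nlinarith) (by nlinarith)
  have hWi : ∀ k, Integrable (fun w => W (X k w)) P := fun k => hN.integrable_of_linear_growth hm hWm hWg φ x₀ k
  have hVi : ∀ k, Integrable (fun w => V (X k w)) P := fun k => hN.integrable_of_linear_growth hm hV.meas hVg φ x₀ k
  set p : ℕ → ℝ := fun k => P.real {w | |X k w| ∈ Set.Icc K M} with hp
  have hAm : ∀ k, MeasurableSet {w | |X k w| ∈ Set.Icc K M} := fun k =>
    (hN.measurable_rcaProcess φ x₀ k).abs measurableSet_Icc
  have hWdr : ∀ x, W x + c * {x : ℝ | |x| ∈ Set.Icc K M}.indicator 1 x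
      ≤ ∫ z, W ((φ + z.1) * x + z.2) ∂μ := by
    intro x
    have iW := hm.integrable_step hWm hWg φ x
    have iV := hm.integrable_step hV.meas hVg φ x
    have hVW : ∫ z, V ((φ + z.1) * x + z.2) ∂μ ≤ ∫ z, W ((φ + z.1) * x + z.2) ∂μ :=
      integral_mono iV iW fun z => le_max_left _ _
    have hvW : v₀ ≤ ∫ z, W ((φ + z.1) * x + z.2) ∂μ := by
      calc v₀ = ∫ _, v₀ ∂μ := by simp
        _ ≤ _ := integral_mono (integrable_const _) iW fun z => le_max_right _ _
    rcases lt_or_ge |x| K with h | h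
    · have hx : x ∉ {x : ℝ | |x| ∈ Set.Icc K M} := fun h' => absurd h'.1 (not_le.2 h)
      rw [Set.indicator_of_notMem hx, mul_zero, add_zero]
      simpa only [hW, max_eq_right (hV.inner x h.le)] using hvW
    · have hWx : W x = V x := max_eq_left (hV.outer x h)
      rw [hWx]
      by_cases h' : |x| ≤ M
      · have hx : x ∈ {x : ℝ | |x| ∈ Set.Icc K M} := ⟨h, h'⟩
        rw [Set.indicator_of_mem hx, Pi.one_apply, mul_one]
        exact (hdr x h h').trans hVW
      · have hx : x ∉ {x : ℝ | |x| ∈ Set.Icc K M} := fun h'' => h' h''.2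
        rw [Set.indicator_of_notMem hx, mul_zero, add_zero]
        -- Beyond `M` only monotonicity is needed; the drift condition is used at the radius of the
        -- point itself.
        obtain ⟨c', hc', hdr'⟩ := hV.drift |x|
        linarith [hdr' x h le_rfl]
  have hstep : ∀ k, ∫ w, W (X k w) ∂P + c * p k ≤ ∫ w, W (X (k + 1) w) ∂P := by
    intro k
    obtain ⟨hi, he⟩ := hN.integral_succ (measurable_rcaProcess_noiseSigma φ x₀ (le_refl k))
      (F := fun q => W ((φ + q.2.1) * q.1 + q.2.2)) (hWm.comp (by fun_prop)) (hWi (k + 1))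
    have he' : ∫ w, W (X (k + 1) w) ∂P = ∫ w, ∫ z, W ((φ + z.1) * X k w + z.2) ∂μ ∂P := he
    rw [he', hp]
    simp only
    have hI : Integrable (fun w => c * {w | |X k w| ∈ Set.Icc K M}.indicator (1 : Ω → ℝ) w) P :=
      ((integrable_const (1 : ℝ)).indicator (hAm k)).const_mul c
    rw [← integral_indicator_one (hAm k), ← integral_const_mul, ← integral_add (hWi k) hI]
    exact integral_mono ((hWi k).add hI) hi fun w => hWdr (X k w)
  have hsum : ∀ n, ∫ w, W (X 0 w) ∂P + c * ∑ k ∈ Finset.range n, p k ≤ ∫ w, W (X n w) ∂P := by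
    intro n
    induction n with
    | zero => simp
    | succ n ih =>
      rw [Finset.sum_range_succ]
      linarith [hstep n]
  have hWV : ∀ n, ∫ w, W (X n w) ∂P ≤ ∫ w, V (X n w) ∂P + |v₀| := by
    intro n
    calc ∫ w, W (X n w) ∂P ≤ ∫ w, (V (X n w) + |v₀|) ∂P :=
          integral_mono (hWi n) ((hVi n).add (integrable_const _)) fun w =>
            max_le (le_add_of_nonneg_right (abs_nonneg _))
              ((le_abs_self _).trans (le_add_of_nonneg_left (hV.nonneg _)))
      _ = _ := by rw [integral_add (hVi n) (integrable_const _)]; simp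
  set B := |v₀| + |∫ w, W (X 0 w) ∂P| with hB
  have hbound : ∀ n : ℕ, (∑ k ∈ Finset.range n, p k) / n
      ≤ (1 / c) * ((∫ w, V (X n w) ∂P) / n + B / n) := by
    intro n
    have h1 : ∑ k ∈ Finset.range n, p k ≤ (1 / c) * (∫ w, V (X n w) ∂P + B) := by
      rw [one_div, inv_mul_eq_div, le_div_iff₀ hc]
      have := neg_abs_le (∫ w, W (X 0 w) ∂P)
      linarith [hsum n, hWV n]
    calc (∑ k ∈ Finset.range n, p k) / n ≤ ((1 / c) * (∫ w, V (X n w) ∂P + B)) / n := by gcongr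
      _ = _ := by ring
  have hlim : Tendsto (fun n : ℕ => (1 / c) * ((∫ w, V (X n w) ∂P) / n + B / n)) atTop (𝓝 0) := by
    have := (hgrow.add (tendsto_const_div_atTop_nhds_zero_nat B)).const_mul (1 / c)
    simpa using this
  refine squeeze_zero (fun n => ?_) hbound hlim
  exact div_nonneg (Finset.sum_nonneg fun k _ => measureReal_nonneg) (Nat.cast_nonneg n)

/-- By `exists_exit` a visit to a compact set at time `k` is charged to a visit to an annulus at
time `k + m`. The compact set is enlarged to contain `[-|K|, |K|]`, so that this annulus lies where
the drift holds. The shift by `m` changes the count by at most `m`. -/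
lemma tendsto_occupation {V : ℝ → ℝ} {K v₀ : ℝ} (hσ2 : 0 < σ2) (hexp : 1 ≤ φ ^ 2 + ω2)
    (hV : IsDrift μ φ V K v₀)
    (hgrow : Tendsto (fun n : ℕ => (∫ w, V (rcaProcess φ x₀ b e n w) ∂P) / n) atTop (𝓝 0))
    (R : ℝ) :
    Tendsto (fun n : ℕ =>
      (∑ k ∈ Finset.range n, P.real {w | |(rcaProcess φ x₀ b e k w)| ≤ R}) / n) atTop (𝓝 0) := by
  obtain ⟨m, M, hM, hex⟩ := hN.exists_exit hm hσ2 hexp x₀ (K := max |K| |R|)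
    (le_max_of_le_left (abs_nonneg _))
  have hann := hN.tendsto_occupation_annulus hm hV hgrow M
  set X := rcaProcess φ x₀ b e with hX
  set p : ℕ → ℝ := fun k => P.real {w | |X k w| ∈ Set.Icc K M} with hp
  have hp1 : ∀ k, p k ≤ 1 := fun k => measureReal_le_one
  have hle : ∀ k, P.real {w | |X k w| ≤ R} ≤ M ^ 2 * p (k + m) := by
    intro k
    calc P.real {w | |X k w| ≤ R} ≤ P.real {w | |X k w| ≤ max |K| |R|} :=
          measureReal_mono fun w (hw : _ ≤ _) =>
            hw.trans ((le_abs_self R).trans (le_max_right _ _))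
      _ ≤ M ^ 2 * P.real {w | |X (k + m) w| ∈ Set.Icc (max |K| |R|) M} := hex k
      _ ≤ M ^ 2 * p (k + m) := by
          gcongr
          exact measureReal_mono fun w (hw : _ ∈ _) =>
            ⟨((le_abs_self K).trans (le_max_left _ _)).trans hw.1, hw.2⟩
  have hshift : ∀ n, ∑ k ∈ Finset.range n, p (k + m) ≤ ∑ k ∈ Finset.range n, p k + m := by
    intro n
    have h1 : ∑ k ∈ Finset.range (m + n), p k
        = ∑ k ∈ Finset.range m, p k + ∑ k ∈ Finset.range n, p (m + k) := Finset.sum_range_add _ _ _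
    have h2 : ∑ k ∈ Finset.range (n + m), p k
        = ∑ k ∈ Finset.range n, p k + ∑ k ∈ Finset.range m, p (n + k) := Finset.sum_range_add _ _ _
    have h3 : ∑ k ∈ Finset.range m, p (n + k) ≤ m := by
      calc _ ≤ ∑ k ∈ Finset.range m, (1 : ℝ) := Finset.sum_le_sum fun k _ => hp1 _
        _ = m := by simp
    have h4 : 0 ≤ ∑ k ∈ Finset.range m, p k := Finset.sum_nonneg fun k _ => measureReal_nonneg
    rw [add_comm n m, h1] at h2
    simp only [add_comm _ m]
    linarith
  have hbound : ∀ n : ℕ, (∑ k ∈ Finset.range n, P.real {w | |X k w| ≤ R}) / n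
      ≤ M ^ 2 * ((∑ k ∈ Finset.range n, p k) / n + m / n) := by
    intro n
    calc _ ≤ (M ^ 2 * (∑ k ∈ Finset.range n, p k + m)) / n := by
          gcongr
          calc _ ≤ ∑ k ∈ Finset.range n, M ^ 2 * p (k + m) := Finset.sum_le_sum fun k _ => hle k
            _ = M ^ 2 * ∑ k ∈ Finset.range n, p (k + m) := by rw [Finset.mul_sum]
            _ ≤ _ := by gcongr; exact hshift n
      _ = _ := by ring
  have hlim : Tendsto (fun n : ℕ => M ^ 2 * ((∑ k ∈ Finset.range n, p k) / n + m / n))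
      atTop (𝓝 0) := by
    have := (hann.add (tendsto_const_div_atTop_nhds_zero_nat (m : ℝ))).const_mul (M ^ 2)
    simpa using this
  refine squeeze_zero (fun n => ?_) hbound hlim
  exact div_nonneg (Finset.sum_nonneg fun k _ => measureReal_nonneg) (Nat.cast_nonneg n)

omit hm in
lemma integrable_inv_sqrt (φ x₀ : ℝ) (k : ℕ) :
    Integrable (fun w => 1 / √(1 + rcaProcess φ x₀ b e k w ^ 2)) P := by
  have := hN.measurable_rcaProcess φ x₀ k
  refine Integrable.of_bound (Measurable.aestronglyMeasurable (by fun_prop)) 1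
    (Eventually.of_forall fun w => ?_)
  have := one_le_sqrt_one_add_sq (rcaProcess φ x₀ b e k w)
  rw [Real.norm_eq_abs, abs_of_nonneg (by positivity)]
  exact (div_le_one (by linarith)).2 this

-- Split at `|X| ≤ R`: the integrand is at most 1 inside and at most `1 / R` outside.
omit hm in
lemma tendsto_mean_inv_sqrt
    (h : ∀ R : ℝ, Tendsto (fun n : ℕ =>
      (∑ k ∈ Finset.range n, P.real {w | |(rcaProcess φ x₀ b e k w)| ≤ R}) / n) atTop (𝓝 0)) :
    Tendsto (fun n : ℕ => (∑ k ∈ Finset.range n,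
      ∫ w, 1 / √(1 + rcaProcess φ x₀ b e k w ^ 2) ∂P) / n) atTop (𝓝 0) := by
  set X := rcaProcess φ x₀ b e with hX
  have hu0 : ∀ k, 0 ≤ ∫ w, 1 / √(1 + X k w ^ 2) ∂P := fun k =>
    integral_nonneg fun w => by positivity
  have hle : ∀ R : ℝ, 0 < R → ∀ k,
      ∫ w, 1 / √(1 + X k w ^ 2) ∂P ≤ P.real {w | |X k w| ≤ R} + 1 / R := by
    intro R hR k
    have hA : MeasurableSet {w | |X k w| ≤ R} :=
      measurableSet_le (hN.measurable_rcaProcess φ x₀ k).abs measurable_const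
    have i1 : Integrable (Set.indicator {w | |X k w| ≤ R} (1 : Ω → ℝ)) P :=
      (integrable_const (1 : ℝ)).indicator hA
    have e1 : P.real {w | |X k w| ≤ R} + 1 / R
        = ∫ w, ({w | |X k w| ≤ R}.indicator (1 : Ω → ℝ) w + 1 / R) ∂P := by
      rw [integral_add i1 (integrable_const _), integral_indicator_one hA]; simp
    rw [e1]
    refine integral_mono (hN.integrable_inv_sqrt φ x₀ k) (i1.add (integrable_const _)) fun w => ?_
    have h1 := one_le_sqrt_one_add_sq (X k w)
    have h2 := abs_le_sqrt_one_add_sq (X k w)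
    by_cases hw : |X k w| ≤ R
    · have hw' : w ∈ {w | |X k w| ≤ R} := hw
      simp only [Set.indicator_of_mem hw', Pi.one_apply]
      have : 1 / √(1 + X k w ^ 2) ≤ 1 := (div_le_one (by linarith)).2 h1
      have : 0 < 1 / R := by positivity
      linarith
    · have hw' : w ∉ {w | |X k w| ≤ R} := hw
      simp only [Set.indicator_of_notMem hw', zero_add]
      exact one_div_le_one_div_of_le hR ((not_le.1 hw).le.trans h2)
  rw [Metric.tendsto_atTop]
  intro ε hε
  have hR : 0 < 2 / ε := by positivity
  obtain ⟨N, hN'⟩ := Metric.tendsto_atTop.1 (h (2 / ε)) (ε / 2) (by positivity)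
  refine ⟨N + 1, fun n hn => ?_⟩
  have h1 := hN' n (by omega)
  have hn0 : (0 : ℝ) < n := by exact_mod_cast (by omega : 0 < n)
  rw [Real.dist_0_eq_abs] at h1 ⊢
  rw [abs_of_nonneg (div_nonneg (Finset.sum_nonneg fun k _ => hu0 k) hn0.le)]
  have h2 := (le_abs_self _).trans_lt h1
  have h3 : (∑ k ∈ Finset.range n, ∫ w, 1 / √(1 + X k w ^ 2) ∂P) / n
      ≤ (∑ k ∈ Finset.range n, P.real {w | |X k w| ≤ 2 / ε}) / n + ε / 2 := by
    rw [div_add' _ _ _ hn0.ne']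
    gcongr
    calc _ ≤ ∑ k ∈ Finset.range n, (P.real {w | |X k w| ≤ 2 / ε} + 1 / (2 / ε)) :=
          Finset.sum_le_sum fun k _ => hle _ hR k
      _ = _ := by
        rw [Finset.sum_add_distrib, Finset.sum_const, Finset.card_range, nsmul_eq_mul, one_div_div]
        ring
  linarith

end IsNoise

end Occupation

/-! ### Estimates near infinity and the drift function for positive logarithmic mean. -/

section Drift

/-- Neighbourhoods of infinity on the real line. -/
abbrev absAtTop : Filter ℝ := comap (fun x : ℝ => |x|) atTop

lemma eventually_absAtTop {p : ℝ → Prop} :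
    (∀ᶠ x in absAtTop, p x) ↔ ∃ K, ∀ x, K ≤ |x| → p x := by
  rw [eventually_comap, eventually_atTop]
  constructor
  · rintro ⟨K, h⟩; exact ⟨K, fun x hx => h _ hx x rfl⟩
  · rintro ⟨K, h⟩; exact ⟨K, fun a ha x hx => h x (hx ▸ ha)⟩

lemma tendsto_abs_absAtTop : Tendsto (fun x : ℝ => |x|) absAtTop atTop := tendsto_comap

lemma tendsto_log_absAtTop : Tendsto Real.log absAtTop atTop := by
  have := Real.tendsto_log_atTop.comp tendsto_abs_absAtTop
  simpa [Function.comp_def, Real.log_abs] using this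

lemma tendsto_inv_absAtTop : Tendsto (fun x : ℝ => x⁻¹) absAtTop (𝓝 0) := by
  rw [tendsto_zero_iff_abs_tendsto_zero]
  have := tendsto_inv_atTop_zero.comp tendsto_abs_absAtTop
  simpa [Function.comp_def, abs_inv] using this

lemma log_le_posLog (x : ℝ) : Real.log x ≤ Real.posLog x := le_max_right _ _

lemma posLog_le_abs (x : ℝ) : Real.posLog x ≤ |x| := by
  rw [Real.posLog_apply]
  refine max_le (abs_nonneg _) ?_
  rw [← Real.log_abs]
  exact (Real.log_le_self (abs_nonneg x))

lemma posLog_eq_log_max (x : ℝ) : Real.posLog x = Real.log (max 1 |x|) := by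
  rw [← Real.posLog_abs, Real.posLog_eq_log_max_one (abs_nonneg x)]

/-- For `|x|` large enough the difference equals `log |A + ε / x|`. `Real.log` ignores signs, so no
absolute values appear. -/
lemma tendsto_posLog_step_sub {A : ℝ} (hA : A ≠ 0) (ε : ℝ) :
    Tendsto (fun x => Real.posLog (A * x + ε) - Real.log x) absAtTop (𝓝 (Real.log A)) := by
  have h1 : Tendsto (fun x : ℝ => Real.log (A + ε * x⁻¹)) absAtTop (𝓝 (Real.log A)) := by
    have : Tendsto (fun x : ℝ => A + ε * x⁻¹) absAtTop (𝓝 (A + ε * 0)) :=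
      (tendsto_inv_absAtTop.const_mul ε).const_add A
    rw [mul_zero, add_zero] at this
    exact (Real.continuousAt_log hA).tendsto.comp this
  refine h1.congr' ?_
  have hA0 : 0 < |A| := abs_pos.2 hA
  filter_upwards [eventually_absAtTop.2 ⟨(1 + |ε|) / |A| + 1, fun x hx => hx⟩] with x hx
  have hx0 : x ≠ 0 := by
    rw [← abs_pos]; exact lt_of_lt_of_le (by positivity) hx
  have h2 : 1 ≤ |A * x + ε| := by
    have h3 : |A * x| - |ε| ≤ |A * x + ε| := by
      have := abs_sub_abs_le_abs_sub (A * x) (-ε)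
      rwa [abs_neg, sub_neg_eq_add] at this
    rw [abs_mul] at h3
    have h4 : 1 + |ε| ≤ |A| * |x| := by
      have : (1 + |ε|) / |A| ≤ |x| := by linarith
      rw [div_le_iff₀ hA0] at this
      linarith
    linarith
  have h5 : A * x + ε ≠ 0 := by
    rw [← abs_pos]; linarith
  rw [Real.posLog_eq_log h2, ← Real.log_div h5 hx0]
  congr 1
  field_simp

/-- With `neg_le_sqrt_mul_sqrt_sub`, this bounds the scaled increment of a square root by the
increment of its argument, which supplies the dominating function below. -/
lemma sqrt_mul_sqrt_sub_le {a c : ℝ} (ha : 0 ≤ a) (hc : 0 ≤ c) :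
    √c * (√a - √c) ≤ (a - c) / 2 := by
  nlinarith [sq_nonneg (√a - √c), Real.sq_sqrt ha, Real.sq_sqrt hc]

lemma neg_le_sqrt_mul_sqrt_sub {a c B : ℝ} (ha : 0 ≤ a) (hc : 0 ≤ c) (hB : 0 ≤ B)
    (h : c - a ≤ B) : -B ≤ √c * (√a - √c) := by
  rcases le_total c a with h1 | h1
  · have : 0 ≤ √c * (√a - √c) :=
      mul_nonneg (Real.sqrt_nonneg _) (sub_nonneg.2 (Real.sqrt_le_sqrt h1))
    linarith
  · have h2 := Real.sqrt_le_sqrt h1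
    nlinarith [Real.sq_sqrt ha, Real.sq_sqrt hc, Real.sqrt_nonneg a, Real.sqrt_nonneg c]

/-- The logarithmic size does not drop by more than an integrable amount. -/
lemma log_sub_posLog_step_le {A x ε : ℝ} (hA : A ≠ 0) (hx : 1 ≤ |x|) :
    Real.log x - Real.posLog (A * x + ε) ≤ 2 * |Real.log (A)| + 2 * Real.log 2 + ε ^ 4 := by
  have hL0 : 0 ≤ Real.posLog (A * x + ε) := Real.posLog_nonneg
  have hl2 : 0 < Real.log 2 := Real.log_pos (by norm_num)
  have habs := abs_nonneg (Real.log A)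
  have he4 : 0 ≤ ε ^ 4 := by positivity
  have hx0 : 0 < |x| := by linarith
  have hA0 : 0 < |A| := abs_pos.2 hA
  have hx2 : √|x| * √|x| = |x| := Real.mul_self_sqrt hx0.le
  have hsx : 0 < √|x| := Real.sqrt_pos.2 hx0
  have hlx : Real.log √|x| = Real.log x / 2 := by rw [Real.log_sqrt hx0.le, Real.log_abs]
  -- If `|ε| ≥ √|x|`, then `log |x| ≤ |x| ≤ ε² ≤ ε⁴`. Otherwise either `|A x|` dominates `ε` and
  -- half of it survives, or `|A| √|x| < 2` and `log |x|` itself is at most `2 log 2 + 2 |log A|`.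
  rcases le_or_gt (√|x|) |ε| with h | h
  · have h1 : |x| ≤ ε ^ 2 := by rw [← sq_abs ε]; nlinarith
    have h2 : Real.log x ≤ |x| := by rw [← Real.log_abs]; exact Real.log_le_self hx0.le
    have h3 : ε ^ 2 ≤ ε ^ 4 := by nlinarith
    linarith
  · rcases le_or_gt 2 (|A| * √|x|) with h1 | h1
    · have h2 : |A * x| / 2 ≤ |A * x + ε| := by
        have h3 : |A * x| - |ε| ≤ |A * x + ε| := by
          have := abs_sub_abs_le_abs_sub (A * x) (-ε)
          rwa [abs_neg, sub_neg_eq_add] at this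
        have h4 : |A * x| = |A| * √|x| * √|x| := by rw [abs_mul, mul_assoc, hx2]
        nlinarith
      have h5 : Real.log (|A * x| / 2) ≤ Real.posLog (A * x + ε) := by
        refine le_trans (Real.log_le_log ?_ h2) ?_
        · rw [abs_mul]; positivity
        · rw [Real.log_abs]; exact log_le_posLog _
      rw [abs_mul, Real.log_div (by positivity) (by norm_num),
        Real.log_mul hA0.ne' hx0.ne', Real.log_abs, Real.log_abs] at h5
      linarith [neg_abs_le (Real.log A)]
    · have h2 := Real.log_le_log (by positivity) h1.le
      rw [Real.log_mul hA0.ne' hsx.ne', Real.log_abs, hlx] at h2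
      linarith [neg_abs_le (Real.log A)]

variable {μ : Measure (ℝ × ℝ)} {φ ω2 σ2 : ℝ}

lemma log_pos_of_one_lt_abs {x : ℝ} (hx : 1 < |x|) : 0 < Real.log x := by
  rw [← Real.log_abs]; exact Real.log_pos hx

lemma posLog_mul_add_le (A x ε : ℝ) :
    Real.posLog (A * x + ε) ≤ Real.posLog A + Real.posLog x + Real.posLog ε + Real.log 2 := by
  linarith [Real.posLog_add (x := A * x) (y := ε), Real.posLog_mul (x := A) (y := x)]

/-- A drift function of the form `V = h ∘ log⁺` from an estimate near infinity. -/
lemma isDrift_of_eventually {h g : ℝ → ℝ} (hh : Continuous h)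
    (hh0 : ∀ L, 0 ≤ L → 0 ≤ h L) (hhle : ∀ L, 0 ≤ L → h L ≤ 1 + L)
    (hinner : ∀ L L', 1 ≤ L' → 0 ≤ L → L ≤ L' → h L ≤ h L')
    (hg : ∀ L, 0 < L → 0 < g L) (hganti : ∀ L L', 0 < L → L ≤ L' → g L' ≤ g L)
    (hev : ∀ᶠ x in absAtTop, h (Real.log x) + g (Real.log x)
      ≤ ∫ z, h (Real.posLog ((φ + z.1) * x + z.2)) ∂μ) :
    ∃ K v₀, IsDrift μ φ (fun x => h (Real.posLog x)) K v₀ := by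
  obtain ⟨K, hK⟩ := eventually_absAtTop.1 hev
  -- This makes `log K' ≥ 1`, as `hinner` requires: one of the functions used for `h` is not
  -- monotone near zero.
  set K' := max K (Real.exp 1) with hK'
  have hK1 : Real.exp 1 ≤ K' := le_max_right _ _
  have hexp : (1 : ℝ) < Real.exp 1 := Real.one_lt_exp_iff.2 one_pos
  have hlogK : 1 ≤ Real.log K' := by
    rw [Real.le_log_iff_exp_le (by linarith)]; exact hK1
  refine ⟨K', h (Real.log K'), ⟨hh.measurable.comp Real.continuous_posLog.measurable,
    fun x => hh0 _ Real.posLog_nonneg, ⟨1, fun x => ?_⟩, fun x hx => ?_, fun x hx => ?_,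
    fun M => ?_⟩⟩
  · rw [one_mul]
    exact (hhle _ Real.posLog_nonneg).trans (by linarith [posLog_le_abs x])
  · refine hinner _ _ hlogK Real.posLog_nonneg ?_
    rw [posLog_eq_log_max]
    exact Real.log_le_log (by positivity) (max_le (by linarith) hx)
  · have hx1 : 1 ≤ |x| := by linarith
    have hlog : Real.log K' ≤ Real.posLog x := by
      rw [Real.posLog_eq_log hx1, ← Real.log_abs x]
      exact Real.log_le_log (by linarith) hx
    exact hinner _ _ (hlogK.trans hlog) (by linarith) hlog
  · refine ⟨g (Real.log (max M K')), hg _ ?_, fun x hx hxM => ?_⟩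
    · exact Real.log_pos (lt_of_lt_of_le (by linarith) (le_max_right _ _))
    · have hx1 : 1 < |x| := by linarith
      have h1 := hK x ((le_max_left _ _).trans hx)
      simp only [Real.posLog_eq_log hx1.le]
      refine le_trans ?_ h1
      gcongr
      refine hganti _ _ (log_pos_of_one_lt_abs hx1) ?_
      rw [← Real.log_abs]
      exact Real.log_le_log (by linarith) (hxM.trans (le_max_left _ _))

/-- With `ℓ = log |x|` and `L = log⁺ |A x + ε|`, the expression is `(L - ℓ) / (√(L / ℓ) + 1)`, where
`L - ℓ → log |A|` and `L / ℓ → 1`. -/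
lemma tendsto_sqrt_mul_sqrt_step_sub {A : ℝ} (hA : A ≠ 0) (ε : ℝ) :
    Tendsto (fun x => √(Real.log x) * (√(Real.posLog (A * x + ε)) - √(Real.log x))) absAtTop
      (𝓝 (Real.log A / 2)) := by
  have h1 := tendsto_posLog_step_sub hA ε
  have h2 : Tendsto (fun x => √(Real.posLog (A * x + ε) / Real.log x)) absAtTop
      (𝓝 1) := by
    have h3 : Tendsto (fun x => 1 + (Real.posLog (A * x + ε) - Real.log x)
        / Real.log x) absAtTop (𝓝 (1 + 0)) :=
      (h1.div_atTop tendsto_log_absAtTop).const_add 1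
    rw [add_zero] at h3
    have h4 := (Real.continuous_sqrt.tendsto 1).comp h3
    rw [Real.sqrt_one] at h4
    refine h4.congr' ?_
    filter_upwards [eventually_absAtTop.2 ⟨2, fun x hx => hx⟩] with x hx
    have := (log_pos_of_one_lt_abs (by linarith : 1 < |x|)).ne'
    simp only [Function.comp]
    congr 1
    field_simp
    ring
  have h5 : Tendsto (fun x => (Real.posLog (A * x + ε) - Real.log x)
      / (√(Real.posLog (A * x + ε) / Real.log x) + 1)) absAtTop
      (𝓝 (Real.log A / (1 + 1))) :=
    h1.div (h2.add_const 1) (by norm_num)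
  rw [one_add_one_eq_two] at h5
  refine h5.congr' ?_
  filter_upwards [eventually_absAtTop.2 ⟨2, fun x hx => hx⟩] with x hx
  have hl := log_pos_of_one_lt_abs (by linarith : 1 < |x|)
  have hL0 : 0 ≤ Real.posLog (A * x + ε) := Real.posLog_nonneg
  set L := Real.posLog (A * x + ε)
  have hs := Real.sqrt_pos.2 hl
  have e1 := Real.sq_sqrt hl.le
  have e2 := Real.sq_sqrt hL0
  have e3 := Real.sqrt_nonneg L
  rw [Real.sqrt_div hL0, div_eq_iff (by positivity)]
  field_simp
  nlinarith

variable [IsProbabilityMeasure μ]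

/-- Drift function in the case `E log |φ + b| > 0`. -/
lemma exists_isDrift_of_pos (hm : NoiseMoments μ ω2 σ2) (hne : ∀ᵐ z ∂μ, φ + z.1 ≠ 0)
    (hint : Integrable (fun z => Real.log (φ + z.1)) μ) (hpos : 0 < ∫ z, Real.log (φ + z.1) ∂μ) :
    ∃ K v₀, IsDrift μ φ (fun x => √(Real.posLog x)) K v₀ := by
  set γ := ∫ z, Real.log (φ + z.1) ∂μ with hγ
  -- The increment of `V` tends to zero at infinity; multiplied by `√(log |x|)`, its mean tends to
  -- `γ / 2`.
  set F : ℝ → ℝ × ℝ → ℝ := fun x z =>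
    √(Real.log x) * (√(Real.posLog ((φ + z.1) * x + z.2)) - √(Real.log x)) with hF
  have hFm : ∀ x, Measurable (F x) := fun x => by
    have : Measurable Real.posLog := Real.continuous_posLog.measurable
    have h2 : Measurable fun z : ℝ × ℝ => Real.posLog ((φ + z.1) * x + z.2) :=
      this.comp (by fun_prop)
    exact ((h2.sqrt).sub_const _).const_mul _
  have hlim : Tendsto (fun x => ∫ z, F x z ∂μ) absAtTop (𝓝 (∫ z, Real.log (φ + z.1) / 2 ∂μ)) := by
    refine tendsto_integral_filter_of_dominated_convergence
      (fun z => 2 * |Real.log (φ + z.1)| + 2 * Real.log 2 + z.2 ^ 4 + |z.2|)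
      (Eventually.of_forall fun x => (hFm x).aestronglyMeasurable) ?_ ?_ ?_
    · filter_upwards [eventually_absAtTop.2 ⟨1, fun x hx => hx⟩] with x hx
      filter_upwards [hne] with z hz
      have hl0 : 0 ≤ Real.log x := by rw [← Real.log_abs]; exact Real.log_nonneg hx
      have hL0 : 0 ≤ Real.posLog ((φ + z.1) * x + z.2) := Real.posLog_nonneg
      have hl2 : 0 < Real.log 2 := Real.log_pos (by norm_num)
      have he4 : 0 ≤ z.2 ^ 4 := by positivity
      rw [Real.norm_eq_abs, abs_le]
      constructor
      · have := neg_le_sqrt_mul_sqrt_sub hL0 hl0 (by positivity)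
          (log_sub_posLog_step_le (ε := z.2) hz hx)
        simp only [hF]
        linarith [abs_nonneg z.2]
      · refine (sqrt_mul_sqrt_sub_le hL0 hl0).trans ?_
        have h1 := posLog_mul_add_le (φ + z.1) x z.2
        rw [Real.posLog_eq_log hx] at h1
        have h2 : Real.posLog (φ + z.1) ≤ |Real.log (φ + z.1)| :=
          max_le (abs_nonneg _) (le_abs_self _)
        have h3 := posLog_le_abs z.2
        linarith [abs_nonneg (Real.log (φ + z.1)), abs_nonneg z.2]
    · exact (((hint.abs.const_mul 2).add (integrable_const _)).add hm.int_e).add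
        hm.integrable_snd.abs
    · filter_upwards [hne] with z hz
      exact tendsto_sqrt_mul_sqrt_step_sub hz z.2
  rw [integral_div] at hlim
  have hev := hlim.eventually (lt_mem_nhds (show γ / 4 < γ / 2 by linarith))
  refine isDrift_of_eventually (h := fun L => √L) (g := fun L => γ / 4 / √L)
    Real.continuous_sqrt (fun L _ => Real.sqrt_nonneg L) (fun L hL => ?_)
    (fun L L' _ _ h => Real.sqrt_le_sqrt h) (fun L hL => ?_) (fun L L' hL h => ?_) ?_
  · nlinarith [Real.sq_sqrt hL, sq_nonneg (√L - 1), Real.sqrt_nonneg L]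
  · have := Real.sqrt_pos.2 hL
    positivity
  · have := Real.sqrt_pos.2 hL
    gcongr
  · filter_upwards [hev, eventually_absAtTop.2 ⟨2, fun x hx => hx⟩] with x hx hx2
    have hl := log_pos_of_one_lt_abs (by linarith : 1 < |x|)
    have hs := Real.sqrt_pos.2 hl
    have hVi : Integrable (fun z : ℝ × ℝ => √(Real.posLog ((φ + z.1) * x + z.2))) μ := by
      refine hm.integrable_step (V := fun t => √(Real.posLog t)) (C := 1)
        (Real.continuous_posLog.sqrt.measurable) (fun t => ?_) φ x
      rw [abs_of_nonneg (Real.sqrt_nonneg _)]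
      have := posLog_le_abs t
      nlinarith [Real.sq_sqrt (Real.posLog_nonneg (x := t)), sq_nonneg (√(Real.posLog t) - 1),
        Real.sqrt_nonneg (Real.posLog t)]
    have e1 : ∫ z, F x z ∂μ = √(Real.log x) *
        (∫ z, √(Real.posLog ((φ + z.1) * x + z.2)) ∂μ - √(Real.log x)) := by
      simp only [hF]
      rw [integral_const_mul, integral_sub hVi (integrable_const _)]
      simp
    rw [e1] at hx
    have : γ / 4 / √(Real.log x) ≤ ∫ z, √(Real.posLog ((φ + z.1) * x + z.2)) ∂μ - √(Real.log x) := by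
      rw [div_le_iff₀ hs]; linarith
    linarith

end Drift

/-! ### The degenerate case, and a lower bound for the gain in the critical case. -/

section Drift

variable {μ : Measure (ℝ × ℝ)} {φ ω2 σ2 : ℝ}

/-- Strict convexity of `x ↦ √(1 + x ^ 2)`. -/
lemma sqrt_one_add_sq_add_ge (x t : ℝ) :
    √(1 + x ^ 2) + x * t / √(1 + x ^ 2) + t ^ 2 / (2 * (1 + x ^ 2) * √(1 + (x + t) ^ 2))
      ≤ √(1 + (x + t) ^ 2) := by
  have hr2 : √(1 + x ^ 2) ^ 2 = 1 + x ^ 2 := Real.sq_sqrt (by positivity)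
  have hR2 : √(1 + (x + t) ^ 2) ^ 2 = 1 + (x + t) ^ 2 := Real.sq_sqrt (by positivity)
  have hr := one_le_sqrt_one_add_sq x
  have hR := one_le_sqrt_one_add_sq (x + t)
  set r := √(1 + x ^ 2)
  set R := √(1 + (x + t) ^ 2)
  rw [← hr2]
  have hr0 : 0 < r := by linarith
  have hR0 : 0 < R := by linarith
  -- With `c = 1 + x (x + t)`, Lagrange's identity reads `(R r)² - c² = t²`, and `c ≤ R r` by
  -- Cauchy–Schwarz; factoring the difference of squares gives the claim.
  have hkey : t ^ 2 ≤ 2 * (R * r) * (R * r - (1 + x * (x + t))) := by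
    have h1 : (R * r) ^ 2 = (1 + (x + t) ^ 2) * (1 + x ^ 2) := by rw [mul_pow, hr2, hR2]
    have h2 : 1 + x * (x + t) ≤ R * r := by
      nlinarith [mul_pos hR0 hr0, sq_nonneg t]
    nlinarith
  have e1 : r + x * t / r + t ^ 2 / (2 * r ^ 2 * R) = (2 * r * R * (r ^ 2 + x * t) + t ^ 2)
      / (2 * r ^ 2 * R) := by field_simp
  have e2 : r ^ 2 + x * t = 1 + x * (x + t) := by rw [hr2]; ring
  rw [e1, div_le_iff₀ (by positivity), e2]
  linarith

/-- Drift function in the case `|φ + b| = 1`. -/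
lemma isDrift_of_abs_eq_one [IsProbabilityMeasure μ] (hm : NoiseMoments μ ω2 σ2) (hσ2 : 0 < σ2)
    (h1 : ∀ᵐ z ∂μ, |φ + z.1| = 1) : IsDrift μ φ (fun x => √(1 + x ^ 2)) 0 1 := by
  refine ⟨by fun_prop, fun x => Real.sqrt_nonneg _, ⟨1, fun x => ?_⟩, fun x hx => ?_,
    fun x _ => one_le_sqrt_one_add_sq x, fun M => ?_⟩
  · rw [one_mul, Real.sqrt_le_left (by positivity)]
    nlinarith [sq_abs x, abs_nonneg x]
  · have : x = 0 := abs_eq_zero.1 (le_antisymm hx (abs_nonneg x))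
    simp [this]
  -- A lower bound for the convexity term that is uniform in `|x| ≤ M`. Its mean is positive because
  -- `e` is not a.s. zero.
  · set D : ℝ × ℝ → ℝ := fun z => z.2 ^ 2 / (2 * (1 + M ^ 2) * (1 + |M| + |z.2|)) with hD
    have hDm : Measurable D := by
      have : Measurable fun z : ℝ × ℝ => |z.2| := measurable_snd.abs
      fun_prop
    have hD0 : ∀ z, 0 ≤ D z := fun z => by positivity
    have hDi : Integrable D μ := hm.integrable_snd_sq.mono' hDm.aestronglyMeasurable
      (Eventually.of_forall fun z => by
        rw [Real.norm_eq_abs, abs_of_nonneg (hD0 z)]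
        refine div_le_self (sq_nonneg _) ?_
        nlinarith [abs_nonneg M, abs_nonneg z.2, sq_nonneg M,
          mul_nonneg (sq_nonneg M) (add_nonneg (abs_nonneg M) (abs_nonneg z.2))])
    refine ⟨∫ z, D z ∂μ, ?_, fun x _ hxM => ?_⟩
    · refine (integral_nonneg hD0).lt_of_ne fun h0 => ?_
      have h2 := (integral_eq_zero_iff_of_nonneg hD0 hDi).1 h0.symm
      have h3 : ∫ z, z.2 ^ 2 ∂μ = 0 := by
        rw [integral_eq_zero_iff_of_nonneg (fun z => sq_nonneg _) hm.integrable_snd_sq]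
        filter_upwards [h2] with z hz
        have : (2 * (1 + M ^ 2) * (1 + |M| + |z.2|)) ≠ 0 := by positivity
        simpa [hD, this] using hz
      rw [hm.e2] at h3
      linarith
    · have iV : Integrable (fun z : ℝ × ℝ => √(1 + ((φ + z.1) * x + z.2) ^ 2)) μ := by
        refine hm.integrable_step (V := fun t => √(1 + t ^ 2)) (C := 1) (by fun_prop)
          (fun t => ?_) φ x
        rw [abs_of_nonneg (Real.sqrt_nonneg _), one_mul, Real.sqrt_le_left (by positivity)]
        nlinarith [sq_abs t, abs_nonneg t]
      have i1 : Integrable (fun z : ℝ × ℝ => φ * z.2 + z.1 * z.2) μ :=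
        (hm.integrable_snd.const_mul φ).add hm.integrable_mul
      have e1 : ∫ z, (φ * z.2 + z.1 * z.2) ∂μ = 0 := by
        rw [integral_add (hm.integrable_snd.const_mul φ) hm.integrable_mul, integral_const_mul,
          hm.e1, hm.be]
        simp
      have i2 : Integrable (fun z : ℝ × ℝ => x / √(1 + x ^ 2) * (φ * z.2 + z.1 * z.2)) μ :=
        i1.const_mul _
      have i3 : Integrable (fun z : ℝ × ℝ => √(1 + x ^ 2)
          + x / √(1 + x ^ 2) * (φ * z.2 + z.1 * z.2)) μ := (integrable_const _).add i2
      have e2 : ∫ z, (√(1 + x ^ 2) + x / √(1 + x ^ 2) * (φ * z.2 + z.1 * z.2) + D z) ∂μ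
          = √(1 + x ^ 2) + ∫ z, D z ∂μ := by
        rw [integral_add i3 hDi, integral_add (integrable_const _) i2, integral_const_mul, e1]
        simp
      rw [← e2]
      refine integral_mono_ae (i3.add hDi) iV ?_
      filter_upwards [h1] with z hz
      have hA2 : (φ + z.1) ^ 2 = 1 := by rw [← sq_abs, hz, one_pow]
      -- As `(φ + b)² = 1`, the new state has the modulus of `x + t`. The linear term in `t` has
      -- mean zero because `e` is centred and uncorrelated with `b`.
      set t := (φ + z.1) * z.2 with ht
      have e3 : ((φ + z.1) * x + z.2) ^ 2 = (x + t) ^ 2 := by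
        rw [ht]
        linear_combination (x ^ 2 - z.2 ^ 2) * hA2
      have ht2 : t ^ 2 = z.2 ^ 2 := by rw [ht, mul_pow, hA2, one_mul]
      have hta : |t| = |z.2| := by rw [ht, abs_mul, hz, one_mul]
      have h4 := sqrt_one_add_sq_add_ge x t
      rw [e3]
      refine le_trans ?_ h4
      have e4 : x / √(1 + x ^ 2) * (φ * z.2 + z.1 * z.2) = x * t / √(1 + x ^ 2) := by
        rw [ht]; ring
      rw [e4, ht2]
      gcongr
      have hM2 : x ^ 2 ≤ M ^ 2 := by
        rw [← sq_abs x, ← sq_abs M]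
        have := hxM.trans (le_abs_self M)
        gcongr
      have hR : √(1 + (x + t) ^ 2) ≤ 1 + |M| + |z.2| := by
        rw [Real.sqrt_le_left (by positivity)]
        have h5 : |x + t| ≤ |M| + |z.2| := by
          rw [← hta]
          exact (abs_add_le _ _).trans (by linarith [le_abs_self M])
        rw [← sq_abs (x + t)]
        nlinarith [abs_nonneg (x + t), abs_nonneg M, abs_nonneg z.2]
      have hR0 : 0 < √(1 + (x + t) ^ 2) := by linarith [one_le_sqrt_one_add_sq (x + t)]
      simp only [hD]
      gcongr

/-- The part of the drop in logarithmic size that is caused by the additive noise. -/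
lemma log_mul_sub_posLog_add_le {A x ε : ℝ} :
    Real.log (A * x) - Real.posLog (A * x + ε) ≤ Real.log (1 + |ε|) ∧
    (A * x ≠ 0 →
      Real.log (A * x) - Real.posLog (A * x + ε) ≤ |ε| / max 1 |A * x + ε|) := by
  set m := max 1 |A * x + ε| with hm
  have hm1 : 1 ≤ m := le_max_left _ _
  have hm2 : |A * x + ε| ≤ m := le_max_right _ _
  have htri : |A * x| ≤ |A * x + ε| + |ε| := by
    have := abs_sub_abs_le_abs_sub (A * x + ε) ε
    have h2 := abs_sub (A * x + ε) ε
    rwa [add_sub_cancel_right] at h2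
  rw [posLog_eq_log_max, ← hm]
  have key : A * x ≠ 0 → Real.log (A * x) - Real.log m = Real.log (|A * x| / m) := fun h => by
    rw [Real.log_div (abs_ne_zero.2 h) (by positivity), Real.log_abs]
  constructor
  · by_cases h : A * x = 0
    · rw [h, Real.log_zero, zero_sub]
      have h1 := Real.log_nonneg hm1
      have h2 := Real.log_nonneg (le_add_of_nonneg_right (abs_nonneg ε) : (1 : ℝ) ≤ 1 + |ε|)
      linarith
    · rw [key h]
      refine Real.log_le_log (by positivity) ?_
      rw [div_le_iff₀ (by positivity)]
      nlinarith [abs_nonneg ε]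
  · intro h
    rw [key h]
    refine (Real.log_le_sub_one_of_pos (by positivity)).trans ?_
    rw [sub_le_iff_le_add, div_add_one (by positivity)]
    gcongr
    linarith

/-- The normalised gain under one step, up to a mean-zero term. -/
noncomputable def logGain (φ x : ℝ) (z : ℝ × ℝ) : ℝ :=
  Real.log x * (√(Real.posLog ((φ + z.1) * x + z.2)) - √(Real.log x)) ^ 2 / 2
    - √(Real.log x) ^ 3 * max 0 (Real.log x + Real.log (φ + z.1)
      - Real.posLog ((φ + z.1) * x + z.2))

/-- A minorant for dominated convergence that is integrable thanks to the fourth moment of `e`. The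
loss term is large only if `ε` is large or if `A` almost annihilates `x`; in the latter case the
quadratic gain compensates for it. -/
lemma logGain_ge {x : ℝ} {z : ℝ × ℝ} (hz : φ + z.1 ≠ 0) (hx : 16 ≤ Real.log x) :
    -(32 + 32 ^ 3 * z.2 ^ 4) ≤ logGain φ x z := by
  have hx0 : x ≠ 0 := fun h => by rw [h, Real.log_zero] at hx; linarith
  have hxx : |x| = Real.exp (Real.log x) := (Real.exp_log_eq_abs hx0).symm
  obtain ⟨hlam1, hlam2⟩ := log_mul_sub_posLog_add_le (A := φ + z.1) (x := x) (ε := z.2)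
  have hlam2' := hlam2 (mul_ne_zero hz hx0)
  rw [Real.log_mul hz hx0, add_comm] at hlam1 hlam2'
  unfold logGain
  have hAabs : |(φ + z.1) * x| = Real.exp (Real.log x + Real.log (φ + z.1)) := by
    rw [abs_mul, Real.exp_add, Real.exp_log_eq_abs hx0, Real.exp_log_eq_abs hz, mul_comm]
  have hLdef := posLog_eq_log_max ((φ + z.1) * x + z.2)
  have hL0 : 0 ≤ Real.posLog ((φ + z.1) * x + z.2) := Real.posLog_nonneg
  set A := φ + z.1
  set ε := z.2
  set ℓ := Real.log x with hℓ
  set L := Real.posLog (A * x + ε) with hL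
  set Y := Real.log A
  set p := √ℓ with hp
  have hpp : p ^ 2 = ℓ := Real.sq_sqrt (by linarith)
  have hp4 : 4 ≤ p := Real.le_sqrt_of_sq_le (by linarith)
  set lam := max 0 (ℓ + Y - L) with hlam
  have hlam0 : 0 ≤ lam := le_max_left _ _
  have hlog0 : 0 ≤ Real.log (1 + |ε|) := Real.log_nonneg (by linarith [abs_nonneg ε])
  have hlamle : lam ≤ Real.log (1 + |ε|) := max_le hlog0 hlam1
  have he4 : 0 ≤ ε ^ 4 := by positivity
  have hG1 : 0 ≤ ℓ * (√L - p) ^ 2 / 2 := by positivity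
  -- For large noise, `p ≤ 32 |ε|` and the whole loss is at most `32³ ε⁴`. Otherwise `|ε| ≤ exp (ℓ /
  -- 4)`.
  rcases le_or_gt (p / 32) (Real.log (1 + |ε|)) with ha | ha
  · have hle : Real.log (1 + |ε|) ≤ |ε| := by
      have := Real.log_le_sub_one_of_pos (by linarith [abs_nonneg ε] : 0 < 1 + |ε|)
      linarith
    have h1 : p ≤ 32 * |ε| := by linarith
    have h2 : p ^ 3 * lam ≤ (32 * |ε|) ^ 3 * |ε| := by
      gcongr
      exact hlamle.trans hle
    have h3 : (32 * |ε|) ^ 3 * |ε| = 32 ^ 3 * ε ^ 4 := by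
      rw [← (Even.pow_abs (by decide) ε : |ε| ^ 4 = ε ^ 4)]; ring
    linarith
  · have heps : |ε| ≤ Real.exp (ℓ / 4) := by
      have h1 : Real.log (1 + |ε|) ≤ ℓ / 4 := by nlinarith
      have h2 := (Real.log_le_iff_le_exp (by linarith [abs_nonneg ε])).1 h1
      linarith
    -- If `Y ≥ -ℓ / 2`, then `|A x| ≥ exp (ℓ / 2)` dominates the noise and `lam ≤ 32 / ℓ²`. If not,
    -- `L ≤ 9 ℓ / 16`, so `√L ≤ 3 p / 4` and the quadratic gain is at least `p⁴ / 32`. This matches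
    -- the loss `p³ * (p / 32)` exactly, which is where the threshold 32 comes from.
    rcases le_or_gt (-(ℓ / 2)) Y with hb | hb
    · have h1 : Real.exp (ℓ / 2) ≤ |A * x| := by
        rw [hAabs]; exact Real.exp_le_exp.2 (by linarith)
      have h2 : |A * x| - |ε| ≤ |A * x + ε| := by
        have := abs_sub_abs_le_abs_sub (A * x) (-ε)
        rwa [abs_neg, sub_neg_eq_add] at this
      have h3 : Real.exp (ℓ / 2) = Real.exp (ℓ / 4) * Real.exp (ℓ / 4) := by
        rw [← Real.exp_add]; congr 1; ring
      have h4 : 1 + ℓ / 4 + (ℓ / 4) ^ 2 / 2 ≤ Real.exp (ℓ / 4) :=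
        Real.quadratic_le_exp_of_nonneg (by linarith)
      set E := Real.exp (ℓ / 4)
      have hE : 0 < E := Real.exp_pos _
      have h5 : E * (ℓ ^ 2 / 32) ≤ max 1 |A * x + ε| := by
        refine le_trans ?_ (le_max_right _ _)
        have : E * (ℓ ^ 2 / 32) ≤ E * (E - 1) := by
          gcongr
          nlinarith
        nlinarith
      have h6 : |ε| / max 1 |A * x + ε| ≤ 32 / ℓ ^ 2 := by
        rw [div_le_div_iff₀ (by positivity) (by positivity)]
        nlinarith [abs_nonneg ε, mul_le_mul_of_nonneg_right heps (sq_nonneg ℓ)]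
      have h7 : lam ≤ 32 / ℓ ^ 2 := max_le (by positivity) (hlam2'.trans h6)
      have h8 : p ^ 3 * lam ≤ 32 := by
        calc p ^ 3 * lam ≤ p ^ 3 * (32 / ℓ ^ 2) := by gcongr
          _ = 32 / p := by rw [← hpp]; field_simp
          _ ≤ 32 := div_le_self (by norm_num) (by linarith)
      linarith
    · have h1 : |A * x + ε| ≤ 2 * Real.exp (ℓ / 2) := by
        refine (abs_add_le _ _).trans ?_
        have h2 : |A * x| ≤ Real.exp (ℓ / 2) := by
          rw [hAabs]; exact Real.exp_le_exp.2 (by linarith)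
        have h3 : Real.exp (ℓ / 4) ≤ Real.exp (ℓ / 2) := Real.exp_le_exp.2 (by linarith)
        linarith
      have h2 : L ≤ 9 / 16 * ℓ := by
        rw [hLdef]
        have h3 : max 1 |A * x + ε| ≤ 2 * Real.exp (ℓ / 2) :=
          max_le (by linarith [Real.one_le_exp (by linarith : 0 ≤ ℓ / 2)]) h1
        refine (Real.log_le_log (by positivity) h3).trans ?_
        rw [Real.log_mul (by norm_num) (Real.exp_pos _).ne', Real.log_exp]
        have := Real.log_two_lt_d9
        linarith
      have h3 : √L ≤ 3 / 4 * p := by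
        rw [Real.sqrt_le_left (by positivity)]
        rw [mul_pow, hpp]; linarith
      have h4 : (p / 4) ^ 2 ≤ (√L - p) ^ 2 := by
        rw [← neg_sq (√L - p)]
        gcongr
        linarith
      have h5 : ℓ * (p / 4) ^ 2 ≤ ℓ * (√L - p) ^ 2 := by gcongr
      have h6 : p ^ 3 * lam ≤ p ^ 3 * (p / 32) := by
        gcongr; linarith
      have h7 : ℓ * (p / 4) ^ 2 / 2 = p ^ 3 * (p / 32) := by rw [← hpp]; ring
      linarith

end Drift

/-! ### The drift function for zero logarithmic mean. -/

section Drift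

variable {μ : Measure (ℝ × ℝ)} {φ ω2 σ2 : ℝ}

lemma measurable_logGain (φ x : ℝ) : Measurable (logGain φ x) := by
  have h1 : Measurable fun z : ℝ × ℝ => Real.posLog ((φ + z.1) * x + z.2) :=
    Real.continuous_posLog.measurable.comp (by fun_prop)
  have h2 : Measurable fun z : ℝ × ℝ => Real.log (φ + z.1) := by fun_prop
  unfold logGain
  exact ((((h1.sqrt).sub_const _).pow_const 2).const_mul _ |>.div_const 2).sub
    ((measurable_const.max ((h2.const_add _).sub h1)).const_mul _)

/-- The square of the scaled increment gives `(log |A| / 2)² / 2`. The loss term is at most of order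
`(log |x|)² / |x|`. -/
lemma tendsto_logGain {z : ℝ × ℝ} (hz : φ + z.1 ≠ 0) :
    Tendsto (fun x => logGain φ x z) absAtTop (𝓝 (Real.log (φ + z.1) ^ 2 / 8)) := by
  have h1 := ((tendsto_sqrt_mul_sqrt_step_sub hz z.2).pow 2).div_const 2
  have h2 : Tendsto (fun x => √(Real.log x) ^ 3 * max 0 (Real.log x + Real.log (φ + z.1)
      - Real.posLog ((φ + z.1) * x + z.2))) absAtTop (𝓝 0) := by
    have h3 : Tendsto (fun x : ℝ => Real.log x ^ 2 / |x| * (2 * |z.2| / |φ + z.1|))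
        absAtTop (𝓝 0) := by
      have h4 := (Real.tendsto_pow_log_div_mul_add_atTop 1 0 2 one_ne_zero).comp
        tendsto_abs_absAtTop
      simp only [Function.comp_def, one_mul, add_zero, Real.log_abs] at h4
      simpa using h4.mul_const (2 * |z.2| / |φ + z.1|)
    refine squeeze_zero' (Eventually.of_forall fun x => by positivity) ?_ h3
    have hA0 : 0 < |φ + z.1| := abs_pos.2 hz
    filter_upwards [tendsto_log_absAtTop.eventually_ge_atTop 1,
      tendsto_abs_absAtTop.eventually_ge_atTop (2 * |z.2| / |φ + z.1| + 1)] with x hx1 hx2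
    have hx0 : 0 < |x| := lt_of_lt_of_le (by positivity) hx2
    have hx0' : x ≠ 0 := abs_pos.1 hx0
    have h5 := (log_mul_sub_posLog_add_le (A := φ + z.1) (x := x) (ε := z.2)).2
      (mul_ne_zero hz hx0')
    rw [Real.log_mul hz hx0', add_comm] at h5
    have h6 : |φ + z.1| * |x| / 2 ≤ max 1 |(φ + z.1) * x + z.2| := by
      refine le_trans ?_ (le_max_right _ _)
      have h7 : |(φ + z.1) * x| - |z.2| ≤ |(φ + z.1) * x + z.2| := by
        have := abs_sub_abs_le_abs_sub ((φ + z.1) * x) (-z.2)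
        rwa [abs_neg, sub_neg_eq_add] at this
      rw [abs_mul] at h7
      have h8 : 2 * |z.2| ≤ |φ + z.1| * |x| := by
        have : 2 * |z.2| / |φ + z.1| ≤ |x| := by linarith
        rw [div_le_iff₀ hA0] at this
        linarith
      linarith
    have h9 : |z.2| / max 1 |(φ + z.1) * x + z.2| ≤ 2 * |z.2| / (|φ + z.1| * |x|) := by
      calc |z.2| / max 1 |(φ + z.1) * x + z.2| ≤ |z.2| / (|φ + z.1| * |x| / 2) := by gcongr
        _ = _ := by field_simp
    have h10 : √(Real.log x) ^ 3 ≤ Real.log x ^ 2 := by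
      have e1 := Real.sq_sqrt (zero_le_one.trans hx1)
      have e2 : 1 ≤ √(Real.log x) := Real.one_le_sqrt.2 hx1
      calc √(Real.log x) ^ 3 ≤ √(Real.log x) ^ 4 := pow_le_pow_right₀ e2 (by norm_num)
        _ = (√(Real.log x) ^ 2) ^ 2 := by ring
        _ = _ := by rw [e1]
    calc _ ≤ Real.log x ^ 2 * (2 * |z.2| / (|φ + z.1| * |x|)) := by
          gcongr
          exact max_le (by positivity) (h5.trans h9)
      _ = _ := by field_simp
  have h4 := h1.sub h2
  have e : (Real.log (φ + z.1) / 2) ^ 2 / 2 - 0 = Real.log (φ + z.1) ^ 2 / 8 := by ring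
  rw [e] at h4
  refine h4.congr' ?_
  filter_upwards [tendsto_log_absAtTop.eventually_ge_atTop 0] with x hx
  unfold logGain
  rw [mul_pow, Real.sq_sqrt hx]

variable [IsProbabilityMeasure μ]

/-- Drift function in the case `E log |φ + b| = 0`, `|φ + b|` not degenerate. -/
lemma exists_isDrift_of_zero (hm : NoiseMoments μ ω2 σ2) (hne : ∀ᵐ z ∂μ, φ + z.1 ≠ 0)
    (hint : Integrable (fun z => Real.log (φ + z.1)) μ) (hzero : ∫ z, Real.log (φ + z.1) ∂μ = 0)
    (hnd : ¬ ∀ᵐ z ∂μ, |φ + z.1| = 1) :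
    ∃ K v₀, IsDrift μ φ (fun x => (√(Real.posLog x) - 1 / 2) ^ 2) K v₀ := by
  -- Truncation at 1 supplies the upper half of the domination. Only a lower bound on the drift is
  -- wanted, so nothing is lost.
  have hlim : Tendsto (fun x => ∫ z, min 1 (logGain φ x z) ∂μ) absAtTop
      (𝓝 (∫ z, min 1 (Real.log (φ + z.1) ^ 2 / 8) ∂μ)) := by
    refine tendsto_integral_filter_of_dominated_convergence
      (fun z => 33 + 32 ^ 3 * z.2 ^ 4)
      (Eventually.of_forall fun x =>
        (measurable_const.min (measurable_logGain φ x)).aestronglyMeasurable) ?_ ?_ ?_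
    · filter_upwards [tendsto_log_absAtTop.eventually_ge_atTop 16] with x hx
      filter_upwards [hne] with z hz
      have := logGain_ge hz hx
      have he4 : 0 ≤ z.2 ^ 4 := by positivity
      rw [Real.norm_eq_abs, abs_le]
      refine ⟨le_min (by linarith) (by linarith), (min_le_left _ _).trans (by linarith)⟩
    · exact (integrable_const _).add (hm.int_e.const_mul _)
    · filter_upwards [hne] with z hz
      exact tendsto_const_nhds.min (tendsto_logGain hz)
  have hYm : Measurable fun z : ℝ × ℝ => Real.log (φ + z.1) := by fun_prop
  set c := ∫ z, min 1 (Real.log (φ + z.1) ^ 2 / 8) ∂μ with hc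
  -- If the mean vanished, `log |A|` would be a.s. zero, which the nondegeneracy hypothesis
  -- excludes.
  have hc0 : 0 < c := by
    have h0 : ∀ z : ℝ × ℝ, 0 ≤ min 1 (Real.log (φ + z.1) ^ 2 / 8) := fun z =>
      le_min zero_le_one (by positivity)
    refine (integral_nonneg h0).lt_of_ne fun h => hnd ?_
    have hi : Integrable (fun z : ℝ × ℝ => min 1 (Real.log (φ + z.1) ^ 2 / 8)) μ := by
      refine (integrable_const (1 : ℝ)).mono'
        (measurable_const.min ((hYm.pow_const 2).div_const 8)).aestronglyMeasurable
        (Eventually.of_forall fun z => ?_)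
      rw [Real.norm_eq_abs, abs_of_nonneg (h0 z)]
      exact min_le_left _ _
    have h1 := (integral_eq_zero_iff_of_nonneg h0 hi).1 h.symm
    filter_upwards [h1, hne] with z hz hz0
    have h2 : Real.log (φ + z.1) ^ 2 / 8 = 0 := by
      rcases min_choice (1 : ℝ) (Real.log (φ + z.1) ^ 2 / 8) with h3 | h3
      · simp only [Pi.zero_apply] at hz
        rw [hz] at h3; norm_num at h3
      · rw [← h3]; exact hz
    have h3 : Real.log |φ + z.1| = 0 := by
      rw [Real.log_abs]
      nlinarith
    exact Real.eq_one_of_pos_of_log_eq_zero (abs_pos.2 hz0) h3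
  have hev := hlim.eventually (lt_mem_nhds (show c / 2 < c by linarith))
  refine isDrift_of_eventually (h := fun L => (√L - 1 / 2) ^ 2) (g := fun L => c / 2 / √L ^ 3)
    (by fun_prop) (fun L _ => sq_nonneg _) (fun L hL => ?_)
    (fun L L' hL' hL h => ?_) (fun L hL => ?_) (fun L L' hL h => ?_) ?_
  · nlinarith [Real.sq_sqrt hL, Real.sqrt_nonneg L]
  · have h1 : 1 ≤ √L' := Real.one_le_sqrt.2 hL'
    have h2 := Real.sqrt_le_sqrt h
    have h3 := Real.sqrt_nonneg L
    nlinarith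
  · have := Real.sqrt_pos.2 hL
    positivity
  · have := Real.sqrt_pos.2 hL
    gcongr
  · filter_upwards [hev, tendsto_log_absAtTop.eventually_ge_atTop 16] with x hx hx2
    have hl : 0 < Real.log x := by linarith
    have hs := Real.sqrt_pos.2 hl
    have hs2 := Real.sq_sqrt hl.le
    have hp4 : 4 ≤ √(Real.log x) := Real.le_sqrt_of_sq_le (by linarith)
    have hVi : Integrable (fun z : ℝ × ℝ =>
        (√(Real.posLog ((φ + z.1) * x + z.2)) - 1 / 2) ^ 2) μ := by
      refine hm.integrable_step (V := fun t => (√(Real.posLog t) - 1 / 2) ^ 2) (C := 1)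
        (by have := Real.continuous_posLog.measurable; fun_prop) (fun t => ?_) φ x
      rw [abs_of_nonneg (sq_nonneg _)]
      have := posLog_le_abs t
      nlinarith [Real.sq_sqrt (Real.posLog_nonneg (x := t)), Real.sqrt_nonneg (Real.posLog t)]
    set p := √(Real.log x) with hp
    -- From `q - p = (q² - p²) / (2 p) - (q - p)² / (2 p)`, the increment of `V` times `p³` equals
    -- `(p³ - p² / 2)(q² - p²) + p² (q - p)² / 2`. Since `q² - p² ≥ Y - lam`, a multiple of `Y = log
    -- |A|` splits off, and its mean is zero.
    have key : ∀ z : ℝ × ℝ, min 1 (logGain φ x z) ≤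
        p ^ 3 * ((√(Real.posLog ((φ + z.1) * x + z.2)) - 1 / 2) ^ 2 - (p - 1 / 2) ^ 2)
          - (p ^ 3 * (1 - 1 / (2 * p))) * Real.log (φ + z.1) := fun z => by
      refine (min_le_right _ _).trans ?_
      unfold logGain
      have hq := Real.sq_sqrt (Real.posLog_nonneg (x := (φ + z.1) * x + z.2))
      rw [← hp, ← hs2]
      set q := √(Real.posLog ((φ + z.1) * x + z.2))
      rw [← hq]
      set lam := max 0 (p ^ 2 + Real.log (φ + z.1) - q ^ 2) with hlam
      have h0 : 0 ≤ lam := le_max_left _ _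
      have h1 : p ^ 2 + Real.log (φ + z.1) - q ^ 2 ≤ lam := le_max_right _ _
      set Y := Real.log (φ + z.1)
      have e1 : p ^ 3 * (1 - 1 / (2 * p)) = p ^ 3 - p ^ 2 / 2 := by field_simp
      rw [e1]
      have h2 : 0 ≤ p ^ 3 - p ^ 2 / 2 := by nlinarith [sq_nonneg p]
      have h3 : (p ^ 3 - p ^ 2 / 2) * (p ^ 2 + Y - q ^ 2) ≤ p ^ 3 * lam :=
        calc _ ≤ (p ^ 3 - p ^ 2 / 2) * lam := by gcongr
          _ ≤ p ^ 3 * lam := by gcongr; nlinarith [sq_nonneg p]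
      nlinarith
    have hi1 : Integrable (fun z : ℝ × ℝ => p ^ 3 *
        ((√(Real.posLog ((φ + z.1) * x + z.2)) - 1 / 2) ^ 2 - (p - 1 / 2) ^ 2)) μ :=
      (hVi.sub (integrable_const _)).const_mul _
    have hi2 : Integrable (fun z : ℝ × ℝ =>
        (p ^ 3 * (1 - 1 / (2 * p))) * Real.log (φ + z.1)) μ := hint.const_mul _
    have hi3 : Integrable (fun z => min 1 (logGain φ x z)) μ := by
      refine ((integrable_const (33 : ℝ)).add (hm.int_e.const_mul (32 ^ 3))).mono'
        (measurable_const.min (measurable_logGain φ x)).aestronglyMeasurable ?_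
      filter_upwards [hne] with z hz
      have := logGain_ge hz hx2
      have he4 : 0 ≤ z.2 ^ 4 := by positivity
      rw [Real.norm_eq_abs, abs_le]
      simp only [Pi.add_apply]
      refine ⟨le_min (by linarith) (by linarith), (min_le_left _ _).trans (by linarith)⟩
    have hmono := integral_mono hi3 (hi1.sub hi2) key
    simp only [Pi.sub_apply] at hmono
    rw [integral_sub hi1 hi2, integral_const_mul, integral_const_mul, hzero,
      integral_sub hVi (integrable_const _)] at hmono
    simp only [integral_const, probReal_univ, smul_eq_mul, one_mul, mul_zero, sub_zero] at hmono
    have h4 : c / 2 / p ^ 3 ≤ ∫ z, (√(Real.posLog ((φ + z.1) * x + z.2)) - 1 / 2) ^ 2 ∂μ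
        - (p - 1 / 2) ^ 2 := by
      rw [div_le_iff₀ (by positivity)]; linarith
    linarith

end Drift

/-! ### Sublinear growth of the mean of the Lyapunov functions. -/

section Growth

variable {Ω : Type*} [mΩ : MeasurableSpace Ω] {P : Measure Ω}
  {b e : ℕ → Ω → ℝ} {μ : Measure (ℝ × ℝ)} {φ x₀ ω2 σ2 : ℝ}

lemma abs_rpow_le_one_add_abs {θ : ℝ} (h0 : 0 ≤ θ) (h1 : θ ≤ 1) (x : ℝ) :
    |x| ^ θ ≤ 1 + |x| := by
  rcases le_total |x| 1 with h | h
  · linarith [Real.rpow_le_one (abs_nonneg x) h h0, abs_nonneg x]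
  · have := Real.rpow_le_rpow_of_exponent_le h h1
    rw [Real.rpow_one] at this
    linarith

lemma abs_mul_add_rpow_le {θ : ℝ} (h0 : 0 < θ) (h1 : θ ≤ 1) (A x ε : ℝ) :
    |A * x + ε| ^ θ ≤ |x| ^ θ * |A| ^ θ + |ε| ^ θ := by
  have h2 := NNReal.rpow_add_le_add_rpow ‖A * x‖₊ ‖ε‖₊ h0.le h1
  rw [← NNReal.coe_le_coe] at h2
  push_cast at h2
  simp only [Real.norm_eq_abs] at h2
  refine (Real.rpow_le_rpow (abs_nonneg _) (abs_add_le _ _) h0.le).trans (h2.trans_eq ?_)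
  rw [abs_mul, Real.mul_rpow (abs_nonneg _) (abs_nonneg _), mul_comm]

lemma posLog_le_log_one_add_rpow {θ : ℝ} (h0 : 0 < θ) (x : ℝ) :
    Real.posLog x ≤ Real.log (1 + |x| ^ θ) / θ := by
  have hr : 0 ≤ |x| ^ θ := by positivity
  rw [le_div_iff₀ h0]
  rcases eq_or_ne x 0 with rfl | hx
  · rw [Real.posLog_zero, zero_mul]; exact Real.log_nonneg (by linarith)
  rw [Real.posLog_apply, max_mul_of_nonneg _ _ h0.le, zero_mul]
  refine max_le (Real.log_nonneg (by linarith)) ?_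
  rw [mul_comm, ← Real.log_abs x, ← Real.log_rpow (abs_pos.2 hx)]
  exact Real.log_le_log (Real.rpow_pos_of_pos (abs_pos.2 hx) _) (by linarith)

lemma sqrt_le_half_add {t a : ℝ} (ht : 0 ≤ t) (ha : 0 < a) : √t ≤ (t / a + a) / 2 := by
  have h : √t * a ≤ (t + a ^ 2) / 2 := by nlinarith [Real.sq_sqrt ht, sq_nonneg (√t - a)]
  rw [← mul_le_mul_iff_of_pos_right ha]
  refine h.trans_eq ?_
  field_simp

/-- Small moments of `|φ + b|` when `E log |φ + b| = 0`. -/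
lemma NoiseMoments.exists_rpow_moment_le [IsProbabilityMeasure μ] (hm : NoiseMoments μ ω2 σ2)
    (hne : ∀ᵐ z ∂μ, φ + z.1 ≠ 0)
    (hint : Integrable (fun z => Real.log (φ + z.1)) μ) (hzero : ∫ z, Real.log (φ + z.1) ∂μ = 0)
    {ε : ℝ} (hε : 0 < ε) :
    ∃ θ : ℝ, 0 < θ ∧ θ ≤ 1 ∧ ∫ z, |φ + z.1| ^ θ ∂μ ≤ 1 + ε * θ := by
  -- The difference quotient of `θ ↦ |A|^θ` at zero. It lies between `log |A|` and `|A| - 1` and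
  -- converges to `log |A|`, so the slope of the moment function at zero is `E log |A| = 0`.
  set s : ℝ → ℝ × ℝ → ℝ := fun θ z => θ⁻¹ * (|φ + z.1| ^ θ - 1) with hs
  have hpow : ∀ θ : ℝ, Measurable fun z : ℝ × ℝ => |φ + z.1| ^ θ := fun θ =>
    ((measurable_fst.const_add φ).abs).pow_const θ
  have hsm : ∀ θ, Measurable (s θ) := fun θ => ((hpow θ).sub_const 1).const_mul _
  have hia : Integrable (fun z : ℝ × ℝ => |φ + z.1|) μ :=
    ((integrable_const φ).add hm.integrable_fst).abs
  have hlim : Tendsto (fun θ => ∫ z, s θ z ∂μ) (𝓝[>] 0) (𝓝 (∫ z, Real.log (φ + z.1) ∂μ)) := by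
    refine tendsto_integral_filter_of_dominated_convergence
      (fun z => |Real.log (φ + z.1)| + (|φ + z.1| + 1))
      (Eventually.of_forall fun θ => (hsm θ).aestronglyMeasurable) ?_ ?_ ?_
    · filter_upwards [Ioc_mem_nhdsGT (zero_lt_one' ℝ)] with θ hθ
      filter_upwards [hne] with z hz
      have hA := abs_pos.2 hz
      have h1 : Real.log (φ + z.1) ≤ s θ z := by
        have h2 := Real.log_le_sub_one_of_pos (Real.rpow_pos_of_pos hA θ)
        rw [Real.log_rpow hA, Real.log_abs] at h2
        simp only [hs]
        rw [← div_eq_inv_mul, le_div_iff₀ hθ.1]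
        linarith
      have h2 : s θ z ≤ |φ + z.1| - 1 := by
        have h3 := rpow_one_add_le_one_add_mul_self (s := |φ + z.1| - 1) (by linarith)
          hθ.1.le hθ.2
        rw [add_sub_cancel] at h3
        simp only [hs]
        rw [← div_eq_inv_mul, div_le_iff₀ hθ.1]
        linarith
      rw [Real.norm_eq_abs, abs_le]
      constructor
      · linarith [neg_abs_le (Real.log (φ + z.1))]
      · linarith [abs_nonneg (Real.log (φ + z.1))]
    · exact hint.abs.add (hia.add (integrable_const 1))
    · filter_upwards [hne] with z hz
      have := tendsto_rpow_sub_one_log (abs_pos.2 hz)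
      rwa [Real.log_abs] at this
  rw [hzero] at hlim
  obtain ⟨θ, h1, h2⟩ := ((hlim.eventually (gt_mem_nhds hε)).and
    (Ioc_mem_nhdsGT (zero_lt_one' ℝ))).exists
  refine ⟨θ, h2.1, h2.2, ?_⟩
  have hi : Integrable (fun z : ℝ × ℝ => |φ + z.1| ^ θ) μ :=
    ((integrable_const 1).add hia).mono' (hpow θ).aestronglyMeasurable
      (Eventually.of_forall fun z => by
        rw [Real.norm_eq_abs, abs_of_nonneg (by positivity)]
        exact abs_rpow_le_one_add_abs h2.1.le h2.2 _)
  simp only [hs] at h1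
  rw [integral_const_mul, integral_sub hi (integrable_const _), ← div_eq_inv_mul,
    div_lt_iff₀ h2.1] at h1
  simp only [integral_const, probReal_univ, smul_eq_mul, one_mul] at h1
  linarith

namespace IsNoise

variable [IsProbabilityMeasure P] (hN : IsNoise P b e μ) (hm : NoiseMoments μ ω2 σ2)
include hN hm

lemma integrable_posLog (φ x₀ : ℝ) (k : ℕ) :
    Integrable (fun w => Real.posLog (rcaProcess φ x₀ b e k w)) P :=
  hN.integrable_of_linear_growth hm Real.continuous_posLog.measurable (C := 1) (fun x => by
    rw [abs_of_nonneg Real.posLog_nonneg]; linarith [posLog_le_abs x]) φ x₀ k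

/-- The mean logarithmic size grows at most linearly. -/
lemma exists_integral_posLog_le (φ x₀ : ℝ) :
    ∃ C, ∀ n : ℕ, ∫ w, Real.posLog (rcaProcess φ x₀ b e n w) ∂P ≤ C * (1 + n) := by
  have := hN.isProbabilityMeasure
  have hiA : Integrable (fun z : ℝ × ℝ => |φ + z.1| + |z.2|) μ :=
    ((integrable_const φ).add hm.integrable_fst).abs.add hm.integrable_snd.abs
  set c := ∫ z, (|φ + z.1| + |z.2|) ∂μ + Real.log 2 with hc
  have hc0 : 0 ≤ c := add_nonneg (integral_nonneg fun z => by positivity)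
    (Real.log_nonneg (by norm_num))
  have hrec : ∀ n : ℕ, ∫ w, Real.posLog (rcaProcess φ x₀ b e n w) ∂P ≤ Real.posLog x₀ + c * n := by
    intro n
    induction n with
    | zero => simp [rcaProcess]
    | succ n ih =>
      have h1 := hN.integrable_posLog hm φ x₀ n
      have h2 : Integrable (fun w => |φ + b (n + 1) w| + |e (n + 1) w|) P :=
        hN.integrable_noise hiA (n + 1)
      have h3 := hN.integral_noise (f := fun z : ℝ × ℝ => |φ + z.1| + |z.2|)
        (((measurable_fst.const_add φ).abs).add measurable_snd.abs) (n + 1)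
      have h4 : ∫ w, Real.posLog (rcaProcess φ x₀ b e (n + 1) w) ∂P
          ≤ ∫ w, (Real.posLog (rcaProcess φ x₀ b e n w)
            + (|φ + b (n + 1) w| + |e (n + 1) w|) + Real.log 2) ∂P := by
        refine integral_mono (hN.integrable_posLog hm φ x₀ (n + 1))
          ((h1.add h2).add (integrable_const _)) fun w => ?_
        have h5 := posLog_mul_add_le (φ + b (n + 1) w) (rcaProcess φ x₀ b e n w) (e (n + 1) w)
        simp only [rcaProcess]
        linarith [posLog_le_abs (φ + b (n + 1) w), posLog_le_abs (e (n + 1) w)]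
      have h12 : Integrable (fun w => Real.posLog (rcaProcess φ x₀ b e n w)
          + (|φ + b (n + 1) w| + |e (n + 1) w|)) P := h1.add h2
      rw [integral_add h12 (integrable_const _), integral_add h1 h2, h3] at h4
      simp only [integral_const, probReal_univ, smul_eq_mul, one_mul] at h4
      push_cast
      linarith
  refine ⟨Real.posLog x₀ + c, fun n => (hrec n).trans ?_⟩
  have : 0 ≤ Real.posLog x₀ := Real.posLog_nonneg
  have hn : (0 : ℝ) ≤ n := n.cast_nonneg
  nlinarith [mul_nonneg this hn]

omit hm in
/-- The mean of the square root of a function with linearly growing mean is sublinear. -/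
lemma tendsto_integral_sqrt_div {U : ℝ → ℝ} {C : ℝ} (hU : ∀ x, 0 ≤ U x)
    (hUm : Measurable U)
    (hi : ∀ n, Integrable (fun w => U (rcaProcess φ x₀ b e n w)) P)
    (h : ∀ n : ℕ, ∫ w, U (rcaProcess φ x₀ b e n w) ∂P ≤ C * (1 + n)) :
    Tendsto (fun n : ℕ => (∫ w, √(U (rcaProcess φ x₀ b e n w)) ∂P) / n) atTop (𝓝 0) := by
  have hle : ∀ n : ℕ, 0 < n → (∫ w, √(U (rcaProcess φ x₀ b e n w)) ∂P) / n
      ≤ (2 * |C| + 1) * (√n)⁻¹ := by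
    intro n hn
    have hn0 : (0 : ℝ) < n := by exact_mod_cast hn
    have hn1 : (1 : ℝ) ≤ n := by exact_mod_cast hn
    have hs : 0 < √(n : ℝ) := Real.sqrt_pos.2 hn0
    have hss : √(n : ℝ) * √n = n := Real.mul_self_sqrt hn0.le
    have hm' := hUm.comp (hN.measurable_rcaProcess φ x₀ n)
    have hi2 : Integrable (fun w => (U (rcaProcess φ x₀ b e n w) / √n + √n) / 2) P :=
      (((hi n).div_const _).add (integrable_const _)).div_const 2
    -- The inequality `√U ≤ (U / √n + √n) / 2` balances a mean of order `n` and yields a bound of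
    -- order `√n`.
    have h1 : ∫ w, √(U (rcaProcess φ x₀ b e n w)) ∂P
        ≤ ∫ w, (U (rcaProcess φ x₀ b e n w) / √n + √n) / 2 ∂P := by
      refine integral_mono_of_nonneg (Eventually.of_forall fun w => Real.sqrt_nonneg _) hi2
        (Eventually.of_forall fun w => sqrt_le_half_add (hU _) hs)
    rw [integral_div, integral_add ((hi n).div_const _) (integrable_const _), integral_div] at h1
    simp only [integral_const, probReal_univ, smul_eq_mul, one_mul] at h1
    have h2 : ∫ w, U (rcaProcess φ x₀ b e n w) ∂P ≤ 2 * |C| * n := by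
      refine (h n).trans ?_
      nlinarith [le_abs_self C, abs_nonneg C]
    have h3 : (∫ w, U (rcaProcess φ x₀ b e n w) ∂P) / √n ≤ 2 * |C| * √n := by
      rw [div_le_iff₀ hs, mul_assoc, hss]; exact h2
    rw [div_le_iff₀ hn0]
    have h4 : (2 * |C| + 1) * (√(n : ℝ))⁻¹ * n = (2 * |C| + 1) * √n := by
      rw [mul_assoc]; congr 1
      rw [inv_mul_eq_div, div_eq_iff hs.ne', hss]
    rw [h4]
    nlinarith [abs_nonneg C, mul_nonneg (abs_nonneg C) hs.le]
  have hlim : Tendsto (fun n : ℕ => (2 * |C| + 1) * (√(n : ℝ))⁻¹) atTop (𝓝 0) := by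
    have := (tendsto_inv_atTop_zero.comp
      (Real.tendsto_sqrt_atTop.comp tendsto_natCast_atTop_atTop)).const_mul (2 * |C| + 1)
    simpa [Function.comp_def] using this
  refine squeeze_zero' (Eventually.of_forall fun n => ?_) ?_ hlim
  · exact div_nonneg (integral_nonneg fun w => Real.sqrt_nonneg _) n.cast_nonneg
  · filter_upwards [eventually_gt_atTop 0] with n hn using hle n hn

lemma tendsto_integral_sqrt_posLog_div (φ x₀ : ℝ) :
    Tendsto (fun n : ℕ => (∫ w, √(Real.posLog (rcaProcess φ x₀ b e n w)) ∂P) / n) atTop (𝓝 0) := by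
  obtain ⟨C, hC⟩ := hN.exists_integral_posLog_le hm φ x₀
  exact hN.tendsto_integral_sqrt_div (fun x => Real.posLog_nonneg)
    Real.continuous_posLog.measurable (hN.integrable_posLog hm φ x₀) hC

/-- If `E (φ + b) ^ 2 = 1` the second moment grows linearly. -/
lemma integral_one_add_sq_of_eq_one (h1 : φ ^ 2 + ω2 = 1) (n : ℕ) :
    ∫ w, (1 + rcaProcess φ x₀ b e n w ^ 2) ∂P = 1 + x₀ ^ 2 + n * σ2 := by
  have hrec : ∫ w, rcaProcess φ x₀ b e n w ^ 2 ∂P = x₀ ^ 2 + n * σ2 := by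
    induction n with
    | zero => simp [rcaProcess]
    | succ n ih =>
      have := hN.integral_indicator_sq_succ hm φ x₀ (k := n) (ι := fun _ => 1) measurable_const
        (by simp)
      simp only [one_mul, integral_const, probReal_univ, smul_eq_mul, mul_one, h1] at this
      rw [this, ih]
      push_cast; ring
  rw [integral_add (integrable_const _) (hN.integrable_sq hm φ x₀ n), hrec]
  simp; ring

lemma tendsto_integral_sqrt_one_add_sq_div (h1 : φ ^ 2 + ω2 = 1) (hσ2 : 0 ≤ σ2) (x₀ : ℝ) :
    Tendsto (fun n : ℕ => (∫ w, √(1 + rcaProcess φ x₀ b e n w ^ 2) ∂P) / n) atTop (𝓝 0) := by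
  refine hN.tendsto_integral_sqrt_div (U := fun x => 1 + x ^ 2) (C := 1 + x₀ ^ 2 + σ2)
    (fun x => by positivity) (by fun_prop)
    (fun n => (integrable_const _).add (hN.integrable_sq hm φ x₀ n)) fun n => ?_
  rw [hN.integral_one_add_sq_of_eq_one hm h1]
  have hn : (0 : ℝ) ≤ n := n.cast_nonneg
  nlinarith [mul_nonneg (sq_nonneg x₀) hn]

/-- If `E log |φ + b| = 0` the mean logarithmic size is sublinear. -/
lemma tendsto_integral_posLog_div (hne : ∀ᵐ z ∂μ, φ + z.1 ≠ 0)
    (hint : Integrable (fun z => Real.log (φ + z.1)) μ) (hzero : ∫ z, Real.log (φ + z.1) ∂μ = 0)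
    (x₀ : ℝ) :
    Tendsto (fun n : ℕ => (∫ w, Real.posLog (rcaProcess φ x₀ b e n w) ∂P) / n) atTop (𝓝 0) := by
  have := hN.isProbabilityMeasure
  -- The `θ`-th moment of the state grows by a factor of at most `1 + ε θ` per step, up to an
  -- additive term. Taking logarithms and dividing by `θ` leaves the rate `ε` and a logarithmic
  -- correction.
  have hbound : ∀ ε : ℝ, 0 < ε → ∃ θ c d : ℝ, 0 < θ ∧ 0 < c ∧ 0 ≤ d ∧ ∀ n : ℕ,
      ∫ w, Real.posLog (rcaProcess φ x₀ b e n w) ∂P ≤ ε * n + Real.log (c + n * d) / θ := by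
    intro ε hε
    obtain ⟨θ, hθ0, hθ1, hρ⟩ := hm.exists_rpow_moment_le hne hint hzero hε
    set r := 1 + ε * θ with hr
    have hr1 : 1 ≤ r := by nlinarith [mul_pos hε hθ0]
    set d := ∫ z, |z.2| ^ θ ∂μ with hd
    have hd0 : 0 ≤ d := integral_nonneg fun z => by positivity
    have hm1 : Measurable fun x : ℝ => |x| ^ θ := (measurable_id.abs).pow_const θ
    have hgr : ∀ x : ℝ, |(|x| ^ θ)| ≤ 1 * (1 + |x|) := fun x => by
      rw [abs_of_nonneg (by positivity), one_mul]; exact abs_rpow_le_one_add_abs hθ0.le hθ1 x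
    have hi : ∀ k, Integrable (fun w => |(rcaProcess φ x₀ b e k w)| ^ θ) P := fun k =>
      hN.integrable_of_linear_growth hm hm1 hgr φ x₀ k
    have hiA : Integrable (fun z : ℝ × ℝ => |φ + z.1| ^ θ) μ := by
      have := hm.integrable_step hm1 hgr φ 1
      refine ((integrable_const 1).add ((integrable_const φ).add hm.integrable_fst).abs).mono'
        (hm1.comp (measurable_fst.const_add φ)).aestronglyMeasurable
        (Eventually.of_forall fun z => ?_)
      rw [Real.norm_eq_abs]
      simpa using hgr (φ + z.1)
    have hiE : Integrable (fun z : ℝ × ℝ => |z.2| ^ θ) μ := by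
      refine ((integrable_const 1).add hm.integrable_snd.abs).mono'
        (hm1.comp measurable_snd).aestronglyMeasurable (Eventually.of_forall fun z => ?_)
      rw [Real.norm_eq_abs]
      simpa using hgr z.2
    have hmean : ∀ n : ℕ, ∫ w, |(rcaProcess φ x₀ b e n w)| ^ θ ∂P
        ≤ r ^ n * (|x₀| ^ θ + n * d) := by
      intro n
      induction n with
      | zero => simp [rcaProcess]
      | succ n ih =>
        have hU : Measurable[noiseSigma b e n] fun w => |(rcaProcess φ x₀ b e n w)| ^ θ :=
          hm1.comp (measurable_rcaProcess_noiseSigma φ x₀ le_rfl)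
        have i1 : Integrable (fun w => |(rcaProcess φ x₀ b e n w)| ^ θ * |φ + b (n + 1) w| ^ θ) P :=
          hN.integrable_mul_succ hU (hi n) (hm1.comp (measurable_fst.const_add φ)) hiA
        have i2 : Integrable (fun w => |e (n + 1) w| ^ θ) P := hN.integrable_noise hiE (n + 1)
        have h1 : ∫ w, |(rcaProcess φ x₀ b e (n + 1) w)| ^ θ ∂P ≤
            ∫ w, (|(rcaProcess φ x₀ b e n w)| ^ θ * |φ + b (n + 1) w| ^ θ
              + |e (n + 1) w| ^ θ) ∂P :=
          integral_mono (hi (n + 1)) (i1.add i2) fun w => by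
            simpa [rcaProcess] using abs_mul_add_rpow_le hθ0 hθ1 (φ + b (n + 1) w)
              (rcaProcess φ x₀ b e n w) (e (n + 1) w)
        have h2 := hN.integral_mul_succ hU (f := fun z : ℝ × ℝ => |φ + z.1| ^ θ)
          (hm1.comp (measurable_fst.const_add φ))
        have h3 := hN.integral_noise (f := fun z : ℝ × ℝ => |z.2| ^ θ)
          (hm1.comp measurable_snd) (n + 1)
        rw [integral_add i1 i2] at h1
        simp only at h1 h2 h3
        rw [h2, h3] at h1
        have h4 : 0 ≤ ∫ w, |(rcaProcess φ x₀ b e n w)| ^ θ ∂P :=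
          integral_nonneg fun w => by positivity
        have h5 : (∫ w, |(rcaProcess φ x₀ b e n w)| ^ θ ∂P) * ∫ z, |φ + z.1| ^ θ ∂μ
            ≤ (r ^ n * (|x₀| ^ θ + n * d)) * r := by gcongr
        have h6 : d ≤ r ^ (n + 1) * d := le_mul_of_one_le_left hd0 (one_le_pow₀ hr1)
        push_cast
        calc _ ≤ _ := h1
          _ ≤ (r ^ n * (|x₀| ^ θ + n * d)) * r + r ^ (n + 1) * d := add_le_add h5 h6
          _ = _ := by ring
    refine ⟨θ, 1 + |x₀| ^ θ, d, hθ0, by positivity, hd0, fun n => ?_⟩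
    have hp0 : 0 < 1 + |x₀| ^ θ + n * d := by positivity
    -- An upper bound for `1 + E |X_n|^θ`. The tangent-line bound `log u ≤ u / a - 1 + log a` then
    -- plays the role of Jensen's inequality.
    set a := r ^ n * (1 + |x₀| ^ θ + n * d) with ha
    have hrn : 1 ≤ r ^ n := one_le_pow₀ hr1
    have ha0 : 0 < a := by positivity
    have hma : 1 + ∫ w, |(rcaProcess φ x₀ b e n w)| ^ θ ∂P ≤ a := by
      have := hmean n
      rw [ha]
      nlinarith
    have hi2 : Integrable (fun w => (((1 + |(rcaProcess φ x₀ b e n w)| ^ θ) / a - 1)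
        + Real.log a) / θ) P :=
      (((((integrable_const 1).add (hi n)).div_const a).sub (integrable_const 1)).add
        (integrable_const _)).div_const θ
    have h1 : ∫ w, Real.posLog (rcaProcess φ x₀ b e n w) ∂P ≤
        ∫ w, (((1 + |(rcaProcess φ x₀ b e n w)| ^ θ) / a - 1) + Real.log a) / θ ∂P := by
      refine integral_mono (hN.integrable_posLog hm φ x₀ n) hi2 fun w => ?_
      refine (posLog_le_log_one_add_rpow hθ0 _).trans ?_
      have hq : 0 < 1 + |(rcaProcess φ x₀ b e n w)| ^ θ := by positivity
      have h2 := Real.log_le_sub_one_of_pos (div_pos hq ha0)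
      rw [Real.log_div hq.ne' ha0.ne'] at h2
      exact div_le_div_of_nonneg_right (by linarith) hθ0.le
    have i3 := ((integrable_const (1 : ℝ)).add (hi n) : Integrable _ P)
    have h2 : ∫ w, (((1 + |(rcaProcess φ x₀ b e n w)| ^ θ) / a - 1) + Real.log a) / θ ∂P
        = (((1 + ∫ w, |(rcaProcess φ x₀ b e n w)| ^ θ ∂P) / a - 1) + Real.log a) / θ := by
      rw [integral_div, integral_add, integral_sub, integral_div, integral_add]
      · simp
      · exact integrable_const _
      · exact hi n
      · exact i3.div_const a
      · exact integrable_const _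
      · exact (i3.div_const a).sub (integrable_const _)
      · exact integrable_const _
    have h3 : (1 + ∫ w, |(rcaProcess φ x₀ b e n w)| ^ θ ∂P) / a ≤ 1 := (div_le_one ha0).2 hma
    have h4 : Real.log a ≤ n * (ε * θ) + Real.log (1 + |x₀| ^ θ + n * d) := by
      rw [ha, Real.log_mul (by positivity) hp0.ne', Real.log_pow]
      have := Real.log_le_sub_one_of_pos (by linarith : 0 < r)
      gcongr
      linarith
    calc _ ≤ _ := h1.trans_eq h2
      _ ≤ (n * (ε * θ) + Real.log (1 + |x₀| ^ θ + n * d)) / θ :=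
        div_le_div_of_nonneg_right (by linarith) hθ0.le
      _ = _ := by field_simp
  rw [Metric.tendsto_atTop]
  intro ε hε
  obtain ⟨θ, c, d, hθ, hc, hd, hb⟩ := hbound (ε / 2) (by positivity)
  -- `d + 1` replaces `d`, which may be zero, so that the argument of the logarithm tends to
  -- infinity and the denominator is positive for `n > 0`.
  have hlim : Tendsto (fun n : ℕ => Real.log (c + n * (d + 1)) ^ 1 / (n * (d + 1) * θ)) atTop
      (𝓝 0) := by
    have h1 := (Real.tendsto_pow_log_div_mul_add_atTop θ (-(c * θ)) 1 hθ.ne').comp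
      (tendsto_atTop_add_const_left atTop c
        ((tendsto_natCast_atTop_atTop (R := ℝ)).atTop_mul_const (by positivity : 0 < d + 1)))
    refine h1.congr fun n => ?_
    simp only [Function.comp]
    congr 1
    ring
  obtain ⟨N, hN'⟩ := Metric.tendsto_atTop.1 hlim (ε / 2 / (d + 1)) (by positivity)
  refine ⟨N + 1, fun n hn => ?_⟩
  have hn0 : (0 : ℝ) < n := by exact_mod_cast (by omega : 0 < n)
  have h1 := (le_abs_self _).trans_lt ((Real.dist_0_eq_abs _).symm.trans_lt (hN' n (by omega)))
  rw [Real.dist_0_eq_abs, abs_of_nonneg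
    (div_nonneg (integral_nonneg fun w => Real.posLog_nonneg) hn0.le), div_lt_iff₀ hn0]
  refine (hb n).trans_lt ?_
  have h2 : Real.log (c + n * d) ≤ Real.log (c + n * (d + 1)) :=
    Real.log_le_log (by positivity) (by nlinarith)
  rw [pow_one, div_lt_div_iff₀ (by positivity) (by positivity)] at h1
  have h3 : Real.log (c + n * (d + 1)) < ε / 2 * n * θ := by
    have : Real.log (c + n * (d + 1)) * (d + 1) < (ε / 2 * n * θ) * (d + 1) := by linarith
    exact lt_of_mul_lt_mul_right this (by positivity)
  have h4 : Real.log (c + n * d) / θ < ε / 2 * n := by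
    rw [div_lt_iff₀ hθ]; linarith
  linarith

end IsNoise

end Growth

/-! ### Escape to infinity under a nonnegative logarithmic mean. -/

section Explosive

variable {Ω : Type*} [mΩ : MeasurableSpace Ω] {P : Measure Ω}
  {b e : ℕ → Ω → ℝ} {μ : Measure (ℝ × ℝ)} {φ ω2 σ2 : ℝ}

lemma NoiseMoments.integral_coeff_sq [IsProbabilityMeasure μ] (hm : NoiseMoments μ ω2 σ2) (φ : ℝ) :
    Integrable (fun z => (φ + z.1) ^ 2) μ ∧ ∫ z, (φ + z.1) ^ 2 ∂μ = φ ^ 2 + ω2 := by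
  have e1 : ∀ z : ℝ × ℝ, (φ + z.1) ^ 2 = φ ^ 2 + (2 * φ * z.1 + z.1 ^ 2) := fun z => by ring
  simp_rw [e1]
  have i1 := hm.integrable_fst.const_mul (2 * φ)
  have i2 : Integrable (fun z : ℝ × ℝ => 2 * φ * z.1 + z.1 ^ 2) μ := i1.add hm.integrable_fst_sq
  refine ⟨(integrable_const _).add i2, ?_⟩
  rw [integral_add (integrable_const _) i2, integral_add i1 hm.integrable_fst_sq,
    integral_const_mul, hm.b1, hm.b2]
  simp

/-- Jensen's inequality: a nonnegative logarithmic mean forces `E (φ + b) ^ 2 ≥ 1`. -/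
lemma NoiseMoments.one_le_coeff_sq [IsProbabilityMeasure μ] (hm : NoiseMoments μ ω2 σ2)
    (hne : ∀ᵐ z ∂μ, φ + z.1 ≠ 0)
    (hint : Integrable (fun z => Real.log (φ + z.1)) μ)
    (hlog : 0 ≤ ∫ z, Real.log (φ + z.1) ∂μ) : 1 ≤ φ ^ 2 + ω2 := by
  obtain ⟨hi, he⟩ := hm.integral_coeff_sq φ
  have h1 : ∫ z, 2 * Real.log (φ + z.1) ∂μ ≤ ∫ z, ((φ + z.1) ^ 2 - 1) ∂μ := by
    refine integral_mono_ae (hint.const_mul 2) (hi.sub (integrable_const _)) ?_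
    filter_upwards [hne] with z hz
    have := Real.log_le_sub_one_of_pos (by positivity : 0 < (φ + z.1) ^ 2)
    rw [Real.log_pow] at this
    exact_mod_cast this
  rw [integral_const_mul, integral_sub hi (integrable_const _), he] at h1
  simp only [integral_const, probReal_univ, smul_eq_mul, one_mul] at h1
  linarith

/-- The process escapes to infinity in mean. -/
lemma IsNoise.tendsto_mean_inv_sqrt_of_log [IsProbabilityMeasure P] (hN : IsNoise P b e μ)
    (hm : NoiseMoments μ ω2 σ2) (hσ2 : 0 < σ2) (hne : ∀ᵐ z ∂μ, φ + z.1 ≠ 0)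
    (hint : Integrable (fun z => Real.log (φ + z.1)) μ)
    (hlog : 0 ≤ ∫ z, Real.log (φ + z.1) ∂μ) (x₀ : ℝ) :
    Tendsto (fun n : ℕ => (∑ k ∈ Finset.range n,
      ∫ w, 1 / √(1 + rcaProcess φ x₀ b e k w ^ 2) ∂P) / n) atTop (𝓝 0) := by
  have := hN.isProbabilityMeasure
  have hexp := hm.one_le_coeff_sq hne hint hlog
  refine hN.tendsto_mean_inv_sqrt fun R => ?_
  -- Each of the three cases has its own Lyapunov function; `exists_exit` serves all of them because
  -- `φ² + ω² ≥ 1` throughout.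
  rcases hlog.eq_or_lt with h0 | hpos
  · by_cases h1 : ∀ᵐ z ∂μ, |φ + z.1| = 1
    · refine hN.tendsto_occupation hm hσ2 hexp (isDrift_of_abs_eq_one hm hσ2 h1)
        (hN.tendsto_integral_sqrt_one_add_sq_div hm ?_ hσ2.le x₀) R
      rw [← (hm.integral_coeff_sq φ).2]
      have : ∫ z, (φ + z.1) ^ 2 ∂μ = ∫ z, (1 : ℝ) ∂μ := integral_congr_ae <| by
        filter_upwards [h1] with z hz
        rw [← sq_abs, hz, one_pow]
      rw [this]; simp
    · obtain ⟨K, v₀, hV⟩ := exists_isDrift_of_zero hm hne hint h0.symm h1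
      refine hN.tendsto_occupation hm hσ2 hexp hV ?_ R
      have hlim := (hN.tendsto_integral_posLog_div hm hne hint h0.symm x₀).add
        (tendsto_const_div_atTop_nhds_zero_nat (1 / 4))
      rw [add_zero] at hlim
      refine squeeze_zero (fun n => div_nonneg (integral_nonneg fun w => sq_nonneg _)
        n.cast_nonneg) (fun n => ?_) hlim
      rw [← add_div]
      gcongr
      have hi := hN.integrable_posLog hm φ x₀ n
      have h2 : ∫ w, Real.posLog (rcaProcess φ x₀ b e n w) ∂P + 1 / 4
          = ∫ w, (Real.posLog (rcaProcess φ x₀ b e n w) + 1 / 4) ∂P := by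
        rw [integral_add hi (integrable_const _)]; simp
      rw [h2]
      refine integral_mono_of_nonneg (Eventually.of_forall fun w => sq_nonneg _)
        (hi.add (integrable_const _)) (Eventually.of_forall fun w => ?_)
      have h3 := Real.posLog_nonneg (x := rcaProcess φ x₀ b e n w)
      simp only
      nlinarith [Real.sq_sqrt h3, Real.sqrt_nonneg (Real.posLog (rcaProcess φ x₀ b e n w))]
  · obtain ⟨K, v₀, hV⟩ := exists_isDrift_of_pos hm hne hint hpos
    exact hN.tendsto_occupation hm hσ2 hexp hV (hN.tendsto_integral_sqrt_posLog_div hm φ x₀) R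

end Explosive

/-! ### Good paths have probability tending to one. -/

section GoodPaths

variable {Ω : Type*} [mΩ : MeasurableSpace Ω] {P : Measure Ω} [IsProbabilityMeasure P]
  {b e : ℕ → Ω → ℝ} {μ : Measure (ℝ × ℝ)} {φ ω2 σ2 : ℝ}

namespace IsNoise

variable (hN : IsNoise P b e μ)
include hN

/-- Second moment of a martingale transform of the noise. -/
lemma integral_sum_sq {U : ℕ → Ω → ℝ} {B : ℝ}
    (hU : ∀ k, Measurable[noiseSigma b e k] (U k)) (hB : ∀ k w, |U k w| ≤ B)
    {f : ℝ × ℝ → ℝ} (hf : Measurable f) (hf0 : ∫ z, f z ∂μ = 0) (hf2 : MemLp f 2 μ) (n : ℕ) :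
    MemLp (fun w => ∑ k ∈ Finset.range n, f (b (k + 1) w, e (k + 1) w) * U k w) 2 P ∧
    ∫ w, (∑ k ∈ Finset.range n, f (b (k + 1) w, e (k + 1) w) * U k w) ^ 2 ∂P
      = (∫ z, f z ^ 2 ∂μ) * ∑ k ∈ Finset.range n, ∫ w, U k w ^ 2 ∂P := by
  have hUm : ∀ k, Measurable (U k) := fun k => (hU k).mono (hN.noiseSigma_le k) le_rfl
  have hfk : ∀ k, MemLp (fun w => f (b k w, e k w)) 2 P := fun k => by
    rw [← hN.law k] at hf2
    exact (memLp_map_measure_iff hf.aestronglyMeasurable (hN.meas k).aemeasurable).1 hf2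
  have hterm : ∀ k, MemLp (fun w => f (b (k + 1) w, e (k + 1) w) * U k w) 2 P := fun k => by
    have : MemLp (U k) ⊤ P := memLp_top_of_bound (hUm k).aestronglyMeasurable B
      (Eventually.of_forall fun w => hB k w)
    exact this.mul (hfk (k + 1))
  have hS : ∀ n, MemLp (fun w => ∑ k ∈ Finset.range n, f (b (k + 1) w, e (k + 1) w) * U k w) 2 P :=
    fun n => memLp_finsetSum _ fun k _ => hterm k
  refine ⟨hS n, ?_⟩
  induction n with
  | zero => simp
  | succ n ih =>
    set S : Ω → ℝ := fun w => ∑ k ∈ Finset.range n, f (b (k + 1) w, e (k + 1) w) * U k w with hSdef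
    have hSm : Measurable[noiseSigma b e n] S := by
      refine Finset.measurable_sum _ fun k hk => ?_
      have hk' := Finset.mem_range.1 hk
      exact (hf.comp (measurable_noiseSigma hk')).mul
        ((hU k).mono (noiseSigma_mono hk'.le) le_rfl)
    -- The cross term has mean zero because the last innovation is centred and independent of the
    -- past, so the second moments add up.
    have h1 : ∀ w, (∑ k ∈ Finset.range (n + 1), f (b (k + 1) w, e (k + 1) w) * U k w) ^ 2
        = S w ^ 2 + (2 * ((S w * U n w) * f (b (n + 1) w, e (n + 1) w))
          + U n w ^ 2 * f (b (n + 1) w, e (n + 1) w) ^ 2) := fun w => by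
      rw [Finset.sum_range_succ]; simp only [hSdef]; ring
    have i1 : Integrable (fun w => S w ^ 2) P := (hS n).integrable_sq
    have i2 : Integrable (fun w => 2 * ((S w * U n w) * f (b (n + 1) w, e (n + 1) w))) P := by
      refine Integrable.const_mul ?_ 2
      refine ((hS n).integrable_mul (hterm n)).congr (Eventually.of_forall fun w => ?_)
      simp only [Pi.mul_apply, hSdef]; ring
    have i3 : Integrable (fun w => U n w ^ 2 * f (b (n + 1) w, e (n + 1) w) ^ 2) P :=
      (hterm n).integrable_sq.congr (Eventually.of_forall fun w => by simp only; ring)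
    have i23 : Integrable (fun w => 2 * ((S w * U n w) * f (b (n + 1) w, e (n + 1) w))
          + U n w ^ 2 * f (b (n + 1) w, e (n + 1) w) ^ 2) P := i2.add i3
    simp_rw [h1]
    rw [integral_add i1 i23, integral_add i2 i3, integral_const_mul,
      hN.integral_mul_succ_eq_zero (U := fun w => S w * U n w) (hSm.mul (hU n)) hf hf0,
      hN.integral_mul_succ ((hU n).pow_const 2) (hf.pow_const 2), ih, Finset.sum_range_succ]
    ring

/-- Chebyshev's inequality for a martingale transform of the noise. -/
lemma measureReal_lt_abs_sum_le {U : ℕ → Ω → ℝ} {B : ℝ}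
    (hU : ∀ k, Measurable[noiseSigma b e k] (U k)) (hB : ∀ k w, |U k w| ≤ B)
    {f : ℝ × ℝ → ℝ} (hf : Measurable f) (hf0 : ∫ z, f z ∂μ = 0) (hf2 : MemLp f 2 μ) (n : ℕ)
    {c : ℝ} (hc : 0 < c) :
    P.real {w | c < |∑ k ∈ Finset.range n, f (b (k + 1) w, e (k + 1) w) * U k w|}
      ≤ ((∫ z, f z ^ 2 ∂μ) * ∑ k ∈ Finset.range n, ∫ w, U k w ^ 2 ∂P) / c ^ 2 := by
  obtain ⟨h1, h2⟩ := hN.integral_sum_sq hU hB hf hf0 hf2 n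
  have h3 := mul_meas_ge_le_integral_of_nonneg (Eventually.of_forall fun w => sq_nonneg _)
    h1.integrable_sq (c ^ 2)
  rw [h2] at h3
  rw [le_div_iff₀ (by positivity), mul_comm]
  refine le_trans ?_ h3
  refine mul_le_mul_of_nonneg_left (measureReal_mono fun w hw => ?_) (by positivity)
  have hw' : c < |∑ k ∈ Finset.range n, f (b (k + 1) w, e (k + 1) w) * U k w| := hw
  change c ^ 2 ≤ (∑ k ∈ Finset.range n, f (b (k + 1) w, e (k + 1) w) * U k w) ^ 2
  rw [← sq_abs (∑ k ∈ Finset.range n, _)]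
  gcongr

lemma measureReal_lt_abs_sum_le' {f : ℝ × ℝ → ℝ} (hf : Measurable f) (hf0 : ∫ z, f z ∂μ = 0)
    (hf2 : MemLp f 2 μ) (n : ℕ) {c : ℝ} (hc : 0 < c) :
    P.real {w | c < |∑ k ∈ Finset.range n, f (b (k + 1) w, e (k + 1) w)|}
      ≤ ((∫ z, f z ^ 2 ∂μ) * n) / c ^ 2 := by
  have := hN.measureReal_lt_abs_sum_le (U := fun _ _ => 1) (B := 1) (fun _ => measurable_const)
    (by simp) hf hf0 hf2 n hc
  simpa using this

lemma tendsto_measureReal_mean {f : ℝ × ℝ → ℝ} (hf : Measurable f) (hf0 : ∫ z, f z ∂μ = 0)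
    (hf2 : MemLp f 2 μ) {ρ : ℝ} (hρ : 0 < ρ) :
    Tendsto (fun n : ℕ =>
      P.real {w | ρ * n < |∑ k ∈ Finset.range n, f (b (k + 1) w, e (k + 1) w)|}) atTop (𝓝 0) := by
  have hlim := tendsto_const_div_atTop_nhds_zero_nat ((∫ z, f z ^ 2 ∂μ) / ρ ^ 2)
  refine squeeze_zero' (Eventually.of_forall fun n => measureReal_nonneg) ?_ hlim
  filter_upwards [eventually_gt_atTop 0] with n hn
  have hn0 : (0 : ℝ) < n := by exact_mod_cast hn
  refine (hN.measureReal_lt_abs_sum_le' hf hf0 hf2 n (by positivity)).trans_eq ?_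
  field_simp

/-- Weighted sums with weights vanishing at infinity are negligible. -/
lemma tendsto_measureReal_weighted {x₀ : ℝ}
    (hesc : Tendsto (fun n : ℕ => (∑ k ∈ Finset.range n,
      ∫ w, 1 / √(1 + rcaProcess φ x₀ b e k w ^ 2) ∂P) / n) atTop (𝓝 0))
    {f : ℝ × ℝ → ℝ} (hf : Measurable f) (hf0 : ∫ z, f z ∂μ = 0)
    (hf2 : MemLp f 2 μ) {h : ℝ → ℝ} (hh : Measurable h) {B : ℝ}
    (hB : ∀ x, |h x| ≤ B / √(1 + x ^ 2)) {ρ : ℝ} (hρ : 0 < ρ) :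
    Tendsto (fun n : ℕ => P.real {w | ρ * √n < |∑ k ∈ Finset.range n,
      f (b (k + 1) w, e (k + 1) w) * h (rcaProcess φ x₀ b e k w)|}) atTop (𝓝 0) := by
  set X := rcaProcess φ x₀ b e with hX
  have hB0 : 0 ≤ B := by simpa using (abs_nonneg _).trans (hB 0)
  have hlim := hesc.const_mul ((∫ z, f z ^ 2 ∂μ) * B ^ 2 / ρ ^ 2)
  rw [mul_zero] at hlim
  have hf20 : 0 ≤ ∫ z, f z ^ 2 ∂μ := integral_nonneg fun z => sq_nonneg _
  refine squeeze_zero' (Eventually.of_forall fun n => measureReal_nonneg) ?_ hlim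
  filter_upwards [eventually_gt_atTop 0] with n hn
  have hn0 : (0 : ℝ) < n := by exact_mod_cast hn
  have hs : 0 < √(n : ℝ) := Real.sqrt_pos.2 hn0
  have hU : ∀ k, Measurable[noiseSigma b e k] fun w => h (X k w) := fun k =>
    hh.comp (measurable_rcaProcess_noiseSigma φ x₀ le_rfl)
  refine (hN.measureReal_lt_abs_sum_le (B := B) hU (fun k w => (hB _).trans
    (div_le_self hB0 (one_le_sqrt_one_add_sq _))) hf hf0 hf2 n (mul_pos hρ hs)).trans ?_
  -- Squaring the weight gives `B² / (1 + X²)`; one of the two factors `1 / √(1 + X²)` is bounded by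
  -- 1 so that the escape hypothesis applies.
  have h1 : ∑ k ∈ Finset.range n, ∫ w, h (X k w) ^ 2 ∂P
      ≤ B ^ 2 * ∑ k ∈ Finset.range n, ∫ w, 1 / √(1 + X k w ^ 2) ∂P := by
    rw [Finset.mul_sum]
    refine Finset.sum_le_sum fun k _ => ?_
    rw [← integral_const_mul]
    refine integral_mono_of_nonneg (Eventually.of_forall fun w => sq_nonneg _)
      ((hN.integrable_inv_sqrt φ x₀ k).const_mul _) (Eventually.of_forall fun w => ?_)
    have h2 := one_le_sqrt_one_add_sq (X k w)
    simp only
    calc h (X k w) ^ 2 = |h (X k w)| ^ 2 := (sq_abs _).symm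
      _ ≤ (B / √(1 + X k w ^ 2)) ^ 2 := by gcongr; exact hB _
      _ = B ^ 2 * (1 / √(1 + X k w ^ 2) * (1 / √(1 + X k w ^ 2))) := by ring
      _ ≤ B ^ 2 * (1 / √(1 + X k w ^ 2) * 1) := by
          gcongr
          exact (div_le_one (by linarith)).2 h2
      _ = _ := by rw [mul_one]
  rw [mul_pow, Real.sq_sqrt hn0.le]
  calc _ ≤ (∫ z, f z ^ 2 ∂μ) * (B ^ 2 * ∑ k ∈ Finset.range n, ∫ w, 1 / √(1 + X k w ^ 2) ∂P)
        / (ρ ^ 2 * n) := by gcongr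
    _ = _ := by field_simp

/-- Markov's inequality suffices: the summands are nonnegative, and by independence each mean
factors into the mean of `f` and `E 1 / √(1 + X_k²)`. -/
lemma tendsto_measureReal_escape {x₀ : ℝ}
    (hesc : Tendsto (fun n : ℕ => (∑ k ∈ Finset.range n,
      ∫ w, 1 / √(1 + rcaProcess φ x₀ b e k w ^ 2) ∂P) / n) atTop (𝓝 0))
    {f : ℝ × ℝ → ℝ} (hf : Measurable f) (hf0 : ∀ z, 0 ≤ f z) (hfi : Integrable f μ)
    {ρ : ℝ} (hρ : 0 < ρ) :
    Tendsto (fun n : ℕ => P.real {w | ρ * n < ∑ k ∈ Finset.range n,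
      f (b (k + 1) w, e (k + 1) w) / √(1 + rcaProcess φ x₀ b e k w ^ 2)}) atTop (𝓝 0) := by
  set X := rcaProcess φ x₀ b e with hX
  have hlim := hesc.const_mul ((∫ z, f z ∂μ) / ρ)
  rw [mul_zero] at hlim
  refine squeeze_zero' (Eventually.of_forall fun n => measureReal_nonneg) ?_ hlim
  filter_upwards [eventually_gt_atTop 0] with n hn
  have hn0 : (0 : ℝ) < n := by exact_mod_cast hn
  have hU : ∀ k, Measurable[noiseSigma b e k] fun w => 1 / √(1 + X k w ^ 2) := fun k => by
    have h1 : Measurable fun x : ℝ => 1 / √(1 + x ^ 2) := by fun_prop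
    exact h1.comp (measurable_rcaProcess_noiseSigma φ x₀ le_rfl)
  have hi : ∀ k, Integrable (fun w => 1 / √(1 + X k w ^ 2) * f (b (k + 1) w, e (k + 1) w)) P :=
    fun k => hN.integrable_mul_succ (hU k) (hN.integrable_inv_sqrt φ x₀ k) hf hfi
  have h1 : ∀ w, ∑ k ∈ Finset.range n, f (b (k + 1) w, e (k + 1) w) / √(1 + X k w ^ 2)
      = ∑ k ∈ Finset.range n, 1 / √(1 + X k w ^ 2) * f (b (k + 1) w, e (k + 1) w) := fun w =>
    Finset.sum_congr rfl fun k _ => by ring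
  simp_rw [h1]
  have h2 := mul_meas_ge_le_integral_of_nonneg (Eventually.of_forall fun w =>
    Finset.sum_nonneg fun k _ => mul_nonneg (by positivity) (hf0 _))
    (integrable_finsetSum (Finset.range n) fun k _ => hi k) (ρ * n)
  rw [integral_finsetSum _ fun k _ => hi k] at h2
  simp_rw [hN.integral_mul_succ (hU _) hf] at h2
  rw [← Finset.sum_mul] at h2
  have h3 : P.real {w | ρ * n < ∑ k ∈ Finset.range n,
        1 / √(1 + X k w ^ 2) * f (b (k + 1) w, e (k + 1) w)}
      ≤ ((∑ k ∈ Finset.range n, ∫ w, 1 / √(1 + X k w ^ 2) ∂P) * ∫ z, f z ∂μ) / (ρ * n) := by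
    rw [le_div_iff₀ (by positivity), mul_comm]
    refine le_trans ?_ h2
    refine mul_le_mul_of_nonneg_left (measureReal_mono fun w hw => ?_) (by positivity)
    have hw' : ρ * n < ∑ k ∈ Finset.range n,
      1 / √(1 + X k w ^ 2) * f (b (k + 1) w, e (k + 1) w) := hw
    exact hw'.le
  refine h3.trans_eq ?_
  field_simp

end IsNoise

namespace NoiseMoments

variable [IsProbabilityMeasure μ] (hm : NoiseMoments μ ω2 σ2)
include hm

lemma memLp_two {f : ℝ × ℝ → ℝ} (hf : Measurable f) (C : ℝ)
    (h : ∀ z, f z ^ 2 ≤ C * (1 + z.1 ^ 4 + z.2 ^ 4)) : MemLp f 2 μ :=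
  (memLp_two_iff_integrable_sq hf.aestronglyMeasurable).2 <|
    hm.integrable_of_le (hf.pow_const 2) C fun z => by
      rw [abs_of_nonneg (sq_nonneg _)]; exact h z

lemma memLp_fst : MemLp (fun z : ℝ × ℝ => z.1) 2 μ :=
  hm.memLp_two measurable_fst 1 fun z => by
    nlinarith [sq_nonneg (z.1 ^ 2 - 1), sq_nonneg (z.2 ^ 2), sq_nonneg (z.1 ^ 2)]

lemma memLp_snd : MemLp (fun z : ℝ × ℝ => z.2) 2 μ :=
  hm.memLp_two measurable_snd 1 fun z => by
    nlinarith [sq_nonneg (z.2 ^ 2 - 1), sq_nonneg (z.1 ^ 2), sq_nonneg (z.2 ^ 2)]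

lemma memLp_mul : MemLp (fun z : ℝ × ℝ => z.1 * z.2) 2 μ :=
  hm.memLp_two (by fun_prop) 1 fun z => by
    nlinarith [sq_nonneg (z.1 ^ 2 - z.2 ^ 2), sq_nonneg (z.1 ^ 2), sq_nonneg (z.2 ^ 2)]

lemma memLp_fst_sq_sub (c : ℝ) : MemLp (fun z : ℝ × ℝ => z.1 ^ 2 - c) 2 μ :=
  hm.memLp_two (by fun_prop) (2 + 2 * c ^ 2) fun z => by
    nlinarith [sq_nonneg (z.1 ^ 2 + c), sq_nonneg (z.2 ^ 2),
      mul_nonneg (sq_nonneg c) (add_nonneg (sq_nonneg (z.1 ^ 2)) (sq_nonneg (z.2 ^ 2)))]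

lemma memLp_snd_sq_sub (c : ℝ) : MemLp (fun z : ℝ × ℝ => z.2 ^ 2 - c) 2 μ :=
  hm.memLp_two (by fun_prop) (2 + 2 * c ^ 2) fun z => by
    nlinarith [sq_nonneg (z.2 ^ 2 + c), sq_nonneg (z.1 ^ 2),
      mul_nonneg (sq_nonneg c) (add_nonneg (sq_nonneg (z.1 ^ 2)) (sq_nonneg (z.2 ^ 2)))]

lemma integral_fst_sq_sub : ∫ z, (z.1 ^ 2 - ω2) ∂μ = 0 := by
  rw [integral_sub hm.integrable_fst_sq (integrable_const _), hm.b2]; simp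

lemma integral_snd_sq_sub : ∫ z, (z.2 ^ 2 - σ2) ∂μ = 0 := by
  rw [integral_sub hm.integrable_snd_sq (integrable_const _), hm.e2]; simp

end NoiseMoments

/-- Paths are good with probability tending to one. -/
lemma IsNoise.tendsto_measureReal_not_pathGood (hN : IsNoise P b e μ)
    (hm : NoiseMoments μ ω2 σ2) (hω2 : 0 < ω2) (hσ2 : 0 < σ2) {x₀ : ℝ}
    (hesc : Tendsto (fun n : ℕ => (∑ k ∈ Finset.range n,
      ∫ w, 1 / √(1 + rcaProcess φ x₀ b e k w ^ 2) ∂P) / n) atTop (𝓝 0))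
    {ρ : ℝ} (hρ : 0 < ρ) :
    Tendsto (fun n : ℕ => P.real {w | ¬ PathGood ω2 σ2 (fun k => rcaProcess φ x₀ b e k w)
      (fun k => b k w) (fun k => e k w) n ρ}) atTop (𝓝 0) := by
  have := hN.isProbabilityMeasure
  obtain ⟨B, -, hB⟩ := exists_scoreWeight_bound hω2 hσ2
  have hB' : ∀ i x, |scoreWeight σ2 i ω2 x| ≤ B / √(1 + x ^ 2) := fun i x => (hB i ω2 le_rfl x).1
  have w := fun (i : Fin 5) {f : ℝ × ℝ → ℝ} (hf : Measurable f) (hf0 : ∫ z, f z ∂μ = 0)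
    (hf2 : MemLp f 2 μ) => hN.tendsto_measureReal_weighted hesc hf hf0 hf2
      (measurable_scoreWeight σ2 i ω2) (hB' i) hρ
  have t1 := hN.tendsto_measureReal_escape hesc (f := fun z => 1 + z.1 ^ 2 + z.2 ^ 2)
    (by fun_prop) (fun z => by positivity)
    (((integrable_const _).add hm.integrable_fst_sq).add hm.integrable_snd_sq) hρ
  have t2 := hN.tendsto_measureReal_mean measurable_fst hm.b1 hm.memLp_fst hρ
  have t3 := hN.tendsto_measureReal_mean (by fun_prop) hm.integral_fst_sq_sub
    (hm.memLp_fst_sq_sub ω2) hρ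
  have s0 := w 0 measurable_fst hm.b1 hm.memLp_fst
  have s1 := w 1 measurable_snd hm.e1 hm.memLp_snd
  have s2 := w 2 (by fun_prop) hm.integral_fst_sq_sub (hm.memLp_fst_sq_sub ω2)
  have s3 := w 3 (by fun_prop) hm.be hm.memLp_mul
  have s4 := w 4 (by fun_prop) hm.integral_snd_sq_sub (hm.memLp_snd_sq_sub σ2)
  have hsum := ((((((t1.add t2).add t3).add s0).add s1).add s2).add s3).add s4
  simp only [add_zero] at hsum
  refine squeeze_zero (fun n => measureReal_nonneg) (fun n => ?_) hsum
  refine le_trans (measureReal_mono ?_) (((measureReal_union_le _ _).trans (add_le_add_left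
    ((measureReal_union_le _ _).trans (add_le_add_left ((measureReal_union_le _ _).trans
    (add_le_add_left ((measureReal_union_le _ _).trans (add_le_add_left
    ((measureReal_union_le _ _).trans (add_le_add_left ((measureReal_union_le _ _).trans
    (add_le_add_left (measureReal_union_le _ _) _)) _)) _)) _)) _)) _)))
  intro v hv
  by_contra hcon
  simp only [Set.mem_union, Set.mem_ofPred_eq, not_or, not_lt] at hcon
  obtain ⟨⟨⟨⟨⟨⟨⟨c1, c2⟩, c3⟩, c4⟩, c5⟩, c6⟩, c7⟩, c8⟩ := hcon
  exact hv ⟨c1, c2, c3, c4, c5, c6, c7, c8⟩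

end GoodPaths

/-! ### The limiting Gaussian law. -/

section CentralLimit

variable {Ω : Type*} [mΩ : MeasurableSpace Ω] {P : Measure Ω}
  {b e : ℕ → Ω → ℝ} {μ : Measure (ℝ × ℝ)} {ω2 σ2 : ℝ}

/-- The covariance matrix of `(b, b ^ 2)` as a quadratic form. -/
lemma NoiseMoments.dotProduct_asympCov_mulVec [IsProbabilityMeasure μ]
    (hm : NoiseMoments μ ω2 σ2) (t : Fin 2 → ℝ) :
    MemLp (fun z : ℝ × ℝ => t 0 * z.1 + t 1 * (z.1 ^ 2 - ω2)) 2 μ ∧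
    ∫ z, (t 0 * z.1 + t 1 * (z.1 ^ 2 - ω2)) ∂μ = 0 ∧
    ∫ z, (t 0 * z.1 + t 1 * (z.1 ^ 2 - ω2)) ^ 2 ∂μ
      = dotProduct t ((asympCov μ ω2 Prod.fst).mulVec t) := by
  have hq := hm.memLp_fst_sq_sub ω2
  refine ⟨(hm.memLp_fst.const_mul (t 0)).add (hq.const_mul (t 1)), ?_, ?_⟩
  · rw [integral_add (hm.integrable_fst.const_mul _)
      ((hq.integrable one_le_two).const_mul _), integral_const_mul, integral_const_mul, hm.b1,
      hm.integral_fst_sq_sub]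
    simp
  · have i3 : Integrable (fun z : ℝ × ℝ => z.1 ^ 3) μ := hm.integrable_of_le (by fun_prop) 1
      fun z => by
        have h1 : |z.1 ^ 3| = |z.1| * |z.1| ^ 2 := by rw [abs_pow]; ring
        have h2 : z.1 ^ 4 = (|z.1| ^ 2) ^ 2 := by rw [sq_abs]; ring
        rw [h1, h2]
        nlinarith [sq_nonneg (|z.1| - 1), sq_nonneg (|z.1| ^ 2 - |z.1|), abs_nonneg z.1,
          sq_nonneg (z.2 ^ 2), sq_nonneg (|z.1| ^ 2 - 1)]
    have hv : Var[fun z : ℝ × ℝ => z.1 ^ 2; μ] = ∫ z, (z.1 ^ 2 - ω2) ^ 2 ∂μ := by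
      rw [variance_eq_integral (by fun_prop), hm.b2]
    have h1 : ∀ z : ℝ × ℝ, (t 0 * z.1 + t 1 * (z.1 ^ 2 - ω2)) ^ 2
        = t 0 ^ 2 * z.1 ^ 2 + (2 * t 0 * t 1 * (z.1 ^ 3 - ω2 * z.1)
          + t 1 ^ 2 * (z.1 ^ 2 - ω2) ^ 2) := fun z => by ring
    simp_rw [h1]
    have j1 : Integrable (fun z : ℝ × ℝ => ω2 * z.1) μ := hm.integrable_fst.const_mul ω2
    have j2 : Integrable (fun z : ℝ × ℝ => 2 * t 0 * t 1 * (z.1 ^ 3 - ω2 * z.1)) μ :=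
      (i3.sub j1).const_mul _
    have j3 : Integrable (fun z : ℝ × ℝ => t 1 ^ 2 * (z.1 ^ 2 - ω2) ^ 2) μ :=
      hq.integrable_sq.const_mul _
    have j23 : Integrable (fun z : ℝ × ℝ => 2 * t 0 * t 1 * (z.1 ^ 3 - ω2 * z.1)
        + t 1 ^ 2 * (z.1 ^ 2 - ω2) ^ 2) μ := j2.add j3
    rw [integral_add (hm.integrable_fst_sq.const_mul _) j23, integral_add j2 j3,
      integral_const_mul, integral_const_mul, integral_const_mul, integral_sub i3 j1,
      integral_const_mul, hm.b1, hm.b2, ← hv]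
    simp [asympCov, Matrix.mulVec, dotProduct, Fin.sum_univ_two]
    ring

lemma NoiseMoments.posSemidef_asympCov [IsProbabilityMeasure μ] (hm : NoiseMoments μ ω2 σ2) :
    (asympCov μ ω2 Prod.fst).PosSemidef := by
  refine Matrix.PosSemidef.of_dotProduct_mulVec_nonneg ?_ fun t => ?_
  · ext i j
    fin_cases i <;> fin_cases j <;> simp [asympCov]
  · rw [star_trivial, ← (hm.dotProduct_asympCov_mulVec t).2.2]
    exact integral_nonneg fun z => sq_nonneg _

/-- Central limit theorem for the empirical first and second moments of the coefficients. -/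
lemma IsNoise.tendstoInDistribution_moments [IsProbabilityMeasure P] (hN : IsNoise P b e μ)
    (hm : NoiseMoments μ ω2 σ2) :
    TendstoInDistribution (fun (n : ℕ) w => (!₂[(√n)⁻¹ * ∑ k ∈ Finset.range n, b (k + 1) w,
        (√n)⁻¹ * ∑ k ∈ Finset.range n, (b (k + 1) w ^ 2 - ω2)] : EuclideanSpace ℝ (Fin 2)))
      atTop (id : EuclideanSpace ℝ (Fin 2) → EuclideanSpace ℝ (Fin 2)) (fun _ => P)
      (multivariateGaussian 0 (asympCov μ ω2 Prod.fst)) := by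
  have := hN.isProbabilityMeasure
  have hbm := hN.meas_b
  set T : ℕ → Ω → EuclideanSpace ℝ (Fin 2) := fun n w =>
    !₂[(√n)⁻¹ * ∑ k ∈ Finset.range n, b (k + 1) w,
        (√n)⁻¹ * ∑ k ∈ Finset.range n, (b (k + 1) w ^ 2 - ω2)] with hT
  have hTm : ∀ n, Measurable (T n) := fun n => by
    refine (WithLp.measurable_toLp 2 _).comp (measurable_pi_lambda _ fun i => ?_)
    fin_cases i
    · exact (Finset.measurable_sum _ fun k _ => hbm (k + 1)).const_mul _
    · exact (Finset.measurable_sum _ fun k _ =>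
        ((hbm (k + 1)).pow_const 2).sub_const ω2).const_mul _
  refine ⟨fun n => (hTm n).aemeasurable, aemeasurable_id,
    ProbabilityMeasure.tendsto_iff_tendsto_charFun.2 fun t => ?_⟩
  obtain ⟨hf2, hf0, hfv⟩ := hm.dotProduct_asympCov_mulVec t.ofLp
  -- Cramér–Wold: the characteristic function of the vector at `t` is that of the scalar sum of
  -- `f(b, e)` at 1, and the variance of `f` is the quadratic form of the covariance matrix at `t`.
  set f : ℝ × ℝ → ℝ := fun z => t.ofLp 0 * z.1 + t.ofLp 1 * (z.1 ^ 2 - ω2) with hf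
  have hfm : Measurable f := by fun_prop
  set Y : ℕ → Ω → ℝ := fun k w => f (b (k + 1) w, e (k + 1) w) with hY
  have hYm : ∀ k, Measurable (Y k) := fun k => hfm.comp (hN.meas (k + 1))
  have hid : ∀ k, IdentDistrib (Y k) (Y 0) P P := fun k =>
    IdentDistrib.comp (f := fun w => (b (k + 1) w, e (k + 1) w)) (g := fun w => (b 1 w, e 1 w))
      ⟨(hN.meas _).aemeasurable, (hN.meas _).aemeasurable, by rw [hN.law, hN.law]⟩ hfm
  have hYind : iIndepFun Y P :=
    (hN.indep.precomp (g := fun k => k + 1) (add_left_injective 1)).comp (fun _ => f) fun _ => hfm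
  have hY2 : MemLp (Y 0) 2 P := by
    rw [← hN.law 1] at hf2
    exact (memLp_map_measure_iff hfm.aestronglyMeasurable (hN.meas 1).aemeasurable).1 hf2
  have hY0 : ∫ w, Y 0 w ∂P = 0 := by
    rw [← hf0]; exact hN.integral_noise hfm 1
  have hYv : Var[Y 0; P] = ∫ z, f z ^ 2 ∂μ := by
    rw [variance_of_integral_eq_zero (hYm 0).aemeasurable hY0]
    exact hN.integral_noise (hfm.pow_const 2) 1
  have hclt := tendstoInDistribution_inv_sqrt_mul_sum_sub
    (HasLaw.id (μ := gaussianReal 0 Var[Y 0; P].toNNReal)) hY2 hYind hid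
  have h1 := (ProbabilityMeasure.tendsto_iff_tendsto_charFun.1 hclt.tendsto) 1
  simp only [ProbabilityMeasure.coe_mk, Measure.map_id] at h1 ⊢
  rw [charFun_multivariateGaussian hm.posSemidef_asympCov]
  rw [charFun_gaussianReal, Real.coe_toNNReal _ (variance_nonneg _ _), hYv, hfv] at h1
  convert h1 using 2 with n
  · rw [charFun_apply, charFun_apply, integral_map (hTm n).aemeasurable (by fun_prop),
      integral_map (hclt.forall_aemeasurable n) (by fun_prop)]
    congr 1
    ext w
    congr 3
    rw [hY0]
    simp only [hT, hY, hf, PiLp.inner_apply, Fin.sum_univ_two]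
    rw [Finset.sum_add_distrib, ← Finset.mul_sum, ← Finset.mul_sum]
    generalize ∑ k ∈ Finset.range n, b (k + 1) w = s
    generalize ∑ k ∈ Finset.range n, (b (k + 1) w ^ 2 - ω2) = s'
    simp
    ring
  · simp

end CentralLimit

/-! ### Asymptotic linearity and conclusion. -/

section Main

variable {Ω : Type*} [mΩ : MeasurableSpace Ω] {P : Measure Ω}
  {b e : ℕ → Ω → ℝ} {μ : Measure (ℝ × ℝ)} {φ x₀ ω2 σ2 : ℝ}

lemma norm_euclidean_two_le (v : EuclideanSpace ℝ (Fin 2)) : ‖v‖ ≤ |v 0| + |v 1| := by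
  rw [EuclideanSpace.norm_eq, Fin.sum_univ_two, Real.norm_eq_abs, Real.norm_eq_abs]
  rw [Real.sqrt_le_left (by positivity)]
  nlinarith [mul_nonneg (abs_nonneg (v 0)) (abs_nonneg (v 1))]

/-- The estimation error is asymptotically linear in the empirical moments. -/
lemma IsNoise.tendstoInMeasure_linearization [IsProbabilityMeasure P] (hN : IsNoise P b e μ)
    (hm : NoiseMoments μ ω2 σ2) (hω2 : 0 < ω2) (hσ2 : 0 < σ2)
    (hesc : Tendsto (fun n : ℕ => (∑ k ∈ Finset.range n,
      ∫ w, 1 / √(1 + rcaProcess φ x₀ b e k w ^ 2) ∂P) / n) atTop (𝓝 0))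
    {sLo sHi xLo xHi : ℝ} (hxLo : 0 < xLo)
    (hφ : φ ∈ Set.Ioo sLo sHi) (hω : ω2 ∈ Set.Ioo xLo xHi)
    (ηhat : ℕ → Ω → EuclideanSpace ℝ (Fin 2))
    (hqmle : ∀ n, ∀ᵐ w ∂P, IsQMLE (paramRect sLo sHi xLo xHi)
      (fun k => rcaProcess φ x₀ b e k w) n σ2 (ηhat n w)) :
    TendstoInMeasure P ((fun (n : ℕ) w => √n • (ηhat n w - !₂[φ, ω2])) -
      (fun (n : ℕ) w => (!₂[(√n)⁻¹ * ∑ k ∈ Finset.range n, b (k + 1) w,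
        (√n)⁻¹ * ∑ k ∈ Finset.range n, (b (k + 1) w ^ 2 - ω2)] : EuclideanSpace ℝ (Fin 2))))
      atTop 0 := by
  have := hN.isProbabilityMeasure
  obtain ⟨C, ρ₀, hC, hρ₀, hlin⟩ := exists_linearization hxLo hσ2 hφ hω
  rw [tendstoInMeasure_iff_measureReal_norm]
  intro ε hε
  rw [Metric.tendsto_atTop]
  intro δ hδ
  set V := ∫ z, (z.1 ^ 2 - ω2) ^ 2 ∂μ with hV
  have hV0 : 0 ≤ V := integral_nonneg fun z => sq_nonneg _
  -- a level exceeded by the normalised sums with small probability only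
  obtain ⟨M, hM, hM2⟩ : ∃ M : ℝ, 0 < M ∧ (ω2 + V) / M ^ 2 ≤ δ / 4 := by
    refine ⟨√(4 * (ω2 + V) / δ), by positivity, ?_⟩
    rw [Real.sq_sqrt (by positivity)]
    field_simp
    exact le_rfl
  -- `M` is fixed before `ρ`: once the normalised sums are at most `M`, the tolerance is chosen so
  -- that the linearisation error stays below `ε`. Neither depends on `n`.
  obtain ⟨ρ, hρ, hρρ, hρε⟩ : ∃ ρ : ℝ, 0 < ρ ∧ ρ ≤ ρ₀ ∧ C * √ρ * (1 + M + M) < ε := by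
    have hlim : Tendsto (fun ρ : ℝ => C * √ρ * (1 + M + M)) (𝓝[>] 0) (𝓝 0) := by
      have h1 : Continuous fun ρ : ℝ => C * √ρ * (1 + M + M) := by fun_prop
      have h2 := (h1.tendsto 0).mono_left (nhdsWithin_le_nhds (s := Set.Ioi 0))
      simpa using h2
    obtain ⟨ρ, h1, h2⟩ := ((hlim.eventually (gt_mem_nhds hε)).and (Ioc_mem_nhdsGT hρ₀)).exists
    exact ⟨ρ, h2.1, h2.2, h1⟩
  obtain ⟨N, hgood⟩ := Metric.tendsto_atTop.1
    (hN.tendsto_measureReal_not_pathGood hm hω2 hσ2 hesc hρ) (δ / 4) (by positivity)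
  refine ⟨N + 1, fun n hn => ?_⟩
  have hn' : 0 < n := by omega
  have hn0 : (0 : ℝ) < n := by exact_mod_cast hn'
  have hs : 0 < √(n : ℝ) := Real.sqrt_pos.2 hn0
  have p1 := (le_abs_self _).trans_lt
    ((Real.dist_0_eq_abs _).symm.trans_lt (hgood n (by omega)))
  have p2 := hN.measureReal_lt_abs_sum_le' measurable_fst hm.b1 hm.memLp_fst n
    (mul_pos hM hs)
  have p3 := hN.measureReal_lt_abs_sum_le' (by fun_prop) hm.integral_fst_sq_sub
    (hm.memLp_fst_sq_sub ω2) n (mul_pos hM hs)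
  rw [mul_pow, Real.sq_sqrt hn0.le, mul_div_mul_right _ _ hn0.ne'] at p2 p3
  rw [hm.b2] at p2
  rw [← hV] at p3
  have p4 : P.real {w | ¬ IsQMLE (paramRect sLo sHi xLo xHi)
      (fun k => rcaProcess φ x₀ b e k w) n σ2 (ηhat n w)} = 0 :=
    (measureReal_eq_zero_iff).2 (hqmle n)
  have hscale : ∀ x : ℝ, |x| ≤ M * √n → |(√(n : ℝ))⁻¹ * x| ≤ M := fun x hx => by
    rw [abs_mul, abs_of_pos (inv_pos.2 hs), inv_mul_le_iff₀ hs, mul_comm]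
    exact hx
  rw [Real.dist_0_eq_abs, abs_of_nonneg measureReal_nonneg]
  refine lt_of_le_of_lt (le_trans (measureReal_mono ?_) ((measureReal_union_le _ _).trans
    (add_le_add_left ((measureReal_union_le _ _).trans (add_le_add_left
      (measureReal_union_le _ _) _)) _)))
    (lt_of_le_of_lt (add_le_add (add_le_add (add_le_add p1.le p2) p3) p4.le) ?_)
  · intro w hw
    by_contra hcon
    simp only [Set.mem_union, Set.mem_ofPred_eq, not_or, not_lt, not_not] at hcon
    obtain ⟨⟨⟨c1, c2⟩, c3⟩, c4⟩ := hcon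
    have hw' : ε ≤ ‖√(n : ℝ) • (ηhat n w - !₂[φ, ω2])
      - !₂[(√(n : ℝ))⁻¹ * ∑ k ∈ Finset.range n, b (k + 1) w,
        (√(n : ℝ))⁻¹ * ∑ k ∈ Finset.range n, (b (k + 1) w ^ 2 - ω2)] - 0‖ := hw
    have h1 := hlin n _ _ _ ρ (ηhat n w) hn' hρ hρρ (fun k => rfl) c1 c4
    have h2 := hscale _ c2
    have h3 := hscale _ c3
    have h4 := norm_euclidean_two_le (√(n : ℝ) • (ηhat n w - !₂[φ, ω2])
      - !₂[(√(n : ℝ))⁻¹ * ∑ k ∈ Finset.range n, b (k + 1) w,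
        (√(n : ℝ))⁻¹ * ∑ k ∈ Finset.range n, (b (k + 1) w ^ 2 - ω2)])
    rw [sub_zero] at hw'
    have h5 := hw'.trans h4
    simp only [PiLp.sub_apply, PiLp.smul_apply, smul_eq_mul, Matrix.cons_val_zero,
      Matrix.cons_val_one] at h5
    have h6 : C * √ρ * (1 + |(√(n : ℝ))⁻¹ * ∑ k ∈ Finset.range n, b (k + 1) w|
        + |(√(n : ℝ))⁻¹ * ∑ k ∈ Finset.range n, (b (k + 1) w ^ 2 - ω2)|)
        ≤ C * √ρ * (1 + M + M) := by gcongr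
    linarith
  · have : (ω2 + V) / M ^ 2 = ω2 / M ^ 2 + V / M ^ 2 := add_div _ _ _
    linarith

/-- Asymptotic normality of the estimator for a measurable noise sequence. -/
lemma IsNoise.tendstoInDistribution_qmle [IsProbabilityMeasure P] (hN : IsNoise P b e μ)
    (hm : NoiseMoments μ ω2 σ2) (hω2 : 0 < ω2) (hσ2 : 0 < σ2)
    (hne : ∀ᵐ z ∂μ, φ + z.1 ≠ 0)
    (hint : Integrable (fun z => Real.log (φ + z.1)) μ)
    (hlog : 0 ≤ ∫ z, Real.log (φ + z.1) ∂μ)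
    {sLo sHi xLo xHi : ℝ} (hxLo : 0 < xLo)
    (hφ : φ ∈ Set.Ioo sLo sHi) (hω : ω2 ∈ Set.Ioo xLo xHi)
    (ηhat : ℕ → Ω → EuclideanSpace ℝ (Fin 2)) (hmeas : ∀ n, AEMeasurable (ηhat n) P)
    (hqmle : ∀ n, ∀ᵐ w ∂P, IsQMLE (paramRect sLo sHi xLo xHi)
      (fun k => rcaProcess φ x₀ b e k w) n σ2 (ηhat n w)) :
    TendstoInDistribution
      (fun (n : ℕ) (w : Ω) => √n • (ηhat n w - !₂[φ, ω2]))
      atTop (id : EuclideanSpace ℝ (Fin 2) → EuclideanSpace ℝ (Fin 2))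
      (fun _ => P) (multivariateGaussian 0 (asympCov μ ω2 Prod.fst)) :=
  -- Slutsky: the error in the linearisation vanishes in probability.
  tendstoInDistribution_of_tendstoInMeasure_sub _ _ (hN.tendstoInDistribution_moments hm)
    (hN.tendstoInMeasure_linearization hm hω2 hσ2
      (hN.tendsto_mean_inv_sqrt_of_log hm hσ2 hne hint hlog x₀) hxLo hφ hω ηhat hqmle)
    fun n => AEMeasurable.const_smul ((hmeas n).sub_const !₂[φ, ω2]) (√(n : ℝ))

end Main

lemma rcaProcess_congr {Ω : Type*} {φ x₀ : ℝ} {b e b' e' : ℕ → Ω → ℝ} {w : Ω}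
    (hb : ∀ k, b k w = b' k w) (he : ∀ k, e k w = e' k w) (k : ℕ) :
    rcaProcess φ x₀ b e k w = rcaProcess φ x₀ b' e' k w := by
  induction k with
  | zero => rfl
  | succ k ih => simp only [rcaProcess, ih, hb, he]

theorem theorem2p2 {Ω : Type*} [MeasurableSpace Ω] (P : Measure Ω) [IsProbabilityMeasure P]
    (φ x₀ ω2 σ2 : ℝ) (b e : ℕ → Ω → ℝ)
    -- the random vectors `(b k, e k)` are independent and identically distributed
    (hindep : iIndepFun (fun (k : ℕ) (w : Ω) => (b k w, e k w)) P)
    (hident : ∀ k : ℕ,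
      IdentDistrib (fun w => (b k w, e k w)) (fun w => (b 0 w, e 0 w)) P P)
    -- moments
    (hω2 : 0 < ω2) (hσ2 : 0 < σ2)
    (hb4 : Integrable (fun w => b 0 w ^ 4) P)
    (he4 : Integrable (fun w => e 0 w ^ 4) P)
    (hb1 : ∫ w, b 0 w ∂P = 0) (hb2 : ∫ w, b 0 w ^ 2 ∂P = ω2)
    (he1 : ∫ w, e 0 w ∂P = 0) (he2 : ∫ w, e 0 w ^ 2 ∂P = σ2)
    (hcov : cov[b 0, e 0; P] = 0)
    -- `E log |φ + b 0| ≥ 0`, where `log 0 = -∞`; the positive part is integrable because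
    -- `E (b 0) ^ 2 < ∞`, so this says that `φ + b 0 ≠ 0` a.s., that the logarithm is
    -- integrable, and that its integral is nonnegative
    (hne : ∀ᵐ w ∂P, φ + b 0 w ≠ 0)
    (hlogint : Integrable (fun w => Real.log |φ + b 0 w|) P)
    (hlog : 0 ≤ ∫ w, Real.log |φ + b 0 w| ∂P)
    -- the compact parameter set, with the true parameter in its interior
    (sLo sHi xLo xHi : ℝ) (hxLo : 0 < xLo)
    (hφ : φ ∈ Set.Ioo sLo sHi) (hω : ω2 ∈ Set.Ioo xLo xHi)
    -- the estimators, computed with `y = σ2`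
    (ηhat : ℕ → Ω → EuclideanSpace ℝ (Fin 2))
    (hmeas : ∀ n, AEMeasurable (ηhat n) P)
    (hqmle : ∀ n, ∀ᵐ w ∂P, IsQMLE (paramRect sLo sHi xLo xHi)
      (fun k => rcaProcess φ x₀ b e k w) n σ2 (ηhat n w)) :
    (asympCov P ω2 (b 0)).PosSemidef ∧
    TendstoInDistribution
      (fun (n : ℕ) (w : Ω) => Real.sqrt n • (ηhat n w - !₂[φ, ω2]))
      atTop (id : EuclideanSpace ℝ (Fin 2) → EuclideanSpace ℝ (Fin 2))
      (fun _ => P) (multivariateGaussian 0 (asympCov P ω2 (b 0))) := by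
  have hZ : ∀ k, AEMeasurable (fun w => (b k w, e k w)) P := fun k => (hident k).aemeasurable_fst
  have hbae : ∀ k, AEMeasurable (b k) P := fun k => measurable_fst.comp_aemeasurable (hZ k)
  have heae : ∀ k, AEMeasurable (e k) P := fun k => measurable_snd.comp_aemeasurable (hZ k)
  -- The noise is only a.e. measurable, whereas the filtration argument needs measurable
  -- coefficients. The modified process agrees a.s. with the original one at all times
  -- simultaneously.
  set b' : ℕ → Ω → ℝ := fun k => (hbae k).mk (b k) with hb'
  set e' : ℕ → Ω → ℝ := fun k => (heae k).mk (e k) with he'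
  have hbb : ∀ k, b k =ᵐ[P] b' k := fun k => (hbae k).ae_eq_mk
  have hee : ∀ k, e k =ᵐ[P] e' k := fun k => (heae k).ae_eq_mk
  have hpair : ∀ k, (fun w => (b k w, e k w)) =ᵐ[P] fun w => (b' k w, e' k w) := fun k => by
    filter_upwards [hbb k, hee k] with w h1 h2
    rw [h1, h2]
  set μ : Measure (ℝ × ℝ) := P.map (fun w => (b 0 w, e 0 w)) with hμ
  have hμP : IsProbabilityMeasure μ := Measure.isProbabilityMeasure_map (hZ 0)
  have hN : IsNoise P b' e' μ :=
    { meas_b := fun k => (hbae k).measurable_mk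
      meas_e := fun k => (heae k).measurable_mk
      indep := hindep.congr hpair
      law := fun k => by rw [← Measure.map_congr (hpair k), (hident k).map_eq] }
  have hmap : ∀ f : ℝ × ℝ → ℝ, Measurable f → ∫ z, f z ∂μ = ∫ w, f (b 0 w, e 0 w) ∂P :=
    fun f hf => integral_map (hZ 0) hf.aestronglyMeasurable
  have himap : ∀ f : ℝ × ℝ → ℝ, Measurable f → Integrable (fun w => f (b 0 w, e 0 w)) P →
      Integrable f μ := fun f hf h =>
    (integrable_map_measure hf.aestronglyMeasurable (hZ 0)).2 h
  have hlp : ∀ {f : Ω → ℝ}, AEMeasurable f P → Integrable (fun w => f w ^ 4) P →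
      MemLp f 2 P := fun {f} hf h => by
    refine (memLp_two_iff_integrable_sq hf.aestronglyMeasurable).2 <|
      ((integrable_const (1 : ℝ)).add h).mono' (hf.pow_const 2).aestronglyMeasurable
        (Eventually.of_forall fun w => ?_)
    rw [Real.norm_eq_abs, abs_of_nonneg (sq_nonneg _), Pi.add_apply]
    nlinarith [sq_nonneg (f w ^ 2 - 1), sq_nonneg (f w ^ 2)]
  have hm : NoiseMoments μ ω2 σ2 :=
    { int_b := himap (fun z => z.1 ^ 4) (by fun_prop) hb4
      int_e := himap (fun z => z.2 ^ 4) (by fun_prop) he4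
      b1 := (hmap _ measurable_fst).trans hb1
      b2 := (hmap (fun z => z.1 ^ 2) (by fun_prop)).trans hb2
      e1 := (hmap _ measurable_snd).trans he1
      e2 := (hmap (fun z => z.2 ^ 2) (by fun_prop)).trans he2
      be := by
        rw [hmap (fun z => z.1 * z.2) (by fun_prop)]
        -- Both variables are centred, so zero covariance means `E (b e) = 0`.
        have h := covariance_eq_sub (hlp (hbae 0) hb4) (hlp (heae 0) he4)
        rw [hcov, hb1, he1] at h
        simp only [Pi.mul_apply, mul_zero, sub_zero] at h
        exact h.symm }
  have hcovμ : asympCov μ ω2 Prod.fst = asympCov P ω2 (b 0) := by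
    have h3 := hmap (fun z => z.1 ^ 3) (by fun_prop)
    have hv : Var[fun z : ℝ × ℝ => z.1 ^ 2; μ] = Var[fun w => b 0 w ^ 2; P] :=
      variance_map (by fun_prop) (hZ 0)
    simp only [asympCov, h3, hv]
  rw [← hcovμ]
  refine ⟨hm.posSemidef_asympCov, ?_⟩
  have hlm : Measurable fun z : ℝ × ℝ => Real.log (φ + z.1) := by fun_prop
  have hX : ∀ᵐ w ∂P, ∀ k, rcaProcess φ x₀ b e k w = rcaProcess φ x₀ b' e' k w := by
    filter_upwards [ae_all_iff.2 hbb, ae_all_iff.2 hee] with w h1 h2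
    exact rcaProcess_congr h1 h2
  refine hN.tendstoInDistribution_qmle (x₀ := x₀) hm hω2 hσ2 ?_ ?_ ?_ hxLo hφ hω ηhat hmeas fun n => ?_
  · refine (ae_map_iff (hZ 0) ?_).2 hne
    exact (measurableSet_eq_fun (measurable_fst.const_add φ) measurable_const).compl
  · refine himap _ hlm ?_
    simpa only [Real.log_abs] using hlogint
  · rw [hmap _ hlm]
    simpa only [Real.log_abs] using hlog
  · filter_upwards [hqmle n, hX] with w h1 h2
    have h3 : (fun k => rcaProcess φ x₀ b e k w) = fun k => rcaProcess φ x₀ b' e' k w := funext h2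
    rwa [h3] at h1
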